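/- Let $s\ge 2$, $b\ge 2$ and $t\ge 0$ be integers. A $(t,s)$-sequence in base $b$ is a sequence $(\boldsymbol x_n)_{n\ge 0}$ in $[0,1)^s$ such that for all $m\ge t$, $j\ge 0$ each elementary interval $\prod_{i=1}^s[a_ib^{-e_i},(a_i+1)b^{-e_i})$ (with integers $e_i\ge 0$, $0\le a_i<b^{e_i}$) with $e_1+\dots+e_s\le m-t$ contains exactly the proportion of the points $\boldsymbol x_{jb^m},\dots,\boldsymbol x_{jb^m+b^m-1}$ given by its Lebesgue measure. A set $A\subseteq[0,1]^s$ is called pseudo-convex if there are finitely many pairwise disjoint convex sets $A_1,\dots,A_p\subseteq[0,1]^s$ covering $A$ such that for each $j$ either $A_j\subseteq A$ or $A_j\setminus A$ is convex. **Setting.** Let $D\subseteq\mathbb R^{s-1}$ be measurable and let $H_1,\dots,H_k$ be measurable real functions, integrable on $D$ (they may change sign). Put $\psi_{k-\ell+1}=\sum_{i=\ell}^kH_i$, and assume that the target $\psi=\psi_k$ satisfies $\psi\ge 0$ on $D$ and $\int_D\psi>0$. Let $\mathcal L_0=D$ and, for $1\le\ell\le k$, $$\mathcal S_\ell=\{\boldsymbol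 x\in\mathcal L_{\ell-1}:\psi_{k-\ell+1}(\boldsymbol x)<H_\ell(\boldsymbol x)\},\qquad \mathcal L_\ell=\{\boldsymbol x\in\mathcal L_{\ell-1}:\psi_{k-\ell+1}(\boldsymbol x)\ge H_\ell(\boldsymbol x)\}$$ (so $\mathcal S_k=\emptyset$), and $$\alpha_\ell=\frac{\int_{\mathcal S_\ell}\psi_{k-\ell+1}}{\int_D\psi},\qquad \beta_\ell=\frac{\int_{\mathcal L_\ell}H_\ell}{\int_D\psi}.$$ Assume that $H_\ell 1_{\mathcal S_\ell}$ ($1\le \ell<k$) and $H_\ell1_{\mathcal L_\ell}$ ($1\le\ell\le k$) are product densities, i.e. almost everywhere equal to a product $\prod_{j=1}^{s-1}g_j(z_j)$ of nonnegative integrable functions of one variable. For $E=\mathcal S_\ell$ or $E=\mathcal L_\ell$ let $F_j$ be the $j$-th marginal distribution function of the normalized restriction of $H_\ell$ to $E$, and $T_{H_\ell,E}(\boldsymbol u)=(F_1^{-1}(u_1),\dots,F_{s-1}^{-1}(u_{s-1}))$ with $F_j^{-1}(u)=\inf\{z:u\le F_j(z)\}$ for $0<u<1$, and with $F_j^{-1}(0)$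 any fixed real number. A point $\boldsymbol u=(\boldsymbol u',u_s)\in[0,1)^s$ is accepted in step $\ell$ if $\boldsymbol z=T_{H_\ell,\mathcal S_\ell}(\boldsymbol u')$ lies in $\mathcal S_\ell$ and $u_sH_\ell(\boldsymbol z)\le\psi_{k-\ell+1}(\boldsymbol z)$. Assume finally that for $1\le\ell<k$ the set of accepted points of $(0,1)^s$ is pseudo-convex. **Algorithm.** For $\ell=1,\dots,k$ take a $(t,s)$-sequence $(\boldsymbol x_n)$ in base $b$ (it may depend on $\ell$). Let $R_{1,\ell}$ consist of the points $T_{H_\ell,\mathcal S_\ell}(\boldsymbol x_n')$ for the first $\lceil N\alpha_\ell\rceil$ accepted $\boldsymbol x_n$, and $R_{2,\ell}$ of the points $T_{H_\ell,\mathcal L_\ell}(\boldsymbol x_n')$, $0\le n<\lceil N\beta_\ell\rceil$. The sample is $R_N=\bigcup_{\ell=1}^k(R_{1,\ell}\cup R_{2,\ell})$, counted with multiplicity, and its star discrepancy is $$D^*_{N,\psi}(R_N)=\sup_{\boldsymbol t\in\mathbb R^{s-1}}\left|\frac{\#\{\boldsymbol y\in R_N:\boldsymbol y\in(-\boldsymbol\infty,\boldsymbol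 t]\}}{\#R_N}-\frac{\int_{D\cap(-\boldsymbol\infty,\boldsymbol t]}\psi}{\int_D\psi}\right|.$$ **Claim.** There are constants $C_{\mathcal S_\ell,\psi_{k-\ell+1}}$, depending only on $s,b,t$ and on $\mathcal S_\ell,\psi_{k-\ell+1},H_\ell$, and $C_{\mathcal L_\ell,H_\ell}$, depending only on $s,b,t$ and on $\mathcal L_\ell,H_\ell$, such that $$D^*_{N,\psi}(R_N)\le\sum_{\ell=1}^{k-1}\frac{C_{\mathcal S_\ell,\psi_{k-\ell+1}}\,\alpha_\ell^{1-1/s}\log(\alpha_\ell N)}{N^{1/s}}+\sum_{\ell=1}^k\frac{C_{\mathcal L_\ell,H_\ell}\,(\log(\beta_\ell N))^{s-1}}{N}+\frac1N$$ for all choices of the driver sequences and for all $N$ that are large enough in the sense that every nonzero $\alpha_\ell$ ($1\le\ell<k$) satisfies $\alpha_\ell N\ge 2$ and every nonzero $\beta_\ell$ ($1\le\ell\le k$) satisfies $\beta_\ell N\ge2$. Terms with $\alpha_\ell=0$ or $\beta_\ell=0$ are read as $0$. -/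

import Mathlib

open MeasureTheory

noncomputable section

namespace DRAR

/-! ### Nets and sequences in base `b` -/

/-- The `b`-adic elementary interval `∏ i, [a i / b ^ e i, (a i + 1) / b ^ e i)`. -/
def elementaryInterval {s : ℕ} (b : ℕ) (a e : Fin s → ℕ) : Set (Fin s → ℝ) :=
  {x | ∀ i, (a i : ℝ) / (b : ℝ) ^ e i ≤ x i ∧ x i < ((a i : ℝ) + 1) / (b : ℝ) ^ e i}

/-- `J` is fair for the points `P 0, …, P (M - 1)`: the proportion of the points that lie in `J`
is the Lebesgue measure of `J`. -/
def IsFair {s M : ℕ} (P : Fin M → Fin s → ℝ) (J : Set (Fin s → ℝ)) : Prop :=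
  (1 / (M : ℝ)) * ∑ n, J.indicator (fun _ => (1 : ℝ)) (P n) = (volume J).toReal

/-- `(t, m, s)`-net in base `b`: `b ^ m` points of `[0, 1) ^ s` for which all elementary
intervals of order at most `m - t` are fair. -/
def IsNet {s : ℕ} (b t m : ℕ) (P : Fin (b ^ m) → Fin s → ℝ) : Prop :=
  t ≤ m ∧ (∀ n i, 0 ≤ P n i ∧ P n i < 1) ∧
    ∀ a e : Fin s → ℕ, (∀ i, a i < b ^ e i) → ∑ i, e i ≤ m - t →
      IsFair P (elementaryInterval b a e)

/-- `(t, s)`-sequence in base `b`: every block `x (j b ^ m), …, x (j b ^ m + b ^ m - 1)` with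
`m ≥ t` is a `(t, m, s)`-net in base `b`. -/
def IsSequence {s : ℕ} (b t : ℕ) (x : ℕ → Fin s → ℝ) : Prop :=
  ∀ m, t ≤ m → ∀ j : ℕ, IsNet b t m (fun n : Fin (b ^ m) => x (j * b ^ m + n))

/-! ### Pseudo-convex sets -/

/-- A subset `A` of `[0, 1] ^ s` is pseudo-convex if it is covered by finitely many pairwise
disjoint convex subsets `B j` of `[0, 1] ^ s` such that, for each `j`, either `B j ⊆ A` or
`B j \ A` is convex. -/
def IsPseudoConvex {s : ℕ} (A : Set (Fin s → ℝ)) : Prop :=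
  A ⊆ Set.Icc 0 1 ∧ ∃ (p : ℕ) (B : Fin p → Set (Fin s → ℝ)),
    (∀ j, B j ⊆ Set.Icc 0 1 ∧ Convex ℝ (B j)) ∧
    (∀ i j, i ≠ j → Disjoint (B i) (B j)) ∧
    A ⊆ ⋃ j, B j ∧
    ∀ j, B j ⊆ A ∨ Convex ℝ (B j \ A)

/-! ### Star discrepancy with respect to a density -/

/-- Star discrepancy of a finite family `P` of points (counted with multiplicity) with respect to
the unnormalized density `ψ` on `D`. -/
def starDiscrepancy {d : ℕ} (D : Set (Fin d → ℝ)) (ψ : (Fin d → ℝ) → ℝ)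
    (P : Multiset (Fin d → ℝ)) : ℝ :=
  ⨆ t : Fin d → ℝ,
    |(1 / (Multiset.card P : ℝ)) * (P.map ((Set.Iic t).indicator (fun _ => (1 : ℝ)))).sum
      - (1 / ∫ x in D, ψ x) * ∫ x in D ∩ Set.Iic t, ψ x|

/-! ### Inverse transformation of a product density -/

/-- `h`, restricted to `E`, is a product density: it is (almost everywhere) the tensor product of
nonnegative integrable functions of one variable. -/
def IsProductDensityOn {d : ℕ} (E : Set (Fin d → ℝ)) (h : (Fin d → ℝ) → ℝ) : Prop :=
  ∃ g : Fin d → ℝ → ℝ, (∀ j, Integrable (g j) ∧ ∀ z, 0 ≤ g j z) ∧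
    E.indicator h =ᵐ[volume] fun x => ∏ j, g j (x j)

/-- The `j`-th marginal cumulative distribution function of the normalized restriction of `h`
to `E`. -/
def marginalCDF {d : ℕ} (E : Set (Fin d → ℝ)) (h : (Fin d → ℝ) → ℝ) (j : Fin d) (z : ℝ) : ℝ :=
  (∫ y in E ∩ {y | y j ≤ z}, h y) / ∫ y in E, h y

/-- The inverse Rosenblatt transformation (its components in state space) of the density `h`
restricted to `E`, for product densities: the conditional distribution functions are then the
marginal ones, and each coordinate is transformed by the inverse
`u ↦ inf {z | u ≤ F_j z}` of the `j`-th marginal distribution function `F_j`.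
At `u j = 0` the inverse may be `-∞`; there an arbitrary real number `c j` is used. -/
def inverseTransform {d : ℕ} (E : Set (Fin d → ℝ)) (h : (Fin d → ℝ) → ℝ) (c : Fin d → ℝ)
    (u : Fin d → ℝ) : Fin d → ℝ :=
  open Classical in
  fun j => if u j = 0 then c j else sInf {z : ℝ | u j ≤ marginalCDF E h j z}

/-! ### Acceptance-rejection -/

/-- The driver point `u = (u', u_s)` is accepted by the acceptance-rejection method with target
`ψ` and proposal `h` on the domain `E`: with `z = T u'` and height `u_s * h z`, the point `z` lies
in `E` and the height is at most `ψ z`. -/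
def Accepts {d : ℕ} (E : Set (Fin d → ℝ)) (ψ h : (Fin d → ℝ) → ℝ) (c : Fin d → ℝ)
    (u : Fin (d + 1) → ℝ) : Prop :=
  inverseTransform E h c (Fin.init u) ∈ E ∧
    u (Fin.last d) * h (inverseTransform E h c (Fin.init u))
      ≤ ψ (inverseTransform E h c (Fin.init u))

/-- The set of accepted points of the open unit cube (where the choice of `c` plays no role), that
is, the preimage, under the transformation, of the region below the graph of `ψ`. -/
def acceptanceSet {d : ℕ} (E : Set (Fin d → ℝ)) (ψ h : (Fin d → ℝ) → ℝ) :
    Set (Fin (d + 1) → ℝ) :=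
  {u | (∀ i, 0 < u i ∧ u i < 1) ∧ Accepts E ψ h 0 u}

/-- The first `n` accepted (and transformed) points, when the driver sequence is `x`. -/
def acceptedPoints {d : ℕ} (E : Set (Fin d → ℝ)) (ψ h : (Fin d → ℝ) → ℝ) (c : Fin d → ℝ)
    (x : ℕ → Fin (d + 1) → ℝ) (n : ℕ) : Multiset (Fin d → ℝ) :=
  (Multiset.range n).map fun i =>
    inverseTransform E h c (Fin.init (x (Nat.nth (fun r => Accepts E ψ h c (x r)) i)))

/-- The first `n` transformed points, when the driver sequence is `x`. -/
def invertedPoints {d : ℕ} (E : Set (Fin d → ℝ)) (h : (Fin d → ℝ) → ℝ) (c : Fin d → ℝ)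
    (x : ℕ → Fin (d + 1) → ℝ) (n : ℕ) : Multiset (Fin d → ℝ) :=
  (Multiset.range n).map fun i => inverseTransform E h c (Fin.init (x i))

/-! ### The deterministic reduced acceptance-rejection algorithm -/

/-- `∑ i = l, …, k, H i`: the part of the target that remains at step `l`
(the whole target for `l = 1`). -/
def remainder {d : ℕ} (k : ℕ) (H : ℕ → (Fin d → ℝ) → ℝ) (l : ℕ) (x : Fin d → ℝ) : ℝ :=
  ∑ i ∈ Finset.Icc l k, H i x

/-- The region `L l` in which `H l` is sampled by inversion; `L 0 = D`. -/
def regionL {d : ℕ} (D : Set (Fin d → ℝ)) (k : ℕ) (H : ℕ → (Fin d → ℝ) → ℝ) :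
    ℕ → Set (Fin d → ℝ)
  | 0 => D
  | l + 1 => {x | x ∈ regionL D k H l ∧ H (l + 1) x ≤ remainder k H (l + 1) x}

/-- The region `S l` (for `1 ≤ l`) in which acceptance-rejection is used with target
`remainder k H l` and proposal `H l`. -/
def regionS {d : ℕ} (D : Set (Fin d → ℝ)) (k : ℕ) (H : ℕ → (Fin d → ℝ) → ℝ) (l : ℕ) :
    Set (Fin d → ℝ) :=
  {x | x ∈ regionL D k H (l - 1) ∧ remainder k H l x < H l x}

/-- The mass fraction `α l` of the region `S l`. -/
def fractionS {d : ℕ} (D : Set (Fin d → ℝ)) (k : ℕ) (H : ℕ → (Fin d → ℝ) → ℝ) (l : ℕ) : ℝ :=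
  (∫ x in regionS D k H l, remainder k H l x) / ∫ x in D, remainder k H 1 x

/-- The mass fraction `β l` of the region `L l`. -/
def fractionL {d : ℕ} (D : Set (Fin d → ℝ)) (k : ℕ) (H : ℕ → (Fin d → ℝ) → ℝ) (l : ℕ) : ℝ :=
  (∫ x in regionL D k H l, H l x) / ∫ x in D, remainder k H 1 x

/-- The sample produced by the algorithm. In step `l` it uses the driver sequence `x l`, accepts
`⌈N α l⌉` points in `S l`, and inverts `⌈N β l⌉` points in `L l`. -/
def sample {d : ℕ} (D : Set (Fin d → ℝ)) (k : ℕ) (H : ℕ → (Fin d → ℝ) → ℝ)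
    (cS cL : ℕ → Fin d → ℝ) (x : ℕ → ℕ → Fin (d + 1) → ℝ) (N : ℕ) : Multiset (Fin d → ℝ) :=
  ∑ l ∈ Finset.Icc 1 k,
    (acceptedPoints (regionS D k H l) (remainder k H l) (H l) (cS l) (x l)
        ⌈(N : ℝ) * fractionS D k H l⌉₊
      + invertedPoints (regionL D k H l) (H l) (cL l) (x l) ⌈(N : ℝ) * fractionL D k H l⌉₊)

end DRAR

end

/-! The target splits as `ψ = ∑ (ψ_{k-ℓ+1} 1_{S_ℓ} + H_ℓ 1_{L_ℓ})` almost for free: on `L_ℓ` the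
function `H_ℓ` is removed and the nonnegative rest is passed on, while `S_ℓ` is dealt with
completely in step `ℓ` (`setIntegral_remainder_eq`). It therefore suffices to bound the error of
each piece on orthants `(-∞, y]`, uniformly in `y` and in the driver sequence, and to add the
rounding errors of the sizes `⌈N γ⌉` (`abs_combined_sub_le`).

Inversion pieces. For a product density the inverse transformation acts coordinatewise, and `T u ≤
y` means `u j ≤ F_j (y j)`. Orthants thus become boxes anchored at the origin in the first `d = s -
1` coordinates, whose volume is the normalized mass of the orthant. The digit expansion of each side
cuts such a box into fair elementary intervals plus small remainders, which gives an error of order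
`m ^ (d - 1)` for a net (`IsNet.abs_sum_boxInd_sub_le`); summing over the nets in the base `b`
expansion of `N` gives `(log N) ^ d`.

Acceptance-rejection pieces. The accepted driver points over `(-∞, y]` fill the intersection of the
pseudo-convex acceptance set with a convex box, that is, a signed combination of a fixed number of
convex sets. A convex set meets few cells of a grid of mesh `b ^ (-k)` without containing them,
namely `O(b ^ (k (s - 1)))` (`card_boundaryCells_le`). With `k` about `m / s` the cells are fair,
and the error for a sequence is `O(N ^ (1 - 1 / s))`. By Tonelli and transport of measure the volume
in question is the target mass divided by the proposal mass
(`IsFactorization.volume_acceptancePart`). The number of driver points needed for `n` acceptances is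
`O(n)`, so the bound carries over to the first `n` accepted points (`exists_abs_sum_nth_sub_le`).

The inverse at a zero coordinate is arbitrary, but driver points with such a coordinate lie in null
convex sets, so the same bounds show that they are rare. The logarithm in the acceptance terms and
the final `1 / N` are slack in this argument. -/

noncomputable section

namespace DRAR

/-! ### Elementary intervals and nets -/

/-- The indicator function of the `b`-adic interval `[a / b ^ e, (a + 1) / b ^ e)` on `[0, ∞)`. -/
def digitInd (b a e : ℕ) (x : ℝ) : ℝ := if ⌊x * (b : ℝ) ^ e⌋₊ = a then 1 else 0

theorem digitInd_nonneg (b a e : ℕ) (x : ℝ) : 0 ≤ digitInd b a e x := by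
  unfold digitInd; split_ifs <;> norm_num

theorem digitInd_zero {b : ℕ} {x : ℝ} (h1 : x < 1) : digitInd b 0 0 x = 1 := by
  have : ⌊x⌋₊ = 0 := Nat.floor_eq_zero.2 h1
  simp [digitInd, this]

theorem mem_elementaryInterval_iff {s b : ℕ} (hb : 0 < b) {a e : Fin s → ℕ} {x : Fin s → ℝ}
    (hx : ∀ i, 0 ≤ x i) :
    x ∈ elementaryInterval b a e ↔ ∀ i, ⌊x i * (b : ℝ) ^ e i⌋₊ = a i := by
  have hb' : ∀ i, (0 : ℝ) < (b : ℝ) ^ e i := fun i => by positivity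
  simp only [elementaryInterval, Set.mem_ofPred_eq]
  refine forall_congr' fun i => ?_
  rw [Nat.floor_eq_iff (mul_nonneg (hx i) (hb' i).le), div_le_iff₀ (hb' i), lt_div_iff₀ (hb' i)]

theorem elementaryInterval_eq_pi {s b : ℕ} (a e : Fin s → ℕ) :
    elementaryInterval b a e =
      Set.univ.pi fun i => Set.Ico ((a i : ℝ) / (b : ℝ) ^ e i) (((a i : ℝ) + 1) / (b : ℝ) ^ e i) := by
  ext x; simp [elementaryInterval, Set.mem_pi]

theorem volume_elementaryInterval {s b : ℕ} (a e : Fin s → ℕ) :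
    volume (elementaryInterval b a e) = ENNReal.ofReal (1 / (b : ℝ) ^ ∑ i, e i) := by
  rw [elementaryInterval_eq_pi, Real.volume_pi_Ico, ← ENNReal.ofReal_prod_of_nonneg]
  · congr 1
    rw [← Finset.prod_pow_eq_pow_sum, one_div, ← Finset.prod_inv_distrib]
    refine Finset.prod_congr rfl fun i _ => ?_
    rw [← sub_div]; simp
  · intro i _
    rw [← sub_div]; simp

theorem prod_digitInd {s b : ℕ} (hb : 0 < b) {a e : Fin s → ℕ} {x : Fin s → ℝ}
    (hx : ∀ i, 0 ≤ x i) :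
    ∏ i, digitInd b (a i) (e i) (x i) =
      (elementaryInterval b a e).indicator (fun _ => (1 : ℝ)) x := by
  classical
  by_cases h : x ∈ elementaryInterval b a e
  · rw [Set.indicator_of_mem h]
    rw [mem_elementaryInterval_iff hb hx] at h
    exact Finset.prod_eq_one fun i _ => by simp [digitInd, h i]
  · rw [Set.indicator_of_notMem h]
    rw [mem_elementaryInterval_iff hb hx] at h
    push Not at h
    obtain ⟨i, hi⟩ := h
    exact Finset.prod_eq_zero (Finset.mem_univ i) (by simp [digitInd, hi])

theorem IsNet.sum_indicator {s b t m : ℕ} (hb : 0 < b) {P : Fin (b ^ m) → Fin s → ℝ}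
    (hP : IsNet b t m P) {a e : Fin s → ℕ} (ha : ∀ i, a i < b ^ e i) (he : ∑ i, e i ≤ m - t) :
    ∑ n, (elementaryInterval b a e).indicator (fun _ => (1 : ℝ)) (P n)
      = (b : ℝ) ^ m / (b : ℝ) ^ ∑ i, e i := by
  have h := hP.2.2 a e ha he
  have hb' : (0 : ℝ) < (b : ℝ) ^ m := by positivity
  rw [IsFair, volume_elementaryInterval, ENNReal.toReal_ofReal (by positivity)] at h
  push_cast at h
  field_simp at h ⊢
  linarith

theorem IsNet.sum_prod_digitInd {s b t m : ℕ} (hb : 0 < b) {P : Fin (b ^ m) → Fin s → ℝ}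
    (hP : IsNet b t m P) {a e : Fin s → ℕ} (ha : ∀ i, a i < b ^ e i) (he : ∑ i, e i ≤ m - t) :
    ∑ n, ∏ i, digitInd b (a i) (e i) (P n i) = (b : ℝ) ^ m / (b : ℝ) ^ ∑ i, e i := by
  rw [← hP.sum_indicator hb ha he]
  exact Finset.sum_congr rfl fun n _ => prod_digitInd hb fun i => (hP.2.1 n i).1

/-! ### Digit expansion of an anchored interval -/

/-- The indicator function of the interval `(-∞, v]`. -/
def anchorInd (v x : ℝ) : ℝ := if x ≤ v then 1 else 0

theorem anchorInd_nonneg (v x : ℝ) : 0 ≤ anchorInd v x := by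
  unfold anchorInd; split_ifs <;> norm_num

theorem anchorInd_le_one (v x : ℝ) : anchorInd v x ≤ 1 := by
  unfold anchorInd; split_ifs <;> norm_num

/-- The left end of the block of numerators at level `j` in the digit expansion of `[0, v]`. -/
def digitStart (b : ℕ) (v : ℝ) : ℕ → ℕ
  | 0 => 0
  | j + 1 => b * ⌊v * (b : ℝ) ^ j⌋₊

/-- The numerators of the elementary intervals of order `j` in the digit expansion of `[0, v]`. -/
def digitBlock (b : ℕ) (v : ℝ) (j : ℕ) : Finset ℕ :=
  Finset.Ico (digitStart b v j) ⌊v * (b : ℝ) ^ j⌋₊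

theorem mul_floor_le_floor_mul {b : ℕ} {y : ℝ} (hy : 0 ≤ y) : b * ⌊y⌋₊ ≤ ⌊y * b⌋₊ := by
  refine Nat.le_floor ?_
  push_cast
  rw [mul_comm]
  exact mul_le_mul_of_nonneg_right (Nat.floor_le hy) (Nat.cast_nonneg b)

theorem floor_mul_lt {b : ℕ} (hb : 0 < b) {y : ℝ} (hy : 0 ≤ y) : ⌊y * b⌋₊ < b * ⌊y⌋₊ + b := by
  have hb' : (0 : ℝ) < b := by exact_mod_cast hb
  rw [Nat.floor_lt (by positivity)]
  push_cast
  nlinarith [Nat.lt_floor_add_one y]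

theorem digitStart_le {b : ℕ} {v : ℝ} (hv : 0 ≤ v) (j : ℕ) :
    digitStart b v j ≤ ⌊v * (b : ℝ) ^ j⌋₊ := by
  cases j with
  | zero => simp [digitStart]
  | succ j =>
    rw [digitStart, pow_succ, ← mul_assoc]
    exact mul_floor_le_floor_mul (by positivity)

/-- At positive levels the cardinality is a base `b` digit of `v`. At level `0` the block is
nonempty only for `v = 1`, and `1 ≤ b - 1` covers that case. -/
theorem card_digitBlock_le {b : ℕ} (hb : 2 ≤ b) {v : ℝ} (hv : 0 ≤ v) (hv1 : v ≤ 1) (j : ℕ) :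
    (digitBlock b v j).card ≤ b - 1 := by
  rw [digitBlock, Nat.card_Ico]
  cases j with
  | zero =>
    have : ⌊v⌋₊ ≤ 1 := Nat.floor_le_of_le (by simpa using hv1)
    simp only [digitStart, pow_zero, mul_one]
    omega
  | succ j =>
    rw [digitStart, pow_succ, ← mul_assoc]
    have := floor_mul_lt (b := b) (by omega) (y := v * (b : ℝ) ^ j) (by positivity)
    omega

theorem lt_of_mem_digitBlock {b : ℕ} {v : ℝ} (hv1 : v ≤ 1) {j a : ℕ}
    (ha : a ∈ digitBlock b v j) : a < b ^ j := by
  rw [digitBlock, Finset.mem_Ico] at ha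
  refine lt_of_lt_of_le ha.2 (Nat.floor_le_of_le ?_)
  push_cast
  nlinarith [show (0 : ℝ) ≤ (b : ℝ) ^ j by positivity]

theorem sum_digitInd_digitBlock {b : ℕ} (v x : ℝ) (j : ℕ) :
    ∑ a ∈ digitBlock b v j, digitInd b a j x =
      if ⌊x * (b : ℝ) ^ j⌋₊ ∈ digitBlock b v j then 1 else 0 := by
  simp [digitInd]

theorem floor_mem_digitBlock_succ {b : ℕ} (hb : 0 < b) {v x : ℝ} (hx : 0 ≤ x) (j : ℕ) :
    ⌊x * (b : ℝ) ^ (j + 1)⌋₊ ∈ digitBlock b v (j + 1) ↔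
      ⌊v * (b : ℝ) ^ j⌋₊ ≤ ⌊x * (b : ℝ) ^ j⌋₊ ∧
        ⌊x * (b : ℝ) ^ (j + 1)⌋₊ < ⌊v * (b : ℝ) ^ (j + 1)⌋₊ := by
  rw [digitBlock, Finset.mem_Ico, digitStart]
  refine and_congr_left fun _ => ?_
  have hb' : (0 : ℝ) < b := by exact_mod_cast hb
  rw [Nat.le_floor_iff (by positivity), Nat.le_floor_iff (by positivity), pow_succ, ← mul_assoc]
  push_cast
  rw [mul_comm (b : ℝ)]
  exact mul_le_mul_iff_left₀ hb'

/-- The partial digit expansion of `[0, v]` is `[0, ⌊v b ^ j⌋ / b ^ j)`. -/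
theorem sum_digitInd {b : ℕ} (hb : 0 < b) {v x : ℝ} (hv : 0 ≤ v) (hx : 0 ≤ x) (κ : ℕ) :
    ∑ j ∈ Finset.range (κ + 1), ∑ a ∈ digitBlock b v j, digitInd b a j x =
      if ⌊x * (b : ℝ) ^ κ⌋₊ < ⌊v * (b : ℝ) ^ κ⌋₊ then 1 else 0 := by
  induction κ with
  | zero =>
    rw [zero_add, Finset.sum_range_one, sum_digitInd_digitBlock]
    simp [digitBlock, digitStart]
  | succ κ ih =>
    rw [Finset.sum_range_succ, ih, sum_digitInd_digitBlock]
    simp only [floor_mem_digitBlock_succ hb hx]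
    -- A point left of the truncation of `v` at level `κ` stays left of the finer truncation, so the
    -- new block is disjoint from the earlier ones. The rest is a case check on the four floors.
    have key : ⌊x * (b : ℝ) ^ κ⌋₊ < ⌊v * (b : ℝ) ^ κ⌋₊ →
        ⌊x * (b : ℝ) ^ (κ + 1)⌋₊ < ⌊v * (b : ℝ) ^ (κ + 1)⌋₊ := by
      intro h
      rw [pow_succ, ← mul_assoc, ← mul_assoc]
      have h1 := floor_mul_lt hb (y := x * (b : ℝ) ^ κ) (by positivity)
      have h2 := mul_floor_le_floor_mul (b := b) (y := v * (b : ℝ) ^ κ) (by positivity)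
      nlinarith
    generalize ⌊x * (b : ℝ) ^ κ⌋₊ = p, ⌊v * (b : ℝ) ^ κ⌋₊ = q,
      ⌊x * (b : ℝ) ^ (κ + 1)⌋₊ = p', ⌊v * (b : ℝ) ^ (κ + 1)⌋₊ = q' at key ⊢
    split_ifs <;> first | (exfalso; omega) | norm_num

/-- The sum telescopes, since level `j + 1` contributes the difference of two consecutive
truncations of `v`. -/
theorem sum_digitLength {b : ℕ} (hb : 0 < b) {v : ℝ} (hv : 0 ≤ v) (κ : ℕ) :
    ∑ j ∈ Finset.range (κ + 1), ∑ _a ∈ digitBlock b v j, 1 / (b : ℝ) ^ j =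
      ⌊v * (b : ℝ) ^ κ⌋₊ / (b : ℝ) ^ κ := by
  have hb' : (0 : ℝ) < b := by exact_mod_cast hb
  induction κ with
  | zero => simp [digitBlock, digitStart]
  | succ κ ih =>
    rw [Finset.sum_range_succ, ih]
    simp only [digitBlock, Finset.sum_const, Nat.card_Ico, nsmul_eq_mul,
      Nat.cast_sub (digitStart_le hv (κ + 1))]
    simp only [digitStart]
    push_cast
    field_simp
    ring

/-- The remainder of the digit expansion of `[0, v]` lies in one elementary interval. -/
theorem anchorInd_sub_nonneg {b : ℕ} (hb : 0 < b) {v x : ℝ} (hv : 0 ≤ v) (hx : 0 ≤ x) (κ : ℕ) :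
    0 ≤ anchorInd v x -
      ∑ j ∈ Finset.range (κ + 1), ∑ a ∈ digitBlock b v j, digitInd b a j x := by
  have hb' : (0 : ℝ) < (b : ℝ) ^ κ := by positivity
  rw [sum_digitInd hb hv hx, anchorInd]
  split_ifs with h1 h2 h2 <;> norm_num
  exfalso
  have := Nat.floor_le_floor (mul_le_mul_of_nonneg_right (not_le.1 h1).le hb'.le)
  omega

/-- A point between the truncation of `v` and `v` has the same numerator at level `κ` as `v`. -/
theorem anchorInd_sub_le {b : ℕ} (hb : 0 < b) {v x : ℝ} (hv : 0 ≤ v) (hx : 0 ≤ x) (κ : ℕ) :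
    anchorInd v x - ∑ j ∈ Finset.range (κ + 1), ∑ a ∈ digitBlock b v j, digitInd b a j x ≤
      digitInd b ⌊v * (b : ℝ) ^ κ⌋₊ κ x := by
  have hb' : (0 : ℝ) < (b : ℝ) ^ κ := by positivity
  rw [sum_digitInd hb hv hx, anchorInd, digitInd]
  split_ifs with h1 h2 h2 <;> norm_num
  · have := Nat.floor_le_floor (mul_le_mul_of_nonneg_right h1 hb'.le)
    omega

/-! ### Boxes and nets -/

/-- One factor of the indicator function of a box that is anchored in the coordinates in `W` and
elementary in the others. -/
def boxInd {s : ℕ} (b : ℕ) (W : Finset (Fin s)) (v : Fin s → ℝ) (a e : Fin s → ℕ) (i : Fin s)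
    (x : ℝ) : ℝ :=
  if i ∈ W then anchorInd (v i) x else digitInd b (a i) (e i) x

/-- One side length of a box that is anchored in the coordinates in `W` and elementary in the
others. -/
def boxLength {s : ℕ} (b : ℕ) (W : Finset (Fin s)) (v : Fin s → ℝ) (e : Fin s → ℕ) (i : Fin s) :
    ℝ :=
  if i ∈ W then v i else 1 / (b : ℝ) ^ e i

/-- The factor in the discrepancy bound for boxes that are anchored in `q` coordinates. -/
def boxBound (b K : ℕ) : ℕ → ℝ
  | 0 => 0
  | q + 1 => ((K : ℝ) + 1) * ((b : ℝ) - 1) * boxBound b K q + 1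

theorem boxBound_nonneg {b K : ℕ} (hb : 1 ≤ b) (q : ℕ) : 0 ≤ boxBound b K q := by
  have hb' : (0 : ℝ) ≤ (b : ℝ) - 1 := by
    have : (1 : ℝ) ≤ b := by exact_mod_cast hb
    linarith
  induction q with
  | zero => simp [boxBound]
  | succ q ih => rw [boxBound]; positivity

/-- Elementary boxes are fair, so `boxBound` starts at `0` and the first anchored coordinate costs
only the remainder `1`. Hence `q + 1` anchored coordinates produce only the power `q`. -/
theorem boxBound_succ_le {b K : ℕ} (hb : 1 ≤ b) (q : ℕ) :
    boxBound b K (q + 1) ≤ ((b : ℝ) * (K + 1)) ^ q := by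
  have hb' : (1 : ℝ) ≤ b := by exact_mod_cast hb
  have hK : (0 : ℝ) ≤ K := Nat.cast_nonneg K
  have h1 : (1 : ℝ) ≤ (b : ℝ) * (K + 1) := by nlinarith
  induction q with
  | zero => simp [boxBound]
  | succ q ih =>
    rw [boxBound, pow_succ]
    have hp : (1 : ℝ) ≤ ((b : ℝ) * (K + 1)) ^ q := one_le_pow₀ h1
    have := mul_le_mul_of_nonneg_left ih
      (mul_nonneg (by linarith : (0 : ℝ) ≤ (K : ℝ) + 1) (by linarith : (0 : ℝ) ≤ (b : ℝ) - 1))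
    nlinarith

section
variable {s b : ℕ} {W : Finset (Fin s)} {v : Fin s → ℝ} {a e : Fin s → ℕ}

theorem boxInd_nonneg (i : Fin s) (x : ℝ) : 0 ≤ boxInd b W v a e i x := by
  unfold boxInd
  split_ifs
  exacts [anchorInd_nonneg _ _, digitInd_nonneg _ _ _ _]

/-- Encloses a partly anchored box in an elementary one, which is then fair and bounds the count of
a remainder. -/
theorem boxInd_le_digitInd (hW : ∀ i ∈ W, e i = 0 ∧ a i = 0) (i : Fin s) {x : ℝ} (hx : x < 1) :
    boxInd b W v a e i x ≤ digitInd b (a i) (e i) x := by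
  unfold boxInd
  split_ifs with h
  · rw [(hW i h).1, (hW i h).2, digitInd_zero hx]
    exact anchorInd_le_one _ _
  · exact le_rfl

theorem boxLength_nonneg (hv : ∀ i, 0 ≤ v i) (i : Fin s) : 0 ≤ boxLength b W v e i := by
  unfold boxLength
  split_ifs
  exacts [hv i, by positivity]

theorem boxLength_le (hv : ∀ i, v i ≤ 1) (hW : ∀ i ∈ W, e i = 0) (i : Fin s) :
    boxLength b W v e i ≤ 1 / (b : ℝ) ^ e i := by
  unfold boxLength
  split_ifs with h
  · simpa [hW i h] using hv i
  · exact le_rfl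

/-- Trading the anchored coordinate `i₀` for an elementary interval changes one factor; the other
factors are shared by all intervals of the digit expansion. -/
theorem prod_boxInd_update {i₀ : Fin s} (hi₀ : i₀ ∉ W) (a' j : ℕ) (x : Fin s → ℝ) :
    ∏ i, boxInd b W v (Function.update a i₀ a') (Function.update e i₀ j) i (x i) =
      digitInd b a' j (x i₀) *
        ∏ i ∈ Finset.univ.erase i₀, boxInd b (insert i₀ W) v a e i (x i) := by
  rw [← Finset.mul_prod_erase _ _ (Finset.mem_univ i₀)]
  congr 1
  · simp [boxInd, hi₀]
  · refine Finset.prod_congr rfl fun i hi => ?_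
    have hne := Finset.ne_of_mem_erase hi
    simp [boxInd, hne]

theorem prod_boxLength_update {i₀ : Fin s} (hi₀ : i₀ ∉ W) (j : ℕ) :
    ∏ i, boxLength b W v (Function.update e i₀ j) i =
      1 / (b : ℝ) ^ j * ∏ i ∈ Finset.univ.erase i₀, boxLength b (insert i₀ W) v e i := by
  rw [← Finset.mul_prod_erase _ _ (Finset.mem_univ i₀)]
  congr 1
  · simp [boxLength, hi₀]
  · refine Finset.prod_congr rfl fun i hi => ?_
    have hne := Finset.ne_of_mem_erase hi
    simp [boxLength, hne]

theorem sum_update_of_eq_zero {i₀ : Fin s} (h0 : e i₀ = 0) (j : ℕ) :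
    ∑ i, Function.update e i₀ j i = j + ∑ i, e i := by
  rw [Finset.sum_update_of_mem (Finset.mem_univ i₀),
    ← Finset.add_sum_erase _ e (Finset.mem_univ i₀), h0, zero_add, Finset.sdiff_singleton_eq_erase]

end

/-- The discrepancy of a net with respect to a box that is anchored in the coordinates in `W`. -/
theorem IsNet.abs_sum_boxInd_sub_le {s b t m : ℕ} (hb : 2 ≤ b) {P : Fin (b ^ m) → Fin s → ℝ}
    (hP : IsNet b t m P) {v : Fin s → ℝ} (hv : ∀ i, 0 ≤ v i ∧ v i ≤ 1) (W : Finset (Fin s)) :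
    ∀ a e : Fin s → ℕ, (∀ i ∈ W, e i = 0 ∧ a i = 0) → (∀ i, a i < b ^ e i) →
      ∑ i, e i ≤ m - t →
      |∑ n, ∏ i, boxInd b W v a e i (P n i) - (b : ℝ) ^ m * ∏ i, boxLength b W v e i| ≤
        (b : ℝ) ^ t * boxBound b (m - t) W.card := by
  classical
  have hb0 : 0 < b := by omega
  have hb' : (0 : ℝ) < b := by exact_mod_cast hb0
  have hb1 : (1 : ℝ) ≤ b := by exact_mod_cast (by omega : 1 ≤ b)
  induction W using Finset.induction_on with
  | empty =>
    intro a e _ ha he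
    simp only [boxInd, boxLength, Finset.notMem_empty, if_false]
    rw [hP.sum_prod_digitInd hb0 ha he, Finset.prod_div_distrib, Finset.prod_pow_eq_pow_sum]
    simp [boxBound, div_eq_mul_inv]
  | insert i₀ W hi₀ ih =>
    intro a e hW ha he
    have hWi₀ := hW i₀ (Finset.mem_insert_self _ _)
    have hWW : ∀ i ∈ W, e i = 0 ∧ a i = 0 := fun i hi => hW i (Finset.mem_insert_of_mem hi)
    -- `κ` is the order that the budget `m - t` leaves for coordinate `i₀`; the digit expansion of
    -- `v i₀` is cut off there.
    obtain ⟨κ, hκ⟩ := Nat.exists_eq_add_of_le he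
    set R : Fin (b ^ m) → ℝ := fun n =>
      ∏ i ∈ Finset.univ.erase i₀, boxInd b (insert i₀ W) v a e i (P n i) with hR
    set Λ : ℝ := ∏ i ∈ Finset.univ.erase i₀, boxLength b (insert i₀ W) v e i with hΛ
    have hR0 : ∀ n, 0 ≤ R n := fun n => Finset.prod_nonneg fun i _ => boxInd_nonneg _ _
    have hΛ0 : 0 ≤ Λ := Finset.prod_nonneg fun i _ => boxLength_nonneg (fun i => (hv i).1) _
    have hΛ1 : Λ ≤ 1 / (b : ℝ) ^ ∑ i, e i := by
      rw [← Finset.add_sum_erase _ e (Finset.mem_univ i₀), hWi₀.1, zero_add,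
        ← Finset.prod_pow_eq_pow_sum, one_div, ← Finset.prod_inv_distrib]
      refine Finset.prod_le_prod (fun i _ => boxLength_nonneg (fun i => (hv i).1) _) fun i _ => ?_
      rw [← one_div]
      exact boxLength_le (fun i => (hv i).2) (fun i hi => (hW i hi).1) i
    have hx : ∀ n, 0 ≤ P n i₀ := fun n => (hP.2.1 n i₀).1
    set β : ℝ := (b : ℝ) ^ t * boxBound b (m - t) W.card with hβ
    have hβ0 : 0 ≤ β := mul_nonneg (by positivity) (boxBound_nonneg (by omega) _)
    have hterm : ∀ j ∈ Finset.range (κ + 1), ∀ a' ∈ digitBlock b (v i₀) j,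
        |∑ n, digitInd b a' j (P n i₀) * R n - (b : ℝ) ^ m * (1 / (b : ℝ) ^ j * Λ)| ≤ β := by
      intro j hj a' ha'
      have h := ih (Function.update a i₀ a') (Function.update e i₀ j) ?_ ?_ ?_
      · simpa only [prod_boxInd_update hi₀, prod_boxLength_update hi₀] using h
      · intro i hi
        have hne : i ≠ i₀ := fun h => hi₀ (h ▸ hi)
        simpa [hne] using hWW i hi
      · intro i
        by_cases h : i = i₀
        · subst h
          simpa using lt_of_mem_digitBlock (hv i).2 ha'
        · simpa [h] using ha i
      · rw [sum_update_of_eq_zero hWi₀.1, hκ]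
        have := Finset.mem_range.1 hj
        omega
    set E : ℝ → ℝ := fun x =>
      ∑ j ∈ Finset.range (κ + 1), ∑ a' ∈ digitBlock b (v i₀) j, digitInd b a' j x with hE
    set ρ : ℝ := ⌊v i₀ * (b : ℝ) ^ κ⌋₊ / (b : ℝ) ^ κ with hρ
    -- The induction hypothesis applies to each of the at most `(κ + 1) (b - 1)` intervals of the
    -- expansion.
    have hmain : |∑ n, E (P n i₀) * R n - (b : ℝ) ^ m * (ρ * Λ)| ≤
        ((m - t : ℕ) + 1) * ((b : ℝ) - 1) * β := by
      have h1 : ∑ n, E (P n i₀) * R n - (b : ℝ) ^ m * (ρ * Λ) =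
          ∑ j ∈ Finset.range (κ + 1), ∑ a' ∈ digitBlock b (v i₀) j,
            (∑ n, digitInd b a' j (P n i₀) * R n - (b : ℝ) ^ m * (1 / (b : ℝ) ^ j * Λ)) := by
        have h2 : (b : ℝ) ^ m * (ρ * Λ) = ∑ j ∈ Finset.range (κ + 1),
            ∑ _a ∈ digitBlock b (v i₀) j, (b : ℝ) ^ m * (1 / (b : ℝ) ^ j * Λ) := by
          rw [hρ, ← sum_digitLength hb0 (hv i₀).1]
          simp only [Finset.sum_mul, Finset.mul_sum]
        rw [h2]
        simp only [Finset.sum_sub_distrib]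
        congr 1
        simp only [hE, Finset.sum_mul]
        rw [Finset.sum_comm]
        exact Finset.sum_congr rfl fun j _ => Finset.sum_comm
      rw [h1]
      calc _ ≤ ∑ j ∈ Finset.range (κ + 1), ∑ a' ∈ digitBlock b (v i₀) j, β :=
            (Finset.abs_sum_le_sum_abs _ _).trans (Finset.sum_le_sum fun j hj =>
              (Finset.abs_sum_le_sum_abs _ _).trans (Finset.sum_le_sum fun a' ha' =>
                hterm j hj a' ha'))
        _ ≤ ∑ j ∈ Finset.range (κ + 1), ((b : ℝ) - 1) * β := by
            refine Finset.sum_le_sum fun j _ => ?_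
            rw [Finset.sum_const, nsmul_eq_mul]
            refine mul_le_mul_of_nonneg_right ?_ hβ0
            have := card_digitBlock_le hb (hv i₀).1 (hv i₀).2 j
            have h2 : ((digitBlock b (v i₀) j).card : ℝ) ≤ ((b - 1 : ℕ) : ℝ) := by
              exact_mod_cast this
            rwa [Nat.cast_sub (by omega), Nat.cast_one] at h2
        _ = ((κ : ℝ) + 1) * (((b : ℝ) - 1) * β) := by
            rw [Finset.sum_const, Finset.card_range, nsmul_eq_mul]; push_cast; ring
        _ ≤ _ := by
            have : (κ : ℝ) ≤ (m - t : ℕ) := by exact_mod_cast (by omega : κ ≤ m - t)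
            rw [mul_assoc]
            exact mul_le_mul_of_nonneg_right (by linarith)
              (mul_nonneg (by linarith) hβ0)
    have hmt : (b : ℝ) ^ m / (b : ℝ) ^ (κ + ∑ i, e i) = (b : ℝ) ^ t := by
      have : m = t + (κ + ∑ i, e i) := by have := hP.1; omega
      rw [this, pow_add]
      field_simp
    -- The count and the scaled volume of the remainder both lie in `[0, b ^ t]`, so their
    -- difference adds at most `b ^ t`: this is the `+ 1` in the recursion of `boxBound`.
    have hrest0 : 0 ≤ ∑ n, (anchorInd (v i₀) (P n i₀) - E (P n i₀)) * R n :=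
      Finset.sum_nonneg fun n _ =>
        mul_nonneg (anchorInd_sub_nonneg hb0 (hv i₀).1 (hx n) κ) (hR0 n)
    have hrest1 : ∑ n, (anchorInd (v i₀) (P n i₀) - E (P n i₀)) * R n ≤ (b : ℝ) ^ t := by
      have h1 : ∀ n, (anchorInd (v i₀) (P n i₀) - E (P n i₀)) * R n ≤
          digitInd b ⌊v i₀ * (b : ℝ) ^ κ⌋₊ κ (P n i₀) * R n := fun n =>
        mul_le_mul_of_nonneg_right (anchorInd_sub_le hb0 (hv i₀).1 (hx n) κ) (hR0 n)
      refine (Finset.sum_le_sum fun n _ => h1 n).trans ?_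
      by_cases hlt : ⌊v i₀ * (b : ℝ) ^ κ⌋₊ < b ^ κ
      · rw [← hmt, ← sum_update_of_eq_zero hWi₀.1,
          ← hP.sum_prod_digitInd hb0 (a := Function.update a i₀ ⌊v i₀ * (b : ℝ) ^ κ⌋₊)]
        · refine Finset.sum_le_sum fun n _ => ?_
          rw [← prod_boxInd_update hi₀]
          refine Finset.prod_le_prod (fun i _ => boxInd_nonneg _ _) fun i _ =>
            boxInd_le_digitInd ?_ i (hP.2.1 n i).2
          intro i hi
          have hne : i ≠ i₀ := fun h => hi₀ (h ▸ hi)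
          simpa [hne] using hWW i hi
        · intro i
          by_cases h : i = i₀
          · subst h; simpa using hlt
          · simpa [h] using ha i
        · rw [sum_update_of_eq_zero hWi₀.1]
          omega
      -- Here `v i₀ = 1`, and the remainder interval starts at `1`, beyond all points of the net.
      · refine (Finset.sum_nonpos fun n _ => ?_).trans (by positivity)
        have hfl : ⌊P n i₀ * (b : ℝ) ^ κ⌋₊ < b ^ κ := by
          rw [Nat.floor_lt (mul_nonneg (hx n) (by positivity))]
          push_cast
          have : (0 : ℝ) < (b : ℝ) ^ κ := by positivity
          nlinarith [(hP.2.1 n i₀).2]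
        rw [digitInd, if_neg (by omega), zero_mul]
    have hlen : 0 ≤ v i₀ - ρ ∧ v i₀ - ρ ≤ 1 / (b : ℝ) ^ κ := by
      have hbk : (0 : ℝ) < (b : ℝ) ^ κ := by positivity
      have h0 : 0 ≤ v i₀ * (b : ℝ) ^ κ := mul_nonneg (hv i₀).1 hbk.le
      constructor
      · rw [sub_nonneg, hρ, div_le_iff₀ hbk]
        exact Nat.floor_le h0
      · rw [hρ, sub_le_iff_le_add, ← add_div, le_div_iff₀ hbk]
        linarith [Nat.lt_floor_add_one (v i₀ * (b : ℝ) ^ κ)]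
    have hlen0 : 0 ≤ (b : ℝ) ^ m * ((v i₀ - ρ) * Λ) :=
      mul_nonneg (by positivity) (mul_nonneg hlen.1 hΛ0)
    have hlen1 : (b : ℝ) ^ m * ((v i₀ - ρ) * Λ) ≤ (b : ℝ) ^ t := by
      rw [← hmt, pow_add, div_eq_mul_inv, mul_inv, ← one_div, ← one_div]
      exact mul_le_mul_of_nonneg_left (mul_le_mul hlen.2 hΛ1 hΛ0 (by positivity)) (by positivity)
    have hleft : ∑ n, ∏ i, boxInd b (insert i₀ W) v a e i (P n i) =
        ∑ n, (anchorInd (v i₀) (P n i₀) - E (P n i₀)) * R n + ∑ n, E (P n i₀) * R n := by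
      rw [← Finset.sum_add_distrib]
      refine Finset.sum_congr rfl fun n _ => ?_
      rw [← Finset.mul_prod_erase _ _ (Finset.mem_univ i₀)]
      simp only [boxInd, Finset.mem_insert_self, if_true, hR]
      ring
    have hright : ∏ i, boxLength b (insert i₀ W) v e i = v i₀ * Λ := by
      rw [← Finset.mul_prod_erase _ _ (Finset.mem_univ i₀)]
      simp [boxLength, hΛ]
    rw [hleft, hright, Finset.card_insert_of_notMem hi₀, boxBound]
    rw [abs_le] at hmain ⊢
    have hfin : (b : ℝ) ^ t * (((m - t : ℕ) + 1) * ((b : ℝ) - 1) * boxBound b (m - t) W.card + 1) =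
        ((m - t : ℕ) + 1) * ((b : ℝ) - 1) * β + (b : ℝ) ^ t := by rw [hβ]; ring
    rw [hfin]
    constructor <;> nlinarith [hmain.1, hmain.2]

/-- The discrepancy of a net with respect to a box anchored in its first coordinates. -/
theorem IsNet.abs_sum_anchorInd_sub_le {d b t m : ℕ} (hd : 1 ≤ d) (hb : 2 ≤ b)
    {P : Fin (b ^ m) → Fin (d + 1) → ℝ} (hP : IsNet b t m P) {v : Fin d → ℝ}
    (hv : ∀ i, 0 ≤ v i ∧ v i ≤ 1) :
    |∑ n, ∏ i : Fin d, anchorInd (v i) (P n i.castSucc) - (b : ℝ) ^ m * ∏ i, v i| ≤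
      (b : ℝ) ^ t * ((b : ℝ) * (m + 1)) ^ (d - 1) := by
  classical
  -- The last coordinate is kept elementary of order `0`, so only `d` coordinates are anchored; its
  -- filler value `1` never enters the volume.
  have h := hP.abs_sum_boxInd_sub_le hb (v := Fin.snoc (α := fun _ => ℝ) v 1)
    (fun i => by
      refine Fin.lastCases ?_ (fun i => ?_) i
      · simp
      · simpa using hv i)
    (Finset.univ.map Fin.castSuccEmb) 0 0 (by simp) (by simp) (by simp)
  have hmem : ∀ i : Fin d, i.castSucc ∈ Finset.univ.map Fin.castSuccEmb := fun i =>
    Finset.mem_map.2 ⟨i, Finset.mem_univ _, rfl⟩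
  have hlast : Fin.last d ∉ Finset.univ.map (Fin.castSuccEmb (n := d)) := by
    simp
  have hl : ∀ n, digitInd b 0 0 (P n (Fin.last d)) = 1 := fun n => digitInd_zero (hP.2.1 n _).2
  simp only [Fin.prod_univ_castSucc, boxInd, boxLength, hmem, hlast, if_true, if_false,
    Fin.snoc_castSucc, Pi.zero_apply, hl, pow_zero, div_one, mul_one, Finset.card_map,
    Finset.card_univ, Fintype.card_fin] at h
  refine h.trans (mul_le_mul_of_nonneg_left ?_ (by positivity))
  obtain ⟨q, rfl⟩ := Nat.exists_eq_add_of_le' hd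
  refine (boxBound_succ_le (by omega) q).trans ?_
  rw [Nat.add_sub_cancel]
  have : ((m - t : ℕ) : ℝ) ≤ m := by exact_mod_cast Nat.sub_le m t
  exact pow_le_pow_left₀ (by positivity)
    (mul_le_mul_of_nonneg_left (by linarith) (Nat.cast_nonneg b)) q

/-! ### From nets to sequences -/

theorem abs_sum_range_mul_le {g : ℕ → ℝ} {M : ℕ} {β : ℝ}
    (hg : ∀ j, |∑ r ∈ Finset.range M, g (j * M + r)| ≤ β) (j q : ℕ) :
    |∑ r ∈ Finset.range (q * M), g (j * M + r)| ≤ q * β := by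
  induction q with
  | zero => simp
  | succ q ih =>
    rw [add_mul, one_mul, Finset.sum_range_add]
    refine (abs_add_le _ _).trans ?_
    have h := hg (j + q)
    simp only [add_mul, add_assoc] at h
    push_cast
    linarith

/-- The base `b` expansion of `N` cuts the range into at most `b - 1` aligned blocks of each length
`b ^ i` with `t ≤ i < m`, and fewer than `b ^ t` leftover terms, each at most `1`. The offset `j` is
arbitrary because the leftover after the longest blocks starts elsewhere. -/
theorem abs_sum_range_le_of_lt_pow {b t : ℕ} (hb : 2 ≤ b) {g β : ℕ → ℝ} (hg1 : ∀ n, |g n| ≤ 1)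
    (hβ : ∀ m, 0 ≤ β m)
    (hg : ∀ m, t ≤ m → ∀ j, |∑ r ∈ Finset.range (b ^ m), g (j * b ^ m + r)| ≤ β m)
    {m : ℕ} (hm : t ≤ m) :
    ∀ j N, N < b ^ m → |∑ r ∈ Finset.range N, g (j * b ^ m + r)| ≤
      (b : ℝ) ^ t + ((b : ℝ) - 1) * ∑ i ∈ Finset.range m, β i := by
  have hb1 : (1 : ℝ) ≤ b := by exact_mod_cast (by omega : 1 ≤ b)
  induction m, hm using Nat.le_induction with
  | base =>
    intro j N hN
    have h1 : |∑ r ∈ Finset.range N, g (j * b ^ t + r)| ≤ N := by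
      refine (Finset.abs_sum_le_sum_abs _ _).trans ?_
      refine (Finset.sum_le_sum fun r _ => hg1 _).trans ?_
      simp
    have h2 : (N : ℝ) ≤ (b : ℝ) ^ t := by exact_mod_cast hN.le
    have h3 : 0 ≤ ((b : ℝ) - 1) * ∑ i ∈ Finset.range t, β i :=
      mul_nonneg (by linarith) (Finset.sum_nonneg fun i _ => hβ i)
    linarith
  | succ m hm ih =>
    intro j N hN
    have hbm : 0 < b ^ m := by positivity
    have hq : N / b ^ m < b := by
      rw [Nat.div_lt_iff_lt_mul hbm, ← pow_succ']
      exact hN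
    have h1 : |∑ r ∈ Finset.range (N / b ^ m * b ^ m), g (j * b * b ^ m + r)| ≤
        (N / b ^ m : ℕ) * β m := abs_sum_range_mul_le (hg m hm) _ _
    have h2 := ih (j * b + N / b ^ m) (N % b ^ m) (Nat.mod_lt _ hbm)
    have hsplit : ∑ r ∈ Finset.range N, g (j * b ^ (m + 1) + r) =
        ∑ r ∈ Finset.range (N / b ^ m * b ^ m), g (j * b * b ^ m + r) +
          ∑ r ∈ Finset.range (N % b ^ m), g ((j * b + N / b ^ m) * b ^ m + r) := by
      conv_lhs => rw [← Nat.div_add_mod' N (b ^ m), Finset.sum_range_add]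
      congr 1
      · refine Finset.sum_congr rfl fun r _ => ?_
        rw [pow_succ', mul_assoc]
      · refine Finset.sum_congr rfl fun r _ => ?_
        rw [pow_succ', add_mul, mul_assoc, add_assoc]
    rw [hsplit, Finset.sum_range_succ]
    refine (abs_add_le _ _).trans ?_
    have h3 : ((N / b ^ m : ℕ) : ℝ) ≤ (b : ℝ) - 1 := by
      have : N / b ^ m + 1 ≤ b := hq
      have : ((N / b ^ m : ℕ) : ℝ) + 1 ≤ b := by exact_mod_cast this
      linarith
    have h4 := mul_le_mul_of_nonneg_right h3 (hβ m)
    linarith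

theorem abs_sum_range_le_sum_log {b t : ℕ} (hb : 2 ≤ b) {g β : ℕ → ℝ} (hg1 : ∀ n, |g n| ≤ 1)
    (hβ : ∀ m, 0 ≤ β m)
    (hg : ∀ m, t ≤ m → ∀ j, |∑ r ∈ Finset.range (b ^ m), g (j * b ^ m + r)| ≤ β m) (N : ℕ) :
    |∑ n ∈ Finset.range N, g n| ≤
      (b : ℝ) ^ t + ((b : ℝ) - 1) * ∑ i ∈ Finset.range (t + (Nat.log b N + 1)), β i := by
  have hN : N < b ^ (t + (Nat.log b N + 1)) :=
    (Nat.lt_pow_succ_log_self (by omega) N).trans_le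
      (Nat.pow_le_pow_right (by omega) (by omega))
  simpa using abs_sum_range_le_of_lt_pow hb hg1 hβ hg (Nat.le_add_right t _) 0 N hN

theorem IsSequence.mem_Ico {s b t : ℕ} (hb : 2 ≤ b) {x : ℕ → Fin s → ℝ} (hx : IsSequence b t x)
    (n : ℕ) (i : Fin s) : 0 ≤ x n i ∧ x n i < 1 := by
  have hbt : 0 < b ^ t := by positivity
  have h := (hx t le_rfl (n / b ^ t)).2.1 ⟨n % b ^ t, Nat.mod_lt _ hbt⟩ i
  simpa only [Nat.div_add_mod'] using h

/-- The summand `1` is at most `log N / log 2` because `N ≥ 2`, whence the factor `2`. -/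
theorem natLog_add_one_le {b N : ℕ} (hb : 2 ≤ b) (hN : 2 ≤ N) :
    (Nat.log b N : ℝ) + 1 ≤ 2 / Real.log 2 * Real.log N := by
  have h2 : 0 < Real.log 2 := Real.log_pos (by norm_num)
  have hlog : Real.log 2 ≤ Real.log N :=
    Real.log_le_log (by norm_num) (by exact_mod_cast hN)
  have h1 : (b : ℝ) ^ Nat.log b N ≤ N := by exact_mod_cast Nat.pow_log_le_self b (by omega)
  have h3 : Nat.log b N * Real.log 2 ≤ Real.log N := by
    calc (Nat.log b N : ℝ) * Real.log 2 = Real.log ((2 : ℝ) ^ Nat.log b N) := by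
          rw [Real.log_pow]
      _ ≤ Real.log N := Real.log_le_log (by positivity)
          ((pow_le_pow_left₀ (by norm_num) (by exact_mod_cast hb) _).trans h1)
  rw [div_mul_eq_mul_div, le_div_iff₀ h2]
  linarith

/-- The discrepancy of a `(t, d + 1)`-sequence with respect to boxes that are anchored in the first
`d` coordinates. -/
theorem exists_abs_sum_anchorInd_sub_le {d b : ℕ} (t : ℕ) (hd : 1 ≤ d) (hb : 2 ≤ b) :
    ∃ C : ℝ, 0 ≤ C ∧ ∀ x : ℕ → Fin (d + 1) → ℝ, IsSequence b t x →
      ∀ v : Fin d → ℝ, (∀ i, 0 ≤ v i ∧ v i ≤ 1) → ∀ N : ℕ, 2 ≤ N →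
        |∑ n ∈ Finset.range N, ∏ i, anchorInd (v i) (x n i.castSucc) - N * ∏ i, v i| ≤
          C * Real.log N ^ d := by
  have hb1 : (1 : ℝ) ≤ b := by exact_mod_cast (by omega : 1 ≤ b)
  have h2 : 0 < Real.log 2 := Real.log_pos (by norm_num)
  refine ⟨((b : ℝ) ^ t + ((b : ℝ) - 1) * ((b : ℝ) ^ t * (b : ℝ) ^ (d - 1))) *
    ((t + 1) * (2 / Real.log 2)) ^ d, ?_, ?_⟩
  · have : (0 : ℝ) ≤ (b : ℝ) - 1 := by linarith
    positivity
  intro x hx v hv N hN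
  set g : ℕ → ℝ := fun n => ∏ i, anchorInd (v i) (x n i.castSucc) - ∏ i, v i with hg
  have hsum : ∀ M j, ∑ r ∈ Finset.range M, g (j + r) =
      ∑ r ∈ Finset.range M, ∏ i, anchorInd (v i) (x (j + r) i.castSucc) - M * ∏ i, v i := by
    intro M j
    simp [hg, Finset.sum_sub_distrib]
  have hg1 : ∀ n, |g n| ≤ 1 := by
    intro n
    have a0 : 0 ≤ ∏ i, anchorInd (v i) (x n i.castSucc) :=
      Finset.prod_nonneg fun i _ => anchorInd_nonneg _ _
    have a1 : ∏ i, anchorInd (v i) (x n i.castSucc) ≤ 1 :=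
      Finset.prod_le_one (fun i _ => anchorInd_nonneg _ _) fun i _ => anchorInd_le_one _ _
    have b0 : 0 ≤ ∏ i, v i := Finset.prod_nonneg fun i _ => (hv i).1
    have b1 : ∏ i, v i ≤ 1 := Finset.prod_le_one (fun i _ => (hv i).1) fun i _ => (hv i).2
    rw [abs_le]; constructor <;> simp only [hg] <;> linarith
  have hmain := abs_sum_range_le_sum_log (t := t) hb hg1
    (β := fun m => (b : ℝ) ^ t * ((b : ℝ) * (m + 1)) ^ (d - 1)) (fun m => by positivity)
    (fun m hm j => by
      rw [hsum, Finset.sum_range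
        (f := fun r => ∏ i, anchorInd (v i) (x (j * b ^ m + r) i.castSucc))]
      have := (hx m hm j).abs_sum_anchorInd_sub_le hd hb hv
      push_cast at this ⊢
      exact this) N
  have h0 := hsum N 0
  simp only [zero_add] at h0
  rw [h0] at hmain
  refine hmain.trans ?_
  set L := Nat.log b N + 1 with hL
  -- `Y` dominates both the number of levels and the base of the `(d - 1)`-th power at each level,
  -- so the whole sum is absorbed into `Y ^ d`.
  set Y : ℝ := (t + 1) * (2 / Real.log 2 * Real.log N) with hY
  have hLY : ((t : ℝ) + L) ≤ Y := by
    have hl := natLog_add_one_le hb hN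
    have hL1 : (1 : ℝ) ≤ L := by exact_mod_cast (by omega : 1 ≤ L)
    have hL' : (L : ℝ) ≤ 2 / Real.log 2 * Real.log N := by rw [hL]; push_cast; exact hl
    have ht : (0 : ℝ) ≤ t := Nat.cast_nonneg t
    calc (t : ℝ) + L ≤ (t + 1) * L := by nlinarith
      _ ≤ Y := mul_le_mul_of_nonneg_left hL' (by linarith)
  have hY1 : 1 ≤ Y := by
    have hL1 : (1 : ℝ) ≤ L := by exact_mod_cast (by omega : 1 ≤ L)
    have ht : (0 : ℝ) ≤ t := Nat.cast_nonneg t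
    linarith
  have hsumβ : ∑ i ∈ Finset.range (t + L), (b : ℝ) ^ t * ((b : ℝ) * (i + 1)) ^ (d - 1) ≤
      (b : ℝ) ^ t * (b : ℝ) ^ (d - 1) * Y ^ d := by
    calc _ ≤ ∑ i ∈ Finset.range (t + L), (b : ℝ) ^ t * ((b : ℝ) * Y) ^ (d - 1) := by
          refine Finset.sum_le_sum fun i hi => ?_
          have hi' : (i : ℝ) + 1 ≤ t + L := by exact_mod_cast Finset.mem_range.1 hi
          gcongr
          linarith
      _ = ((t : ℝ) + L) * ((b : ℝ) ^ t * ((b : ℝ) * Y) ^ (d - 1)) := by simp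
      _ ≤ Y * ((b : ℝ) ^ t * ((b : ℝ) * Y) ^ (d - 1)) := by gcongr
      _ = _ := by
          obtain ⟨q, rfl⟩ := Nat.exists_eq_add_of_le' hd
          rw [Nat.add_sub_cancel, mul_pow, pow_succ]; ring
  have hYd : 1 ≤ Y ^ d := one_le_pow₀ hY1
  have h5 : (b : ℝ) ^ t ≤ (b : ℝ) ^ t * Y ^ d := le_mul_of_one_le_right (by positivity) hYd
  have h6 := mul_le_mul_of_nonneg_left hsumβ (by linarith : (0 : ℝ) ≤ (b : ℝ) - 1)
  have h7 : ((t + 1) * (2 / Real.log 2)) ^ d * Real.log N ^ d = Y ^ d := by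
    rw [← mul_pow, hY]; ring
  rw [mul_assoc, h7]
  linarith

/-- If a set of indices agrees, apart from points with a zero coordinate, with the indices of the
points in an anchored box, then its counting function deviates little from its expectation. -/
theorem exists_abs_sum_indicator_sub_le {d b : ℕ} (t : ℕ) (hd : 1 ≤ d) (hb : 2 ≤ b) :
    ∃ C : ℝ, 0 ≤ C ∧ ∀ x : ℕ → Fin (d + 1) → ℝ, IsSequence b t x →
      ∀ v : Fin d → ℝ, (∀ i, 0 ≤ v i ∧ v i ≤ 1) → ∀ Q : Set ℕ,
        (∀ n, (∀ i : Fin d, x n i.castSucc ≠ 0) → (n ∈ Q ↔ ∀ i, x n i.castSucc ≤ v i)) →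
        ∀ N : ℕ, 2 ≤ N →
          |∑ n ∈ Finset.range N, Q.indicator (fun _ => (1 : ℝ)) n - N * ∏ i, v i| ≤
            C * Real.log N ^ d := by
  classical
  obtain ⟨C, hC, h⟩ := exists_abs_sum_anchorInd_sub_le t hd hb
  refine ⟨(d + 1) * C, by positivity, fun x hx v hv Q hQ N hN => ?_⟩
  have hmain := h x hx v hv N hN
  -- A coordinate hyperplane is the anchored box with one side `0` and the others `1`. Its volume is
  -- zero, so the box bound limits the number of points on it.
  have hzero : ∀ i : Fin d, ∑ n ∈ Finset.range N, anchorInd 0 (x n i.castSucc) ≤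
      C * Real.log N ^ d := by
    intro i
    have h1 := h x hx (Function.update 1 i 0) (fun j => by
      by_cases hj : j = i
      · subst hj; simp
      · simp [hj]) N hN
    have h2 : ∏ j, Function.update (1 : Fin d → ℝ) i 0 j = 0 :=
      Finset.prod_eq_zero (Finset.mem_univ i) (by simp)
    have h3 : ∀ n, ∏ j, anchorInd (Function.update (1 : Fin d → ℝ) i 0 j) (x n j.castSucc) =
        anchorInd 0 (x n i.castSucc) := by
      intro n
      rw [← Finset.mul_prod_erase _ _ (Finset.mem_univ i), Finset.prod_eq_one, mul_one]
      · simp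
      · intro j hj
        have hne := Finset.ne_of_mem_erase hj
        simp [hne, anchorInd, ((hx.mem_Ico hb) n j.castSucc).2.le]
    simp only [h2, h3, mul_zero, sub_zero] at h1
    exact (le_abs_self _).trans h1
  have hdiff : ∀ n, |Q.indicator (fun _ => (1 : ℝ)) n - ∏ i, anchorInd (v i) (x n i.castSucc)| ≤
      ∑ i : Fin d, anchorInd 0 (x n i.castSucc) := by
    intro n
    by_cases hn : ∀ i : Fin d, x n i.castSucc ≠ 0
    · have : Q.indicator (fun _ => (1 : ℝ)) n = ∏ i, anchorInd (v i) (x n i.castSucc) := by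
        by_cases hq : n ∈ Q
        · rw [Set.indicator_of_mem hq, Finset.prod_eq_one]
          intro i _
          simp [anchorInd, (hQ n hn).1 hq i]
        · rw [Set.indicator_of_notMem hq]
          rw [hQ n hn] at hq
          push Not at hq
          obtain ⟨i, hi⟩ := hq
          exact (Finset.prod_eq_zero (Finset.mem_univ i) (by simp [anchorInd, hi])).symm
      rw [this, sub_self, abs_zero]
      exact Finset.sum_nonneg fun i _ => anchorInd_nonneg _ _
    · push Not at hn
      obtain ⟨i, hi⟩ := hn
      have h1 : (1 : ℝ) ≤ ∑ i : Fin d, anchorInd 0 (x n i.castSucc) := by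
        calc (1 : ℝ) = anchorInd 0 (x n i.castSucc) := by simp [anchorInd, hi]
          _ ≤ _ := Finset.single_le_sum (f := fun i : Fin d => anchorInd 0 (x n i.castSucc))
            (fun i _ => anchorInd_nonneg _ _) (Finset.mem_univ i)
      have a0 : 0 ≤ ∏ i, anchorInd (v i) (x n i.castSucc) :=
        Finset.prod_nonneg fun i _ => anchorInd_nonneg _ _
      have a1 : ∏ i, anchorInd (v i) (x n i.castSucc) ≤ 1 :=
        Finset.prod_le_one (fun i _ => anchorInd_nonneg _ _) fun i _ => anchorInd_le_one _ _
      have b0 : 0 ≤ Q.indicator (fun _ => (1 : ℝ)) n :=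
        Set.indicator_nonneg (fun _ _ => zero_le_one) n
      have b1 : Q.indicator (fun _ => (1 : ℝ)) n ≤ 1 :=
        Set.indicator_le_self' (fun _ _ => zero_le_one) n
      rw [abs_le]; constructor <;> linarith
  have htot : |∑ n ∈ Finset.range N, Q.indicator (fun _ => (1 : ℝ)) n -
      ∑ n ∈ Finset.range N, ∏ i, anchorInd (v i) (x n i.castSucc)| ≤ d * (C * Real.log N ^ d) := by
    rw [← Finset.sum_sub_distrib]
    refine (Finset.abs_sum_le_sum_abs _ _).trans ?_
    refine (Finset.sum_le_sum fun n _ => hdiff n).trans ?_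
    rw [Finset.sum_comm]
    refine (Finset.sum_le_sum fun i _ => hzero i).trans ?_
    simp
  rw [abs_le] at *
  constructor <;> nlinarith [hmain.1, hmain.2, htot.1, htot.2]

/-! ### Convex sets and grids -/

/-- A point outside a convex set can be weakly separated from it, in finite dimension. -/
theorem exists_separating_functional {s : ℕ} (hs : 1 ≤ s) {C : Set (Fin s → ℝ)} (hC : Convex ℝ C)
    {p : Fin s → ℝ} (hp : p ∉ C) :
    ∃ f : Fin s → ℝ, f ≠ 0 ∧ ∀ c ∈ C, ∑ i, f i * c i ≤ ∑ i, f i * p i := by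
  suffices h : ∃ f : (Fin s → ℝ) →ₗ[ℝ] ℝ, f ≠ 0 ∧ ∀ c ∈ C, f c ≤ f p by
    obtain ⟨f, hf, h⟩ := h
    have hfx : ∀ x, f x = ∑ i, f (Pi.single i 1) * x i := by
      intro x
      rw [LinearMap.pi_apply_eq_sum_univ f x]
      refine Finset.sum_congr rfl fun i _ => ?_
      rw [smul_eq_mul, mul_comm]
      congr 2
      ext j
      simp [Pi.single_apply, eq_comm]
    refine ⟨fun i => f (Pi.single i 1), ?_, fun c hc => ?_⟩
    · intro h0
      refine hf (LinearMap.ext fun x => ?_)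
      rw [hfx]
      simp [fun i => congrFun h0 i]
    · rw [← hfx, ← hfx]
      exact h c hc
  -- The set need not be closed, so separation is only weak, and the functional must be shown to be
  -- nonzero separately when the interior is empty.
  by_cases hint : (interior C).Nonempty
  · obtain ⟨f, hf, h⟩ := geometric_hahn_banach_of_nonempty_interior_point hC
      (fun h => hp (interior_subset h)) hint
    exact ⟨f.toLinearMap, fun h0 => hf (by ext x; exact LinearMap.congr_fun h0 x), h⟩
  rcases C.eq_empty_or_nonempty with rfl | ⟨c₀, hc₀⟩
  · refine ⟨LinearMap.proj ⟨0, hs⟩, fun h0 => ?_, by simp⟩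
    have := LinearMap.congr_fun h0 (fun _ => 1)
    simp at this
  -- A nonempty convex set without interior lies in a proper affine subspace, on which some nonzero
  -- functional is constant; its sign is chosen to suit `p`.
  rw [hC.interior_nonempty_iff_affineSpan_eq_top] at hint
  have hdir : (affineSpan ℝ C).direction < ⊤ := by
    refine lt_top_iff_ne_top.2 fun h => hint ?_
    rwa [AffineSubspace.direction_eq_top_iff_of_nonempty
      ⟨c₀, subset_affineSpan ℝ C hc₀⟩] at h
  obtain ⟨f, hf, hker⟩ := Submodule.exists_le_ker_of_lt_top _ hdir
  have hconst : ∀ c ∈ C, f c = f c₀ := by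
    intro c hc
    have : c - c₀ ∈ (affineSpan ℝ C).direction :=
      AffineSubspace.vsub_mem_direction (subset_affineSpan ℝ C hc) (subset_affineSpan ℝ C hc₀)
    have := hker this
    rw [LinearMap.mem_ker, map_sub] at this
    linarith
  rcases le_total (f c₀) (f p) with h | h
  · exact ⟨f, hf, fun c hc => (hconst c hc).trans_le h⟩
  · exact ⟨-f, neg_ne_zero.2 hf, fun c hc => by simp [hconst c hc, h]⟩

/-- A set of grid cells with the property that the cells on each line parallel to the `i`-th axis
are close together has few elements. -/
theorem card_le_of_line_gap {s q m : ℕ} (hm : 0 < m) (B : Finset (Fin s → ℕ)) (i : Fin s)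
    (hB : ∀ a ∈ B, ∀ j, a j < q)
    (hgap : ∀ a ∈ B, ∀ a' ∈ B, (∀ j, j ≠ i → a' j = a j) → a i < a' i → a' i < a i + m) :
    B.card ≤ m * q ^ (s - 1) := by
  classical
  have hcard : (Fintype.piFinset fun j => if j = i then Finset.range m else Finset.range q).card =
      m * q ^ (s - 1) := by
    rw [Fintype.card_piFinset, ← Finset.mul_prod_erase _ _ (Finset.mem_univ i)]
    congr 1
    · simp
    · rw [Finset.prod_congr rfl (g := fun _ => q) (fun j hj => by
        simp [Finset.ne_of_mem_erase hj])]
      simp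
  rw [← hcard]
  -- Reducing the `i`-th coordinate modulo `m` is injective: two cells with the same image lie on
  -- one line, at a distance that is divisible by `m` yet less than `m`.
  refine Finset.card_le_card_of_injOn (fun a j => if j = i then a i % m else a j) ?_ ?_
  · intro a ha
    simp only [Finset.mem_coe, Fintype.mem_piFinset]
    intro j
    split_ifs
    · exact Finset.mem_range.2 (Nat.mod_lt _ hm)
    · exact Finset.mem_range.2 (hB a ha j)
  · have key : ∀ a ∈ B, ∀ a' ∈ B, (∀ j, j ≠ i → a' j = a j) → a' i % m = a i % m →
        ¬ a i < a' i := by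
      intro a ha a' ha' hj hmod hlt
      have h1 := hgap a ha a' ha' hj hlt
      have h2 : m ∣ a' i - a i := (Nat.modEq_iff_dvd' hlt.le).1 hmod.symm
      have := Nat.le_of_dvd (by omega) h2
      omega
    intro a ha a' ha' h
    have hj : ∀ j, j ≠ i → a j = a' j := fun j hj => by simpa [hj] using congrFun h j
    have hi : a i % m = a' i % m := by simpa using congrFun h i
    ext j
    by_cases hji : j = i
    · subst hji
      exact le_antisymm (not_lt.1 (key a' ha' a ha hj hi))
        (not_lt.1 (key a ha a' ha' (fun j h => (hj j h).symm) hi.symm))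
    · exact hj j hji

/-- The cells of the grid of mesh `b ^ (-k)` that meet `C` but are not contained in `C`. -/
def boundaryCells {s : ℕ} (b k : ℕ) (C : Set (Fin s → ℝ)) : Finset (Fin s → ℕ) :=
  open Classical in
  (Fintype.piFinset fun _ => Finset.range (b ^ k)).filter fun a =>
    (elementaryInterval b a (fun _ => k) ∩ C).Nonempty ∧
      ¬ elementaryInterval b a (fun _ => k) ⊆ C

theorem abs_sub_le_of_mem_elementaryInterval {s b k : ℕ} (hb : 0 < b) {a a' : Fin s → ℕ}
    {x y : Fin s → ℝ} (hx : x ∈ elementaryInterval b a (fun _ => k))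
    (hy : y ∈ elementaryInterval b a' (fun _ => k)) (j : Fin s) :
    ((a' j : ℝ) - a j - 1) / (b : ℝ) ^ k < y j - x j ∧
      y j - x j < ((a' j : ℝ) - a j + 1) / (b : ℝ) ^ k := by
  have hbk : (0 : ℝ) < (b : ℝ) ^ k := by positivity
  have h1 := hx j
  have h2 := hy j
  rw [div_le_iff₀ hbk, lt_div_iff₀ hbk] at h1 h2
  rw [div_lt_iff₀ hbk, lt_div_iff₀ hbk]
  constructor <;> nlinarith [h1.1, h1.2, h2.1, h2.2]

/-- If a functional with dominating coordinate `i` does not increase from `p` to `c`, then `c`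
cannot lie `s` cells further than `p` in the direction of the sign of the `i`-th coefficient. -/
theorem not_far_of_sum_mul_le {s b k : ℕ} (hb : 0 < b) {f : Fin s → ℝ}
    {i : Fin s} (hmax : ∀ j, |f j| ≤ |f i|) {a a' : Fin s → ℕ} {p c : Fin s → ℝ}
    (hp : p ∈ elementaryInterval b a (fun _ => k)) (hc : c ∈ elementaryInterval b a' (fun _ => k))
    (hle : ∑ j, f j * c j ≤ ∑ j, f j * p j) (hj : ∀ j, j ≠ i → a' j = a j) :
    (0 < f i → a' i < a i + (s + 1)) ∧ (f i < 0 → a i < a' i + (s + 1)) := by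
  classical
  have hbk : (0 : ℝ) < (b : ℝ) ^ k := by positivity
  have hdiff : ∑ j, f j * (c j - p j) ≤ 0 := by
    simp only [mul_sub, Finset.sum_sub_distrib]
    linarith
  rw [← Finset.add_sum_erase _ _ (Finset.mem_univ i)] at hdiff
  -- In every coordinate but `i` the two cells agree, so `c` and `p` differ there by less than one
  -- mesh width, weighted by at most `|f i|`. This leaves room for about `s` cells in direction `i`.
  have hrest : -(s * (|f i| / (b : ℝ) ^ k)) ≤ ∑ j ∈ Finset.univ.erase i, f j * (c j - p j) := by
    calc -(s * (|f i| / (b : ℝ) ^ k))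
        ≤ ∑ j ∈ Finset.univ.erase i, -(|f i| / (b : ℝ) ^ k) := by
          rw [Finset.sum_const, nsmul_eq_mul, mul_neg, neg_le_neg_iff]
          refine mul_le_mul_of_nonneg_right ?_ (by positivity)
          have := Finset.card_le_univ (Finset.univ.erase i)
          rw [Fintype.card_fin] at this
          exact_mod_cast this
      _ ≤ _ := by
          refine Finset.sum_le_sum fun j hjm => ?_
          have h := abs_sub_le_of_mem_elementaryInterval hb hp hc j
          rw [hj j (Finset.ne_of_mem_erase hjm)] at h
          have h1 : |c j - p j| ≤ 1 / (b : ℝ) ^ k := by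
            rw [abs_le]
            constructor
            · rw [← neg_div]
              have := h.1
              simp only [sub_self, zero_sub] at this
              exact this.le
            · have := h.2
              simp only [sub_self, zero_add] at this
              exact this.le
          have h2 : |f j * (c j - p j)| ≤ |f i| / (b : ℝ) ^ k := by
            rw [abs_mul, ← mul_one_div]
            exact mul_le_mul (hmax j) h1 (abs_nonneg _) (abs_nonneg _)
          exact (abs_le.1 h2).1
  have hi := abs_sub_le_of_mem_elementaryInterval hb hp hc i
  rw [div_lt_iff₀ hbk, lt_div_iff₀ hbk] at hi
  have hsum : f i * (c i - p i) ≤ s * (|f i| / (b : ℝ) ^ k) := by linarith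
  rw [← mul_div_assoc, le_div_iff₀ hbk] at hsum
  constructor
  · intro hpos
    by_contra hcon
    have hcon' : (a i : ℝ) + (s + 1) ≤ a' i := by exact_mod_cast not_lt.1 hcon
    rw [abs_of_pos hpos] at hsum
    have : (s : ℝ) < (c i - p i) * (b : ℝ) ^ k := by linarith [hi.1]
    nlinarith
  · intro hneg
    by_contra hcon
    have hcon' : (a' i : ℝ) + (s + 1) ≤ a i := by exact_mod_cast not_lt.1 hcon
    rw [abs_of_neg hneg] at hsum
    have : (c i - p i) * (b : ℝ) ^ k < -s := by linarith [hi.2]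
    nlinarith

/-- A boundary cell contains a point outside `C`; a functional separates it from `C`, and `i` is
chosen as the coordinate with the largest coefficient. On the line of cells in direction `i`, no
cell meeting `C` lies more than `s` cells away on the side given by the sign. Sorting the boundary
cells by `i` and by the sign gives `2 s` classes, and within one class the cells on a line in
direction `i` are closer than `s + 1`. -/
theorem card_boundaryCells_le {s b : ℕ} (hs : 1 ≤ s) (hb : 0 < b) (k : ℕ) {C : Set (Fin s → ℝ)}
    (hC : Convex ℝ C) :
    (boundaryCells b k C).card ≤ 2 * s * (s + 1) * (b ^ k) ^ (s - 1) := by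
  classical
  have hne : Nonempty (Fin s) := ⟨⟨0, hs⟩⟩
  have hex : ∀ a ∈ boundaryCells b k C, ∃ i : Fin s,
      (∀ a' ∈ boundaryCells b k C, (∀ j, j ≠ i → a' j = a j) → a' i < a i + (s + 1)) ∨
      (∀ a' ∈ boundaryCells b k C, (∀ j, j ≠ i → a' j = a j) → a i < a' i + (s + 1)) := by
    intro a ha
    have ha' := (Finset.mem_filter.1 ha).2.2
    rw [Set.not_subset] at ha'
    obtain ⟨p, hp, hpC⟩ := ha'
    obtain ⟨f, hf, hsep⟩ := exists_separating_functional hs hC hpC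
    obtain ⟨i, hi⟩ := Finite.exists_max fun j => |f j|
    have hfi : f i ≠ 0 := by
      intro h0
      refine hf (funext fun j => ?_)
      have := hi j
      rw [h0, abs_zero] at this
      exact abs_eq_zero.1 (le_antisymm this (abs_nonneg _))
    have hfar : ∀ a' ∈ boundaryCells b k C, (∀ j, j ≠ i → a' j = a j) →
        (0 < f i → a' i < a i + (s + 1)) ∧ (f i < 0 → a i < a' i + (s + 1)) := by
      intro a' ha' hj
      obtain ⟨c, hc, hcC⟩ := (Finset.mem_filter.1 ha').2.1
      exact not_far_of_sum_mul_le hb hi hp hc (hsep c hcC) hj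
    rcases lt_or_gt_of_ne hfi with hneg | hpos
    · exact ⟨i, Or.inr fun a' ha' hj => (hfar a' ha' hj).2 hneg⟩
    · exact ⟨i, Or.inl fun a' ha' hj => (hfar a' ha' hj).1 hpos⟩
  set B₁ : Fin s → Finset (Fin s → ℕ) := fun i => (boundaryCells b k C).filter fun a =>
    ∀ a' ∈ boundaryCells b k C, (∀ j, j ≠ i → a' j = a j) → a' i < a i + (s + 1) with hB₁
  set B₂ : Fin s → Finset (Fin s → ℕ) := fun i => (boundaryCells b k C).filter fun a =>
    ∀ a' ∈ boundaryCells b k C, (∀ j, j ≠ i → a' j = a j) → a i < a' i + (s + 1) with hB₂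
  have hlt : ∀ a ∈ boundaryCells b k C, ∀ j, a j < b ^ k := fun a ha j =>
    Finset.mem_range.1 (Fintype.mem_piFinset.1 (Finset.mem_filter.1 ha).1 j)
  have hc₁ : ∀ i, (B₁ i).card ≤ (s + 1) * (b ^ k) ^ (s - 1) := fun i =>
    card_le_of_line_gap (Nat.succ_pos s) _ i
      (fun a ha => hlt a (Finset.mem_filter.1 ha).1)
      (fun a ha a' ha' hj _ => (Finset.mem_filter.1 ha).2 a' (Finset.mem_filter.1 ha').1 hj)
  -- For the opposite sign, the defining property of the upper cell is applied to the lower one.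
  have hc₂ : ∀ i, (B₂ i).card ≤ (s + 1) * (b ^ k) ^ (s - 1) := fun i =>
    card_le_of_line_gap (Nat.succ_pos s) _ i
      (fun a ha => hlt a (Finset.mem_filter.1 ha).1)
      (fun a ha a' ha' hj _ => (Finset.mem_filter.1 ha').2 a (Finset.mem_filter.1 ha).1
        fun j h => (hj j h).symm)
  have hsub : boundaryCells b k C ⊆ Finset.univ.biUnion fun i => B₁ i ∪ B₂ i := by
    intro a ha
    obtain ⟨i, h | h⟩ := hex a ha
    · exact Finset.mem_biUnion.2 ⟨i, Finset.mem_univ _,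
        Finset.mem_union_left _ (Finset.mem_filter.2 ⟨ha, h⟩)⟩
    · exact Finset.mem_biUnion.2 ⟨i, Finset.mem_univ _,
        Finset.mem_union_right _ (Finset.mem_filter.2 ⟨ha, h⟩)⟩
  calc (boundaryCells b k C).card ≤ ∑ i, (B₁ i ∪ B₂ i).card :=
        (Finset.card_le_card hsub).trans Finset.card_biUnion_le
    _ ≤ ∑ _i : Fin s, 2 * ((s + 1) * (b ^ k) ^ (s - 1)) := by
        refine Finset.sum_le_sum fun i _ => (Finset.card_union_le _ _).trans ?_
        have := hc₁ i; have := hc₂ i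
        omega
    _ = _ := by simp; ring

/-! ### Discrepancy with respect to convex sets -/

theorem exists_cell_of_mem {s b k : ℕ} (hb : 0 < b) {x : Fin s → ℝ}
    (hx : ∀ i, 0 ≤ x i ∧ x i < 1) :
    ∃ a ∈ Fintype.piFinset (fun _ : Fin s => Finset.range (b ^ k)),
      x ∈ elementaryInterval b a (fun _ => k) := by
  have hbk : (0 : ℝ) < (b : ℝ) ^ k := by positivity
  refine ⟨fun i => ⌊x i * (b : ℝ) ^ k⌋₊, Fintype.mem_piFinset.2 fun i => Finset.mem_range.2 ?_,
    (mem_elementaryInterval_iff hb fun i => (hx i).1).2 fun i => rfl⟩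
  rw [Nat.floor_lt (mul_nonneg (hx i).1 hbk.le)]
  push_cast
  nlinarith [(hx i).2]

theorem eq_of_mem_elementaryInterval {s b : ℕ} (hb : 0 < b) {a a' e : Fin s → ℕ}
    {x : Fin s → ℝ} (h : x ∈ elementaryInterval b a e) (h' : x ∈ elementaryInterval b a' e) :
    a = a' := by
  have hx : ∀ i, 0 ≤ x i := fun i => le_trans (by positivity) (h i).1
  rw [mem_elementaryInterval_iff hb hx] at h h'
  exact funext fun i => (h i).symm.trans (h' i)

theorem measurableSet_elementaryInterval {s b : ℕ} (a e : Fin s → ℕ) :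
    MeasurableSet (elementaryInterval b a e) := by
  rw [elementaryInterval_eq_pi]
  exact MeasurableSet.univ_pi fun i => measurableSet_Ico

/-- The cells of the grid of mesh `b ^ (-k)` that are contained in `C`. -/
def innerCells {s : ℕ} (b k : ℕ) (C : Set (Fin s → ℝ)) : Finset (Fin s → ℕ) :=
  open Classical in
  (Fintype.piFinset fun _ => Finset.range (b ^ k)).filter fun a =>
    elementaryInterval b a (fun _ => k) ⊆ C

theorem mem_cells_of_mem {s b k : ℕ} (hb : 0 < b) {C : Set (Fin s → ℝ)} {x : Fin s → ℝ}
    (hx : ∀ i, 0 ≤ x i ∧ x i < 1) (hxC : x ∈ C) :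
    ∃ a ∈ innerCells b k C ∪ boundaryCells b k C, x ∈ elementaryInterval b a (fun _ => k) := by
  classical
  obtain ⟨a, ha, hxa⟩ := exists_cell_of_mem (k := k) hb hx
  refine ⟨a, ?_, hxa⟩
  by_cases h : elementaryInterval b a (fun _ => k) ⊆ C
  · exact Finset.mem_union_left _ (Finset.mem_filter.2 ⟨ha, h⟩)
  · exact Finset.mem_union_right _ (Finset.mem_filter.2 ⟨ha, ⟨x, hxa, hxC⟩, h⟩)

theorem pairwiseDisjoint_elementaryInterval {s b : ℕ} (hb : 0 < b) (e : Fin s → ℕ)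
    (S : Set (Fin s → ℕ)) : S.PairwiseDisjoint fun a => elementaryInterval b a e := by
  intro a _ a' _ hne
  exact Set.disjoint_left.2 fun x h h' => hne (eq_of_mem_elementaryInterval hb h h')

theorem measureReal_biUnion_elementaryInterval {s b : ℕ} (hb : 0 < b) (k : ℕ)
    (S : Finset (Fin s → ℕ)) :
    volume.real (⋃ a ∈ S, elementaryInterval b a fun _ => k) =
      S.card * (1 / (b : ℝ) ^ (s * k)) := by
  have hfin : ∀ a ∈ S, volume (elementaryInterval b a fun _ => k) ≠ ⊤ := by
    intro a _
    rw [volume_elementaryInterval]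
    exact ENNReal.ofReal_ne_top
  rw [measureReal_biUnion_finset (pairwiseDisjoint_elementaryInterval hb _ _)
    (fun a _ => measurableSet_elementaryInterval _ _) hfin]
  simp only [measureReal_def, volume_elementaryInterval]
  rw [Finset.sum_const, nsmul_eq_mul, ENNReal.toReal_ofReal (by positivity)]
  simp

theorem measureReal_le_cells {s b : ℕ} (hb : 0 < b) (k : ℕ) {C : Set (Fin s → ℝ)}
    (hC : C ⊆ Set.Icc 0 1) :
    volume.real C ≤ ((innerCells b k C).card + (boundaryCells b k C).card) *
      (1 / (b : ℝ) ^ (s * k)) := by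
  classical
  -- The cells cover only the half-open cube; the missing upper faces form a null set.
  have hnull : volume (Set.Icc (0 : Fin s → ℝ) 1 \ Set.univ.pi fun _ => Set.Ico 0 1) = 0 :=
    (ae_le_set.1 (Measure.univ_pi_Ico_ae_eq_Icc (μ := fun _ : Fin s => (volume : Measure ℝ))
      (f := 0) (g := 1)).symm.le)
  have hsub : C ⊆ (⋃ a ∈ innerCells b k C ∪ boundaryCells b k C,
      elementaryInterval b a fun _ => k) ∪
      (Set.Icc (0 : Fin s → ℝ) 1 \ Set.univ.pi fun _ => Set.Ico 0 1) := by
    intro x hx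
    by_cases h : x ∈ Set.univ.pi fun _ : Fin s => Set.Ico (0 : ℝ) 1
    · obtain ⟨a, ha, hxa⟩ := mem_cells_of_mem (k := k) hb
        (fun i => h i (Set.mem_univ i)) hx
      exact Or.inl (Set.mem_biUnion ha hxa)
    · exact Or.inr ⟨hC hx, h⟩
  have hfin : volume (⋃ a ∈ innerCells b k C ∪ boundaryCells b k C,
      elementaryInterval b a fun _ => k) ≠ ⊤ := by
    refine ne_top_of_le_ne_top ?_ (measure_biUnion_finset_le _ _)
    refine ENNReal.sum_ne_top.2 fun a _ => ?_
    rw [volume_elementaryInterval]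
    exact ENNReal.ofReal_ne_top
  have h1 : volume.real C ≤ volume.real (⋃ a ∈ innerCells b k C ∪ boundaryCells b k C,
      elementaryInterval b a fun _ => k) := by
    refine ENNReal.toReal_mono hfin ((measure_mono hsub).trans ?_)
    refine (measure_union_le _ _).trans ?_
    rw [hnull, add_zero]
  refine h1.trans ?_
  rw [measureReal_biUnion_elementaryInterval hb]
  refine mul_le_mul_of_nonneg_right ?_ (by positivity)
  exact_mod_cast Finset.card_union_le _ _

theorem cells_le_measureReal {s b : ℕ} (hb : 0 < b) (k : ℕ) {C : Set (Fin s → ℝ)}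
    (hC : C ⊆ Set.Icc 0 1) :
    (innerCells b k C).card * (1 / (b : ℝ) ^ (s * k)) ≤ volume.real C := by
  classical
  rw [← measureReal_biUnion_elementaryInterval hb]
  refine measureReal_mono (Set.iUnion₂_subset fun a ha => (Finset.mem_filter.1 ha).2) ?_
  exact ne_top_of_le_ne_top isCompact_Icc.measure_lt_top.ne (measure_mono hC)

theorem IsNet.sum_indicator_cells {s b t m k : ℕ} (hb : 0 < b) {P : Fin (b ^ m) → Fin s → ℝ}
    (hP : IsNet b t m P) (hk : s * k ≤ m - t) {S : Finset (Fin s → ℕ)}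
    (hS : ∀ a ∈ S, ∀ i, a i < b ^ k) :
    ∑ n, ∑ a ∈ S, (elementaryInterval b a fun _ => k).indicator (fun _ => (1 : ℝ)) (P n) =
      S.card * ((b : ℝ) ^ m / (b : ℝ) ^ (s * k)) := by
  rw [Finset.sum_comm, Finset.sum_congr rfl fun a ha => hP.sum_indicator hb (hS a ha) (by simpa)]
  simp

theorem sum_indicator_innerCells_le {s b : ℕ} (hb : 0 < b) (k : ℕ) (C : Set (Fin s → ℝ))
    (x : Fin s → ℝ) :
    ∑ a ∈ innerCells b k C,
        (elementaryInterval b a fun _ => k).indicator (fun _ => (1 : ℝ)) x ≤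
      C.indicator (fun _ => (1 : ℝ)) x := by
  classical
  by_cases h : ∃ a ∈ innerCells b k C, x ∈ elementaryInterval b a fun _ => k
  · obtain ⟨a, ha, hxa⟩ := h
    rw [Finset.sum_eq_single_of_mem a ha, Set.indicator_of_mem hxa,
      Set.indicator_of_mem ((Finset.mem_filter.1 ha).2 hxa)]
    intro a' _ hne
    exact Set.indicator_of_notMem (fun h' => hne (eq_of_mem_elementaryInterval hb h' hxa)) _
  · push Not at h
    rw [Finset.sum_eq_zero fun a ha => Set.indicator_of_notMem (h a ha) _]
    exact Set.indicator_nonneg (fun _ _ => zero_le_one) _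

/-- Both the count and the scaled volume of `C` lie between those of the inner cells and those of
the inner and boundary cells together. The choice `k = (m - t) / s` is the finest mesh whose cells,
of order `s k`, are still fair; each carries `b ^ (m - s k)` points, and there are `O(b ^ (k (s -
1)))` boundary cells. -/
theorem IsNet.abs_sum_indicator_convex_sub_le {s b t m : ℕ} (hs : 1 ≤ s) (hb : 0 < b)
    {P : Fin (b ^ m) → Fin s → ℝ} (hP : IsNet b t m P) {C : Set (Fin s → ℝ)}
    (hC : C ⊆ Set.Icc 0 1) (hconv : Convex ℝ C) :
    |∑ n, C.indicator (fun _ => (1 : ℝ)) (P n) - (b : ℝ) ^ m * volume.real C| ≤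
      2 * s * (s + 1) * ((b : ℝ) ^ m / (b : ℝ) ^ ((m - t) / s)) := by
  classical
  set k := (m - t) / s with hk
  have hb' : (0 : ℝ) < b := by exact_mod_cast hb
  have hsk : s * k ≤ m - t := Nat.mul_div_le _ _
  have hgrid : ∀ a ∈ Fintype.piFinset (fun _ : Fin s => Finset.range (b ^ k)),
      ∀ i, a i < b ^ k := fun a ha i => Finset.mem_range.1 (Fintype.mem_piFinset.1 ha i)
  have hI := hP.sum_indicator_cells hb hsk (S := innerCells b k C)
    fun a ha => hgrid a (Finset.mem_filter.1 ha).1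
  have hIB := hP.sum_indicator_cells hb hsk (S := innerCells b k C ∪ boundaryCells b k C)
    fun a ha => (Finset.mem_union.1 ha).elim (fun ha => hgrid a (Finset.mem_filter.1 ha).1)
      fun ha => hgrid a (Finset.mem_filter.1 ha).1
  have hlow : ∑ n, ∑ a ∈ innerCells b k C,
      (elementaryInterval b a fun _ => k).indicator (fun _ => (1 : ℝ)) (P n) ≤
      ∑ n, C.indicator (fun _ => (1 : ℝ)) (P n) := by
    refine Finset.sum_le_sum fun n _ => ?_
    exact sum_indicator_innerCells_le hb k C (P n)
  have hupp : ∑ n, C.indicator (fun _ => (1 : ℝ)) (P n) ≤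
      ∑ n, ∑ a ∈ innerCells b k C ∪ boundaryCells b k C,
        (elementaryInterval b a fun _ => k).indicator (fun _ => (1 : ℝ)) (P n) := by
    refine Finset.sum_le_sum fun n _ => ?_
    have h0 : ∀ a ∈ innerCells b k C ∪ boundaryCells b k C,
        0 ≤ (elementaryInterval b a fun _ => k).indicator (fun _ => (1 : ℝ)) (P n) :=
      fun a _ => Set.indicator_nonneg (fun _ _ => zero_le_one) _
    by_cases h : P n ∈ C
    · obtain ⟨a, ha, hxa⟩ := mem_cells_of_mem (k := k) hb (hP.2.1 n) h
      rw [Set.indicator_of_mem h]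
      refine le_trans ?_ (Finset.single_le_sum h0 ha)
      rw [Set.indicator_of_mem hxa]
    · rw [Set.indicator_of_notMem h]
      exact Finset.sum_nonneg h0
  rw [hI] at hlow
  rw [hIB] at hupp
  have hcard : (((innerCells b k C ∪ boundaryCells b k C).card : ℕ) : ℝ) ≤
      (innerCells b k C).card + (boundaryCells b k C).card := by
    exact_mod_cast Finset.card_union_le _ _
  set w : ℝ := (b : ℝ) ^ m / (b : ℝ) ^ (s * k) with hw
  have hw0 : 0 ≤ w := by positivity
  have hv1 := mul_le_mul_of_nonneg_left (measureReal_le_cells hb k hC)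
    (by positivity : (0 : ℝ) ≤ (b : ℝ) ^ m)
  have hv2 := mul_le_mul_of_nonneg_left (cells_le_measureReal hb k hC)
    (by positivity : (0 : ℝ) ≤ (b : ℝ) ^ m)
  have e1 : (b : ℝ) ^ m * (((innerCells b k C).card + (boundaryCells b k C).card) *
      (1 / (b : ℝ) ^ (s * k))) = ((innerCells b k C).card + (boundaryCells b k C).card) * w := by
    rw [hw]; ring
  have e2 : (b : ℝ) ^ m * ((innerCells b k C).card * (1 / (b : ℝ) ^ (s * k))) =
      (innerCells b k C).card * w := by
    rw [hw]; ring
  rw [e1] at hv1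
  rw [e2] at hv2
  have hbd : ((boundaryCells b k C).card : ℝ) * w ≤
      2 * s * (s + 1) * ((b : ℝ) ^ m / (b : ℝ) ^ k) := by
    have h1 : ((boundaryCells b k C).card : ℝ) ≤ 2 * s * (s + 1) * ((b : ℝ) ^ k) ^ (s - 1) := by
      exact_mod_cast card_boundaryCells_le hs hb k hconv
    refine (mul_le_mul_of_nonneg_right h1 hw0).trans (le_of_eq ?_)
    obtain ⟨q, rfl⟩ := Nat.exists_eq_add_of_le' hs
    rw [hw, Nat.add_sub_cancel, ← pow_mul, add_mul, pow_add, one_mul, mul_comm k q]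
    field_simp
  have hup' := hupp.trans (mul_le_mul_of_nonneg_right hcard hw0)
  rw [abs_le]
  constructor <;> linarith

/-- Puts the net bound into geometric form, ready for summation over `m`. Rounding in the exponent
costs at most `t / s + 1 ≤ t + s`. -/
theorem pow_div_pow_le {s b t m : ℕ} (hs : 1 ≤ s) (hb : 1 ≤ b) :
    (b : ℝ) ^ m / (b : ℝ) ^ ((m - t) / s) ≤
      (b : ℝ) ^ (t + s) * ((b : ℝ) ^ (1 - 1 / (s : ℝ))) ^ m := by
  have hb1 : (1 : ℝ) ≤ b := by exact_mod_cast hb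
  have hb' : (0 : ℝ) < b := by linarith
  have hs' : (1 : ℝ) ≤ s := by exact_mod_cast hs
  rw [← Real.rpow_natCast (b : ℝ) m, ← Real.rpow_natCast (b : ℝ) ((m - t) / s),
    ← Real.rpow_sub hb', ← Real.rpow_natCast (b : ℝ) (t + s), ← Real.rpow_mul_natCast hb'.le,
    ← Real.rpow_add hb']
  refine Real.rpow_le_rpow_of_exponent_le hb1 ?_
  have h1 : m - t < s * ((m - t) / s) + s := by
    have := Nat.lt_mul_div_succ (m - t) hs
    rwa [Nat.mul_add, Nat.mul_one] at this
  have h2 : (m : ℝ) ≤ t + (s * ((m - t) / s : ℕ) + s) := by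
    exact_mod_cast (by omega : m ≤ t + (s * ((m - t) / s) + s))
  have h3 : (m : ℝ) / s ≤ t / s + ((m - t) / s : ℕ) + 1 := by
    rw [div_le_iff₀ (by linarith), add_mul, add_mul, div_mul_cancel₀ _ (by linarith)]
    linarith
  have h4 : (t : ℝ) / s ≤ t := div_le_self (Nat.cast_nonneg t) hs'
  have h5 : (1 - 1 / (s : ℝ)) * m = m - m / s := by ring
  rw [h5]
  push_cast
  linarith

/-- The discrepancy of a `(t, s)`-sequence with respect to convex sets. -/
theorem exists_abs_sum_indicator_convex_sub_le {s b : ℕ} (t : ℕ) (hs : 2 ≤ s) (hb : 2 ≤ b) :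
    ∃ A : ℝ, 0 ≤ A ∧ ∀ x : ℕ → Fin s → ℝ, IsSequence b t x →
      ∀ C : Set (Fin s → ℝ), C ⊆ Set.Icc 0 1 → Convex ℝ C → ∀ N : ℕ, 1 ≤ N →
        |∑ n ∈ Finset.range N, C.indicator (fun _ => (1 : ℝ)) (x n) - N * volume.real C| ≤
          A * (N : ℝ) ^ (1 - 1 / (s : ℝ)) := by
  have hb1 : (1 : ℝ) < b := by exact_mod_cast (by omega : 1 < b)
  have hb' : (0 : ℝ) < b := by linarith
  have hs2 : (2 : ℝ) ≤ s := by exact_mod_cast hs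
  -- Since `s ≥ 2` the ratio `b ^ θ` exceeds `1`, so the geometric sum over the levels is comparable
  -- to its last term and no logarithm arises.
  have hθ : 0 < 1 - 1 / (s : ℝ) := by
    have : 1 / (s : ℝ) ≤ 1 / 2 := one_div_le_one_div_of_le (by norm_num) hs2
    linarith
  set θ : ℝ := 1 - 1 / (s : ℝ) with hθ'
  set ρ : ℝ := (b : ℝ) ^ θ with hρ
  have hρ1 : 1 < ρ := Real.one_lt_rpow hb1 hθ
  set c : ℝ := 2 * s * (s + 1) * (b : ℝ) ^ (t + s) with hc
  have hc0 : 0 ≤ c := by positivity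
  refine ⟨(b : ℝ) ^ t + ((b : ℝ) - 1) * (c * (ρ ^ (t + 1) / (ρ - 1))), ?_, ?_⟩
  · have : 0 ≤ (b : ℝ) - 1 := by linarith
    have : 0 ≤ ρ - 1 := by linarith
    positivity
  intro x hx C hC hconv N hN
  set g : ℕ → ℝ := fun n => C.indicator (fun _ => (1 : ℝ)) (x n) - volume.real C with hg
  have hvol : volume.real C ≤ 1 := by
    have h : volume.real (Set.Icc (0 : Fin s → ℝ) 1) = 1 := by
      simp [measureReal_def, Real.volume_Icc_pi]
    rw [← h]
    exact measureReal_mono hC isCompact_Icc.measure_lt_top.ne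
  have hsum : ∀ M j, ∑ r ∈ Finset.range M, g (j + r) =
      ∑ r ∈ Finset.range M, C.indicator (fun _ => (1 : ℝ)) (x (j + r)) - M * volume.real C := by
    intro M j
    simp [hg, Finset.sum_sub_distrib]
  have hg1 : ∀ n, |g n| ≤ 1 := by
    intro n
    have a0 : 0 ≤ C.indicator (fun _ => (1 : ℝ)) (x n) :=
      Set.indicator_nonneg (fun _ _ => zero_le_one) _
    have a1 : C.indicator (fun _ => (1 : ℝ)) (x n) ≤ 1 :=
      Set.indicator_le_self' (fun _ _ => zero_le_one) _
    have b0 : 0 ≤ volume.real C := measureReal_nonneg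
    rw [abs_le]; constructor <;> simp only [hg] <;> linarith
  have hmain := abs_sum_range_le_sum_log (t := t) hb hg1 (β := fun m => c * ρ ^ m)
    (fun m => by positivity)
    (fun m hm j => by
      rw [hsum, Finset.sum_range
        (f := fun r => C.indicator (fun _ => (1 : ℝ)) (x (j * b ^ m + r)))]
      have h1 := (hx m hm j).abs_sum_indicator_convex_sub_le (by omega) (by omega) hC hconv
      have h2 := mul_le_mul_of_nonneg_left (pow_div_pow_le (s := s) (b := b) (t := t) (m := m)
        (by omega) (by omega)) (by positivity : (0 : ℝ) ≤ 2 * s * (s + 1))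
      push_cast at h1 ⊢
      refine h1.trans (h2.trans (le_of_eq ?_))
      rw [hc, mul_assoc (2 * (s : ℝ) * (s + 1))]) N
  have h0 := hsum N 0
  simp only [zero_add] at h0
  rw [h0] at hmain
  refine hmain.trans ?_
  set L := Nat.log b N with hL
  have hρL : ρ ^ L ≤ (N : ℝ) ^ θ := by
    rw [hρ, ← Real.rpow_mul_natCast hb'.le, mul_comm θ, Real.rpow_mul hb'.le, Real.rpow_natCast]
    refine Real.rpow_le_rpow (by positivity) ?_ hθ.le
    exact_mod_cast Nat.pow_log_le_self b (by omega)
  have hN1 : (1 : ℝ) ≤ (N : ℝ) ^ θ := Real.one_le_rpow (by exact_mod_cast hN) hθ.le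
  have hgeo : ∑ i ∈ Finset.range (t + (L + 1)), c * ρ ^ i ≤
      c * (ρ ^ (t + 1) / (ρ - 1)) * (N : ℝ) ^ θ := by
    rw [← Finset.mul_sum, geom_sum_eq hρ1.ne', mul_assoc c]
    refine mul_le_mul_of_nonneg_left ?_ hc0
    rw [div_mul_eq_mul_div]
    refine div_le_div_of_nonneg_right ?_ (by linarith)
    have : ρ ^ (t + (L + 1)) = ρ ^ (t + 1) * ρ ^ L := by ring
    rw [this]
    have := mul_le_mul_of_nonneg_left hρL (by positivity : 0 ≤ ρ ^ (t + 1))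
    linarith
  have h1 := mul_le_mul_of_nonneg_left hgeo (by linarith : (0 : ℝ) ≤ (b : ℝ) - 1)
  have h2 : (b : ℝ) ^ t ≤ (b : ℝ) ^ t * (N : ℝ) ^ θ := le_mul_of_one_le_right (by positivity) hN1
  linarith

/-! ### Quantile functions -/

section Quantile

open ProbabilityTheory Filter Topology

/-- By right continuity the infimum is attained. The limits at `±∞` make the set nonempty and
bounded below, which is where `0 < u < 1` enters. -/
theorem sInf_le_iff_le_cdf (ν : Measure ℝ) {u : ℝ} (h0 : 0 < u) (h1 : u < 1) (z : ℝ) :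
    sInf {y : ℝ | u ≤ cdf ν y} ≤ z ↔ u ≤ cdf ν z := by
  obtain ⟨z₁, hz₁⟩ := ((tendsto_cdf_atTop ν).eventually (lt_mem_nhds h1)).exists
  obtain ⟨z₀, hz₀⟩ := ((tendsto_cdf_atBot ν).eventually (gt_mem_nhds h0)).exists
  have hne : {y : ℝ | u ≤ cdf ν y}.Nonempty := ⟨z₁, le_of_lt hz₁⟩
  have hbdd : BddBelow {y : ℝ | u ≤ cdf ν y} := by
    refine ⟨z₀, fun y (hy : u ≤ cdf ν y) => ?_⟩
    by_contra hlt
    exact absurd (hy.trans (monotone_cdf ν (not_le.1 hlt).le)) (not_le.2 hz₀)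
  have hmem : u ≤ cdf ν (sInf {y : ℝ | u ≤ cdf ν y}) := by
    have hcont : Tendsto (cdf ν) (𝓝[>] sInf {y : ℝ | u ≤ cdf ν y})
        (𝓝 (cdf ν (sInf {y : ℝ | u ≤ cdf ν y}))) :=
      ((cdf ν).right_continuous _).mono_left (nhdsWithin_mono _ Set.Ioi_subset_Ici_self)
    refine ge_of_tendsto hcont ?_
    filter_upwards [self_mem_nhdsWithin] with y hy
    obtain ⟨w, hw, hwy⟩ := exists_lt_of_csInf_lt hne hy
    exact le_trans hw (monotone_cdf ν hwy.le)
  exact ⟨fun h => hmem.trans (monotone_cdf ν h), fun h => csInf_le hbdd h⟩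

/-- The quantile function of a probability measure on `ℝ`, extended by `0` outside `(0, 1)`. -/
def quantile (ν : Measure ℝ) (u : ℝ) : ℝ :=
  open Classical in if u ∈ Set.Ioo (0 : ℝ) 1 then sInf {z : ℝ | u ≤ cdf ν z} else 0

theorem quantile_of_mem (ν : Measure ℝ) {u : ℝ} (h : u ∈ Set.Ioo (0 : ℝ) 1) :
    quantile ν u = sInf {z : ℝ | u ≤ cdf ν z} := if_pos h

theorem quantile_le_iff (ν : Measure ℝ) {u : ℝ} (h : u ∈ Set.Ioo (0 : ℝ) 1) (z : ℝ) :
    quantile ν u ≤ z ↔ u ≤ cdf ν z := by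
  rw [quantile_of_mem ν h, sInf_le_iff_le_cdf ν h.1 h.2]

theorem measurable_quantile (ν : Measure ℝ) : Measurable (quantile ν) := by
  classical
  refine measurable_of_Iic fun z => ?_
  have : quantile ν ⁻¹' Set.Iic z =
      (Set.Ioo (0 : ℝ) 1 ∩ Set.Iic (cdf ν z)) ∪ ((Set.Ioo (0 : ℝ) 1)ᶜ ∩ {_u | 0 ≤ z}) := by
    ext u
    by_cases h : u ∈ Set.Ioo (0 : ℝ) 1
    · simp only [Set.mem_preimage, Set.mem_Iic, quantile_le_iff ν h, Set.mem_union,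
        Set.mem_inter_iff, h, true_and, Set.mem_compl_iff, not_true_eq_false, false_and, or_false]
    · simp [quantile, h]
  rw [this]
  exact (measurableSet_Ioo.inter measurableSet_Iic).union
    (measurableSet_Ioo.compl.inter (MeasurableSet.const _))

/-- The quantile function transports the uniform distribution on `(0, 1)` to `ν`. -/
theorem map_quantile (ν : Measure ℝ) [IsProbabilityMeasure ν] :
    (volume.restrict (Set.Ioo (0 : ℝ) 1)).map (quantile ν) = ν := by
  refine (Measure.ext_of_Iic _ _ fun z => ?_)
  rw [Measure.map_apply (measurable_quantile ν) measurableSet_Iic,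
    Measure.restrict_apply (measurable_quantile ν measurableSet_Iic), ← ofReal_cdf]
  have hae : (quantile ν ⁻¹' Set.Iic z ∩ Set.Ioo (0 : ℝ) 1 : Set ℝ) =
      Set.Iic (cdf ν z) ∩ Set.Ioo 0 1 := by
    ext u
    refine and_congr_left fun h => ?_
    exact quantile_le_iff ν h z
  -- With the endpoint `1` included, the set is exactly `(0, F z]`, also when `F z = 1`.
  rw [hae, measure_congr ((ae_eq_refl (Set.Iic (cdf ν z))).inter Ioo_ae_eq_Ioc)]
  have : (Set.Iic (cdf ν z) ∩ Set.Ioc 0 1 : Set ℝ) = Set.Ioc 0 (cdf ν z) := by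
    ext u
    have := cdf_le_one ν z
    simp only [Set.mem_inter_iff, Set.mem_Iic, Set.mem_Ioc]
    constructor
    · rintro ⟨h1, h2, h3⟩; exact ⟨h2, h1⟩
    · rintro ⟨h1, h2⟩; exact ⟨h2, h1, h2.trans this⟩
  rw [this, Real.volume_Ioc, sub_zero]

end Quantile

/-! ### Product densities -/

section ProductDensity

open ProbabilityTheory

variable {d : ℕ} {E : Set (Fin d → ℝ)} {h : (Fin d → ℝ) → ℝ} {g : Fin d → ℝ → ℝ}

/-- The probability measure on `ℝ` with density proportional to `f`. -/
def normalizedMeasure (f : ℝ → ℝ) : Measure ℝ :=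
  volume.withDensity fun x => ENNReal.ofReal (f x / ∫ y, f y)

theorem normalizedMeasure_apply {f : ℝ → ℝ} (hf : Integrable f) (hf0 : ∀ z, 0 ≤ f z)
    {A : Set ℝ} (hA : MeasurableSet A) :
    normalizedMeasure f A = ENNReal.ofReal ((∫ z in A, f z) / ∫ z, f z) := by
  have hI : 0 ≤ ∫ z, f z := integral_nonneg hf0
  rw [normalizedMeasure, withDensity_apply _ hA, ← ofReal_integral_eq_lintegral_ofReal
    (hf.div_const _).integrableOn (ae_of_all _ fun z => div_nonneg (hf0 z) hI), integral_div]

theorem isProbabilityMeasure_normalizedMeasure {f : ℝ → ℝ} (hf : Integrable f)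
    (hf0 : ∀ z, 0 ≤ f z) (hI : ∫ z, f z ≠ 0) : IsProbabilityMeasure (normalizedMeasure f) := by
  refine ⟨?_⟩
  rw [normalizedMeasure_apply hf hf0 MeasurableSet.univ, setIntegral_univ, div_self hI,
    ENNReal.ofReal_one]

theorem cdf_normalizedMeasure {f : ℝ → ℝ} (hf : Integrable f)
    (hf0 : ∀ z, 0 ≤ f z) (hI : ∫ z, f z ≠ 0) (z : ℝ) :
    cdf (normalizedMeasure f) z = (∫ y in Set.Iic z, f y) / ∫ y, f y := by
  have := isProbabilityMeasure_normalizedMeasure hf hf0 hI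
  rw [cdf_eq_real, measureReal_def, normalizedMeasure_apply hf hf0 measurableSet_Iic,
    ENNReal.toReal_ofReal]
  exact div_nonneg (setIntegral_nonneg measurableSet_Iic fun z _ => hf0 z) (integral_nonneg hf0)

theorem setIntegral_prod_eq (g : Fin d → ℝ → ℝ) {A : Fin d → Set ℝ}
    (hA : ∀ j, MeasurableSet (A j)) :
    ∫ x in Set.univ.pi A, ∏ j, g j (x j) = ∏ j, ∫ z in A j, g j z := by
  classical
  rw [← integral_indicator (MeasurableSet.univ_pi hA)]
  have : (fun x : Fin d → ℝ => (Set.univ.pi A).indicator (fun x => ∏ j, g j (x j)) x) =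
      fun x => ∏ j, (A j).indicator (g j) (x j) := by
    ext x
    by_cases hx : x ∈ Set.univ.pi A
    · rw [Set.indicator_of_mem hx]
      exact Finset.prod_congr rfl fun j _ => (Set.indicator_of_mem (hx j (Set.mem_univ j)) _).symm
    · rw [Set.indicator_of_notMem hx]
      simp only [Set.mem_pi, Set.mem_univ, true_imp_iff, not_forall] at hx
      obtain ⟨j, hj⟩ := hx
      exact (Finset.prod_eq_zero (Finset.mem_univ j) (Set.indicator_of_notMem hj _)).symm
  rw [this, integral_fintype_prod_volume_eq_prod]
  exact Finset.prod_congr rfl fun j _ => integral_indicator (hA j)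

/-- The data of a product density with positive mass: factors `g j`, whose product is the
density. -/
structure IsFactorization (E : Set (Fin d → ℝ)) (h : (Fin d → ℝ) → ℝ) (g : Fin d → ℝ → ℝ) :
    Prop where
  measurableSet : MeasurableSet E
  integrable : ∀ j, Integrable (g j)
  nonneg : ∀ j z, 0 ≤ g j z
  ae_eq : E.indicator h =ᵐ[volume] fun x => ∏ j, g j (x j)
  integral_pos : 0 < ∫ x in E, h x

namespace IsFactorization

theorem setIntegral_inter (hg : IsFactorization E h g) {A : Fin d → Set ℝ}
    (hA : ∀ j, MeasurableSet (A j)) :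
    ∫ x in E ∩ Set.univ.pi A, h x = ∏ j, ∫ z in A j, g j z := by
  rw [Set.inter_comm, ← setIntegral_indicator hg.measurableSet,
    integral_congr_ae (ae_restrict_of_ae hg.ae_eq), setIntegral_prod_eq g hA]

theorem integral_eq (hg : IsFactorization E h g) : ∫ x in E, h x = ∏ j, ∫ z, g j z := by
  have := hg.setIntegral_inter (A := fun _ => Set.univ) fun _ => MeasurableSet.univ
  simpa using this

theorem integral_factor_ne_zero (hg : IsFactorization E h g) (j : Fin d) : ∫ z, g j z ≠ 0 := by
  intro h0
  have := hg.integral_pos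
  rw [hg.integral_eq, Finset.prod_eq_zero (Finset.mem_univ j) h0] at this
  exact lt_irrefl _ this

theorem isProbabilityMeasure (hg : IsFactorization E h g) (j : Fin d) :
    IsProbabilityMeasure (normalizedMeasure (g j)) :=
  isProbabilityMeasure_normalizedMeasure (hg.integrable j) (hg.nonneg j)
    (hg.integral_factor_ne_zero j)

/-- The factors other than the `j`-th integrate over the whole line and cancel against the total
mass. -/
theorem marginalCDF_eq (hg : IsFactorization E h g) (j : Fin d) (z : ℝ) :
    marginalCDF E h j z = cdf (normalizedMeasure (g j)) z := by
  classical
  rw [cdf_normalizedMeasure (hg.integrable j) (hg.nonneg j) (hg.integral_factor_ne_zero j),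
    marginalCDF, hg.integral_eq]
  have hset : {y : Fin d → ℝ | y j ≤ z} =
      Set.univ.pi (Function.update (fun _ => Set.univ) j (Set.Iic z)) := by
    ext y
    simp only [Set.mem_ofPred_eq, Set.mem_pi, Set.mem_univ, true_imp_iff]
    constructor
    · intro hy i
      by_cases hi : i = j
      · subst hi; simpa using hy
      · simp [hi]
    · intro hy
      simpa using hy j
  rw [hset, hg.setIntegral_inter, ← Finset.mul_prod_erase _ _ (Finset.mem_univ j),
    ← Finset.mul_prod_erase _ (fun j => ∫ z, g j z) (Finset.mem_univ j)]
  · rw [Finset.prod_congr rfl (g := fun i => ∫ z, g i z) fun i hi => by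
      simp [Finset.ne_of_mem_erase hi]]
    rw [Function.update_self, mul_div_mul_right]
    exact Finset.prod_ne_zero_iff.2 fun i _ => hg.integral_factor_ne_zero i
  · intro i
    by_cases hi : i = j
    · subst hi; simp
    · simp [hi]

/-- Identifies the volume of the anchored box in driver space with the normalized mass of the
orthant. -/
theorem prod_marginalCDF (hg : IsFactorization E h g) (y : Fin d → ℝ) :
    ∏ j, marginalCDF E h j (y j) = (∫ x in E ∩ Set.Iic y, h x) / ∫ x in E, h x := by
  rw [← Set.pi_univ_Iic, hg.setIntegral_inter fun _ => measurableSet_Iic, hg.integral_eq,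
    ← Finset.prod_div_distrib]
  refine Finset.prod_congr rfl fun j _ => ?_
  rw [hg.marginalCDF_eq, cdf_normalizedMeasure (hg.integrable j) (hg.nonneg j)
    (hg.integral_factor_ne_zero j)]

theorem marginalCDF_mem_Icc (hg : IsFactorization E h g) (j : Fin d) (z : ℝ) :
    0 ≤ marginalCDF E h j z ∧ marginalCDF E h j z ≤ 1 := by
  rw [hg.marginalCDF_eq]
  exact ⟨cdf_nonneg _ _, cdf_le_one _ _⟩

theorem inverseTransform_eq_quantile (hg : IsFactorization E h g) (c : Fin d → ℝ)
    {u : Fin d → ℝ} {j : Fin d} (hu : u j ∈ Set.Ioo (0 : ℝ) 1) :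
    inverseTransform E h c u j = quantile (normalizedMeasure (g j)) (u j) := by
  rw [inverseTransform, if_neg hu.1.ne', quantile_of_mem _ hu]
  simp only [hg.marginalCDF_eq]

/-- This equivalence turns orthants in state space into anchored boxes in driver space. It needs `u
j` in the open interval, hence the separate treatment of zero coordinates. -/
theorem inverseTransform_le_iff (hg : IsFactorization E h g) (c : Fin d → ℝ)
    {u : Fin d → ℝ} {j : Fin d} (hu : u j ∈ Set.Ioo (0 : ℝ) 1) (z : ℝ) :
    inverseTransform E h c u j ≤ z ↔ u j ≤ marginalCDF E h j z := by
  rw [hg.inverseTransform_eq_quantile c hu, quantile_le_iff _ hu, hg.marginalCDF_eq]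

/-- It suffices to compare the two measures on measurable boxes, where the integral of the product
density factors. -/
theorem pi_normalizedMeasure (hg : IsFactorization E h g) :
    Measure.pi (fun j => normalizedMeasure (g j)) =
      volume.withDensity fun x => ENNReal.ofReal (E.indicator h x / ∫ y in E, h y) := by
  have := hg.isProbabilityMeasure
  refine Measure.pi_eq fun A hA => ?_
  have hI : 0 ≤ ∫ y in E, h y := hg.integral_pos.le
  rw [withDensity_apply _ (MeasurableSet.univ_pi hA),
    setLIntegral_congr_fun_ae (MeasurableSet.univ_pi hA)
      (g := fun x => ENNReal.ofReal ((∏ j, g j (x j)) / ∫ y in E, h y))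
      (hg.ae_eq.mono fun x hx _ => by simp only [hx]),
    ← ofReal_integral_eq_lintegral_ofReal, integral_div, setIntegral_prod_eq g hA, hg.integral_eq,
    ← Finset.prod_div_distrib, ENNReal.ofReal_prod_of_nonneg]
  · exact Finset.prod_congr rfl fun j _ =>
      (normalizedMeasure_apply (hg.integrable j) (hg.nonneg j) (hA j)).symm
  · exact fun j _ => div_nonneg (setIntegral_nonneg (hA j) fun z _ => hg.nonneg j z)
      (integral_nonneg (hg.nonneg j))
  · exact ((Integrable.fintype_prod hg.integrable).div_const _).integrableOn
  · exact ae_of_all _ fun x => div_nonneg (Finset.prod_nonneg fun j _ => hg.nonneg j _) hI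

/-- The coordinatewise quantile transformation. -/
def transform (g : Fin d → ℝ → ℝ) (u : Fin d → ℝ) : Fin d → ℝ :=
  fun j => quantile (normalizedMeasure (g j)) (u j)

theorem measurable_transform (g : Fin d → ℝ → ℝ) : Measurable (transform g) :=
  measurable_pi_lambda _ fun j => (measurable_quantile _).comp (measurable_pi_apply j)

theorem map_transform (hg : IsFactorization E h g) :
    (volume.restrict (Set.univ.pi fun _ : Fin d => Set.Ioo (0 : ℝ) 1)).map (transform g) =
      volume.withDensity fun x => ENNReal.ofReal (E.indicator h x / ∫ y in E, h y) := by
  have := hg.isProbabilityMeasure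
  have hmap : ∀ j : Fin d, (volume.restrict (Set.Ioo (0 : ℝ) 1)).map
      (quantile (normalizedMeasure (g j))) = normalizedMeasure (g j) := fun j => map_quantile _
  rw [← hg.pi_normalizedMeasure, volume_pi, Measure.restrict_pi_pi]
  conv_rhs => rw [← funext hmap]
  have : ∀ j : Fin d, SigmaFinite ((volume.restrict (Set.Ioo (0 : ℝ) 1)).map
      (quantile (normalizedMeasure (g j)))) := fun j => by rw [hmap j]; infer_instance
  exact Measure.pi_map_pi fun j => (measurable_quantile _).aemeasurable

end IsFactorization

end ProductDensity

section

/-! ### The volume of the acceptance set -/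

variable {d : ℕ} {E : Set (Fin d → ℝ)} {ψ h : (Fin d → ℝ) → ℝ} {g : Fin d → ℝ → ℝ}

/-- The part of the acceptance set whose transformed points lie in `Z`. -/
def acceptancePart (E : Set (Fin d → ℝ)) (ψ h : (Fin d → ℝ) → ℝ) (Z : Set (Fin d → ℝ)) :
    Set (Fin (d + 1) → ℝ) :=
  acceptanceSet E ψ h ∩ {u | inverseTransform E h 0 (Fin.init u) ∈ Z}

/-- The acceptance region over `Z` in state space coordinates. -/
def acceptanceRegion (E : Set (Fin d → ℝ)) (ψ h : (Fin d → ℝ) → ℝ) (Z : Set (Fin d → ℝ)) :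
    Set (ℝ × (Fin d → ℝ)) :=
  {p | p.1 ∈ Set.Ioo (0 : ℝ) 1 ∧ p.2 ∈ E ∩ Z ∧ p.1 * h p.2 ≤ ψ p.2}

theorem measurableSet_acceptanceRegion (hE : MeasurableSet E) (hψ : Measurable ψ)
    (hh : Measurable h) {Z : Set (Fin d → ℝ)} (hZ : MeasurableSet Z) :
    MeasurableSet (acceptanceRegion E ψ h Z) := by
  refine (measurable_fst measurableSet_Ioo).inter
    ((measurable_snd (hE.inter hZ)).inter ?_)
  exact measurableSet_le (measurable_fst.mul (hh.comp measurable_snd)) (hψ.comp measurable_snd)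

/-- Splits off the height coordinate. On the open cube the inverse transformation equals the
measurable map `transform g`, so measurability and Tonelli become available. -/
theorem IsFactorization.acceptancePart_eq (hg : IsFactorization E h g) (Z : Set (Fin d → ℝ)) :
    acceptancePart E ψ h Z = (MeasurableEquiv.piFinSuccAbove (fun _ => ℝ) (Fin.last d)) ⁻¹'
      {p | p.2 ∈ (Set.univ.pi fun _ : Fin d => Set.Ioo (0 : ℝ) 1) ∧
        (p.1, transform g p.2) ∈ acceptanceRegion E ψ h Z} := by
  ext u
  have hinit : ((MeasurableEquiv.piFinSuccAbove (fun _ => ℝ) (Fin.last d)) u).2 = Fin.init u := by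
    ext j
    simp [MeasurableEquiv.piFinSuccAbove_apply, Fin.insertNthEquiv, Fin.init]
  have hlast : ((MeasurableEquiv.piFinSuccAbove (fun _ => ℝ) (Fin.last d)) u).1 =
      u (Fin.last d) := by
    simp [MeasurableEquiv.piFinSuccAbove_apply, Fin.insertNthEquiv]
  simp only [acceptancePart, acceptanceSet, Accepts, acceptanceRegion, Set.mem_inter_iff,
    Set.mem_preimage, Set.mem_ofPred_eq, hinit, hlast, Fin.forall_fin_succ']
  have hpi : Fin.init u ∈ (Set.univ.pi fun _ : Fin d => Set.Ioo (0 : ℝ) 1) ↔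
      ∀ i : Fin d, 0 < u i.castSucc ∧ u i.castSucc < 1 := by
    simp [Set.mem_pi, Fin.init]
  rw [hpi]
  by_cases hu : ∀ i : Fin d, 0 < u i.castSucc ∧ u i.castSucc < 1
  · have hT : inverseTransform E h 0 (Fin.init u) = transform g (Fin.init u) :=
      funext fun j => hg.inverseTransform_eq_quantile 0 (hu j)
    rw [hT]
    simp only [Set.mem_Ioo]
    tauto
  · tauto

/-- Because `0 ≤ ψ < h` on `E`, the slice is `(0, ψ z / h z]` and the constraint that the height be
below `1` has no effect. -/
theorem volume_slice_acceptanceRegion (hψ0 : ∀ z ∈ E, 0 ≤ ψ z) (hψh : ∀ z ∈ E, ψ z < h z)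
    (Z : Set (Fin d → ℝ)) (z : Fin d → ℝ) :
    volume {w : ℝ | (w, z) ∈ acceptanceRegion E ψ h Z} =
      (E ∩ Z).indicator (fun z => ENNReal.ofReal (ψ z / h z)) z := by
  by_cases hz : z ∈ E ∩ Z
  · have h0 := hψ0 z hz.1
    have hlt := hψh z hz.1
    have hpos : 0 < h z := h0.trans_lt hlt
    have hset : {w : ℝ | (w, z) ∈ acceptanceRegion E ψ h Z} = Set.Ioc 0 (ψ z / h z) := by
      ext w
      simp only [acceptanceRegion, Set.mem_ofPred_eq, Set.mem_Ioo, Set.mem_Ioc, hz, true_and,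
        le_div_iff₀ hpos]
      constructor
      · rintro ⟨⟨h1, _⟩, h3⟩; exact ⟨h1, h3⟩
      · rintro ⟨h1, h2⟩; exact ⟨⟨h1, by nlinarith⟩, h2⟩
    rw [Set.indicator_of_mem hz, hset, Real.volume_Ioc, sub_zero]
  · rw [Set.indicator_of_notMem hz]
    have hset : {w : ℝ | (w, z) ∈ acceptanceRegion E ψ h Z} = ∅ := by
      ext w
      simp only [acceptanceRegion, Set.mem_ofPred_eq, hz, false_and, and_false,
        Set.mem_empty_iff_false]
    rw [hset, measure_empty]

theorem IsFactorization.measurableSet_acceptancePart (hg : IsFactorization E h g)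
    (hψ : Measurable ψ) (hh : Measurable h) {Z : Set (Fin d → ℝ)} (hZ : MeasurableSet Z) :
    MeasurableSet (acceptancePart E ψ h Z) := by
  rw [hg.acceptancePart_eq]
  refine (MeasurableEquiv.measurable _) (MeasurableSet.inter ?_ ?_)
  · exact measurable_snd (MeasurableSet.univ_pi fun _ => measurableSet_Ioo)
  · exact (measurable_fst.prodMk ((measurable_transform g).comp measurable_snd))
      (measurableSet_acceptanceRegion hg.measurableSet hψ hh hZ)

/-- By Tonelli the volume is the integral of the slice length `ψ / h` at the transformed point. The
transformation carries the uniform measure to the density `h / ∫ h`, and the factor `h` cancels. -/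
theorem IsFactorization.volume_acceptancePart (hg : IsFactorization E h g) (hψ : Measurable ψ)
    (hh : Measurable h) (hint : IntegrableOn ψ E) (hψ0 : ∀ z ∈ E, 0 ≤ ψ z)
    (hψh : ∀ z ∈ E, ψ z < h z) {Z : Set (Fin d → ℝ)} (hZ : MeasurableSet Z) :
    volume.real (acceptancePart E ψ h Z) = (∫ z in E ∩ Z, ψ z) / ∫ z in E, h z := by
  have hm : 0 < ∫ z in E, h z := hg.integral_pos
  have hEy : MeasurableSet (E ∩ Z) := hg.measurableSet.inter hZ
  have hR := measurableSet_acceptanceRegion hg.measurableSet hψ hh hZ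
  have hcube : MeasurableSet (Set.univ.pi fun _ : Fin d => Set.Ioo (0 : ℝ) 1) :=
    MeasurableSet.univ_pi fun _ => measurableSet_Ioo
  have hB : MeasurableSet {p : ℝ × (Fin d → ℝ) |
      p.2 ∈ (Set.univ.pi fun _ : Fin d => Set.Ioo (0 : ℝ) 1) ∧
        (p.1, transform g p.2) ∈ acceptanceRegion E ψ h Z} :=
    (measurable_snd hcube).inter
      ((measurable_fst.prodMk ((measurable_transform g).comp measurable_snd)) hR)
  set G : (Fin d → ℝ) → ENNReal :=
    (E ∩ Z).indicator (fun z => ENNReal.ofReal (ψ z / h z)) with hG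
  have hGm : Measurable G := (hψ.div hh).ennreal_ofReal.indicator hEy
  have h1 : volume (acceptancePart E ψ h Z) =
      ∫⁻ u in Set.univ.pi fun _ : Fin d => Set.Ioo (0 : ℝ) 1, G (transform g u) := by
    rw [hg.acceptancePart_eq, (volume_preserving_piFinSuccAbove (fun _ => ℝ)
      (Fin.last d)).measure_preimage hB.nullMeasurableSet, Measure.volume_eq_prod,
      Measure.prod_apply_symm hB, ← lintegral_indicator hcube]
    refine lintegral_congr fun u => ?_
    by_cases hu : u ∈ Set.univ.pi fun _ : Fin d => Set.Ioo (0 : ℝ) 1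
    · rw [Set.indicator_of_mem hu, hG, ← volume_slice_acceptanceRegion hψ0 hψh]
      congr 1
      ext w
      simp only [Set.mem_preimage, Set.mem_ofPred_eq, hu, true_and]
    · rw [Set.indicator_of_notMem hu]
      convert measure_empty (μ := (volume : Measure ℝ))
      ext w
      simp only [Set.mem_preimage, Set.mem_ofPred_eq, hu, false_and, Set.mem_empty_iff_false]
  have h2 : volume (acceptancePart E ψ h Z) =
      ENNReal.ofReal ((∫ z in E ∩ Z, ψ z) / ∫ z in E, h z) := by
    rw [h1, ← lintegral_map hGm (measurable_transform g), hg.map_transform,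
      lintegral_withDensity_eq_lintegral_mul _
        ((hh.indicator hg.measurableSet).div_const _).ennreal_ofReal hGm,
      ← integral_div, ofReal_integral_eq_lintegral_ofReal, ← lintegral_indicator hEy]
    · refine lintegral_congr fun z => ?_
      rw [Pi.mul_apply, hG]
      by_cases hz : z ∈ E ∩ Z
      · have hpos : 0 < h z := (hψ0 z hz.1).trans_lt (hψh z hz.1)
        rw [Set.indicator_of_mem hz, Set.indicator_of_mem hz, Set.indicator_of_mem hz.1,
          ← ENNReal.ofReal_mul (by positivity)]
        congr 1
        field_simp
      · rw [Set.indicator_of_notMem hz, Set.indicator_of_notMem hz, mul_zero]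
    · exact (hint.mono_set Set.inter_subset_left).div_const _
    · refine (ae_restrict_iff' hEy).2 (ae_of_all _ fun z hz => ?_)
      exact div_nonneg (hψ0 z hz.1) hm.le
  rw [measureReal_def, h2, ENNReal.toReal_ofReal]
  exact div_nonneg (setIntegral_nonneg hEy fun z hz => hψ0 z hz.1) hm.le

theorem IsFactorization.volume_acceptanceSet (hg : IsFactorization E h g) (hψ : Measurable ψ)
    (hh : Measurable h) (hint : IntegrableOn ψ E) (hψ0 : ∀ z ∈ E, 0 ≤ ψ z)
    (hψh : ∀ z ∈ E, ψ z < h z) :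
    volume.real (acceptanceSet E ψ h) = (∫ z in E, ψ z) / ∫ z in E, h z := by
  have := hg.volume_acceptancePart hψ hh hint hψ0 hψh MeasurableSet.univ
  simpa [acceptancePart] using this

end

/-! ### Discrepancy with respect to pseudo-convex sets -/

/-- The indicator of `A ∩ J` is the sum over `j` of those of `B j ∩ J` minus those of `(B j \ A) ∩
J`. These `2 p` sets are convex, and the bound for convex sets is uniform, so the constant does not
depend on `J`. -/
theorem IsPseudoConvex.exists_abs_sum_indicator_sub_le {s b : ℕ} (t : ℕ) (hs : 2 ≤ s)
    (hb : 2 ≤ b) {A : Set (Fin s → ℝ)} (hA : IsPseudoConvex A) (hAm : MeasurableSet A) :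
    ∃ C : ℝ, 0 ≤ C ∧ ∀ x : ℕ → Fin s → ℝ, IsSequence b t x →
      ∀ J : Set (Fin s → ℝ), Convex ℝ J → ∀ N : ℕ, 1 ≤ N →
        |∑ n ∈ Finset.range N, (A ∩ J).indicator (fun _ => (1 : ℝ)) (x n) -
            N * volume.real (A ∩ J)| ≤ C * (N : ℝ) ^ (1 - 1 / (s : ℝ)) := by
  classical
  obtain ⟨C, hC, hconv⟩ := exists_abs_sum_indicator_convex_sub_le t hs hb
  obtain ⟨-, p, B, hB, hdisj, hcov, hdiff⟩ := hA
  -- In the case `B j ⊆ A` the difference is empty, so both alternatives of the definition are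
  -- treated alike.
  have hD : ∀ j, Convex ℝ (B j \ A) := fun j => (hdiff j).elim
    (fun h => by rw [Set.sdiff_eq_empty.2 h]; exact convex_empty) id
  refine ⟨2 * p * C, by positivity, fun x hx J hJ N hN => ?_⟩
  have hBJ : ∀ j, Convex ℝ (B j ∩ J) := fun j => (hB j).2.inter hJ
  have hDJ : ∀ j, Convex ℝ ((B j \ A) ∩ J) := fun j => (hD j).inter hJ
  have hBI : ∀ j, B j ∩ J ⊆ Set.Icc 0 1 := fun j => Set.inter_subset_left.trans (hB j).1
  have hDI : ∀ j, (B j \ A) ∩ J ⊆ Set.Icc 0 1 := fun j =>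
    Set.inter_subset_left.trans (Set.sdiff_subset.trans (hB j).1)
  have hind : ∀ u, (A ∩ J).indicator (fun _ => (1 : ℝ)) u =
      ∑ j, ((B j ∩ J).indicator (fun _ => (1 : ℝ)) u -
        ((B j \ A) ∩ J).indicator (fun _ => (1 : ℝ)) u) := by
    intro u
    by_cases hu : u ∈ A ∩ J
    · obtain ⟨j, hj⟩ := Set.mem_iUnion.1 (hcov hu.1)
      rw [Finset.sum_eq_single_of_mem j (Finset.mem_univ j)]
      · simp [Set.indicator, hu.1, hu.2, hj]
      · intro i _ hi
        have : u ∉ B i := fun h => Set.disjoint_left.1 (hdisj i j hi) h hj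
        simp [Set.indicator, this]
    · rw [Set.indicator_of_notMem hu, Finset.sum_eq_zero]
      intro j _
      by_cases hJu : u ∈ J
      · have : u ∉ A := fun h => hu ⟨h, hJu⟩
        simp [Set.indicator, this]
      · simp [Set.indicator, hJu]
  have hfin : ∀ {S : Set (Fin s → ℝ)}, S ⊆ Set.Icc 0 1 → volume S ≠ ⊤ := fun h =>
    ne_top_of_le_ne_top isCompact_Icc.measure_lt_top.ne (measure_mono h)
  have hvol : volume.real (A ∩ J) =
      ∑ j, (volume.real (B j ∩ J) - volume.real ((B j \ A) ∩ J)) := by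
    have hU : A ∩ J = ⋃ j ∈ (Finset.univ : Finset (Fin p)), (B j ∩ J) ∩ A := by
      ext u
      simp only [Set.mem_inter_iff, Set.mem_iUnion, Finset.mem_univ, exists_true_left]
      constructor
      · rintro ⟨h1, h2⟩
        obtain ⟨j, hj⟩ := Set.mem_iUnion.1 (hcov h1)
        exact ⟨j, ⟨hj, h2⟩, h1⟩
      · rintro ⟨j, ⟨_, h2⟩, h1⟩
        exact ⟨h1, h2⟩
    rw [hU, measureReal_def, measure_biUnion_finset₀, ENNReal.toReal_sum]
    · refine Finset.sum_congr rfl fun j _ => ?_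
      have h1 := measureReal_inter_add_sdiff (μ := volume) (s := B j ∩ J) hAm (hfin (hBI j))
      have h2 : (B j ∩ J) \ A = (B j \ A) ∩ J := by
        ext u; simp only [Set.mem_sdiff, Set.mem_inter_iff]; tauto
      rw [h2] at h1
      rw [← measureReal_def]
      linarith
    · exact fun j _ => hfin (Set.inter_subset_left.trans (hBI j))
    · intro i _ j _ hij
      refine Disjoint.aedisjoint ?_
      exact (hdisj i j hij).mono (fun u h => h.1.1) fun u h => h.1.1
    -- Convex sets need not be Borel, but they are null measurable, which is enough for additivity.
    · exact fun j _ => ((hBJ j).nullMeasurableSet _).inter hAm.nullMeasurableSet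
  have hsum : ∑ n ∈ Finset.range N, (A ∩ J).indicator (fun _ => (1 : ℝ)) (x n) -
      N * volume.real (A ∩ J) =
      ∑ j, ((∑ n ∈ Finset.range N, (B j ∩ J).indicator (fun _ => (1 : ℝ)) (x n) -
          N * volume.real (B j ∩ J)) -
        (∑ n ∈ Finset.range N, ((B j \ A) ∩ J).indicator (fun _ => (1 : ℝ)) (x n) -
          N * volume.real ((B j \ A) ∩ J))) := by
    rw [hvol, Finset.sum_congr rfl fun n _ => hind (x n), Finset.sum_comm, Finset.mul_sum,
      ← Finset.sum_sub_distrib]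
    refine Finset.sum_congr rfl fun j _ => ?_
    rw [Finset.sum_sub_distrib]
    ring
  rw [hsum]
  refine (Finset.abs_sum_le_sum_abs _ _).trans ?_
  calc _ ≤ ∑ _j : Fin p, 2 * (C * (N : ℝ) ^ (1 - 1 / (s : ℝ))) := by
        refine Finset.sum_le_sum fun j _ => (abs_sub _ _).trans ?_
        have h1 := hconv x hx _ (hBI j) (hBJ j) N hN
        have h2 := hconv x hx _ (hDI j) (hDJ j) N hN
        linarith
    _ = _ := by simp; ring

/-- Few points of a `(t, s)`-sequence have a zero coordinate, so they do not matter. -/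
theorem IsPseudoConvex.exists_abs_sum_index_sub_le {s b : ℕ} (t : ℕ) (hs : 2 ≤ s)
    (hb : 2 ≤ b) {A : Set (Fin s → ℝ)} (hA : IsPseudoConvex A) (hAm : MeasurableSet A) :
    ∃ C : ℝ, 0 ≤ C ∧ ∀ x : ℕ → Fin s → ℝ, IsSequence b t x →
      ∀ J : Set (Fin s → ℝ), Convex ℝ J → ∀ Q : Set ℕ,
        (∀ n, (∀ i, x n i ≠ 0) → (n ∈ Q ↔ x n ∈ A ∩ J)) → ∀ N : ℕ, 1 ≤ N →
          |∑ n ∈ Finset.range N, Q.indicator (fun _ => (1 : ℝ)) n - N * volume.real (A ∩ J)| ≤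
            C * (N : ℝ) ^ (1 - 1 / (s : ℝ)) := by
  classical
  obtain ⟨C, hC, hpc⟩ := hA.exists_abs_sum_indicator_sub_le t hs hb hAm
  obtain ⟨C', hC', hconv⟩ := exists_abs_sum_indicator_convex_sub_le t hs hb
  refine ⟨C + s * C', by positivity, fun x hx J hJ Q hQ N hN => ?_⟩
  have hmain := hpc x hx J hJ N hN
  -- The faces of the cube through the origin are convex and null, so the convex bound itself limits
  -- the number of points on them.
  set Z : Fin s → Set (Fin s → ℝ) := fun i => Set.Icc 0 1 ∩ {u | u i = 0} with hZ
  have hzero : ∀ i, ∑ n ∈ Finset.range N, (Z i).indicator (fun _ => (1 : ℝ)) (x n) ≤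
      C' * (N : ℝ) ^ (1 - 1 / (s : ℝ)) := by
    intro i
    have hcv : Convex ℝ (Z i) := by
      refine (convex_Icc _ _).inter ?_
      intro u hu w hw p q _ _ _
      simp only [Set.mem_ofPred_eq] at hu hw ⊢
      simp [hu, hw]
    have hnull : volume (Z i) = 0 :=
      measure_mono_null Set.inter_subset_right (Measure.pi_hyperplane _ i 0)
    have h := hconv x hx (Z i) Set.inter_subset_left hcv N hN
    rw [measureReal_def, hnull, ENNReal.toReal_zero, mul_zero, sub_zero] at h
    exact (le_abs_self _).trans h
  have hdiff : ∀ n, |Q.indicator (fun _ => (1 : ℝ)) n -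
      (A ∩ J).indicator (fun _ => (1 : ℝ)) (x n)| ≤
      ∑ i, (Z i).indicator (fun _ => (1 : ℝ)) (x n) := by
    intro n
    have hZ0 : ∀ i ∈ Finset.univ, 0 ≤ (Z i).indicator (fun _ => (1 : ℝ)) (x n) :=
      fun i _ => Set.indicator_nonneg (fun _ _ => zero_le_one) _
    by_cases hn : ∀ i, x n i ≠ 0
    · have : Q.indicator (fun _ => (1 : ℝ)) n = (A ∩ J).indicator (fun _ => (1 : ℝ)) (x n) := by
        simp only [Set.indicator, hQ n hn]
      rw [this, sub_self, abs_zero]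
      exact Finset.sum_nonneg hZ0
    · push Not at hn
      obtain ⟨i, hi⟩ := hn
      have hmem : x n ∈ Z i := ⟨⟨fun j => ((hx.mem_Ico hb) n j).1,
        fun j => ((hx.mem_Ico hb) n j).2.le⟩, hi⟩
      have h1 : (1 : ℝ) ≤ ∑ i, (Z i).indicator (fun _ => (1 : ℝ)) (x n) := by
        refine le_trans ?_ (Finset.single_le_sum hZ0 (Finset.mem_univ i))
        rw [Set.indicator_of_mem hmem]
      have a0 : 0 ≤ (A ∩ J).indicator (fun _ => (1 : ℝ)) (x n) :=
        Set.indicator_nonneg (fun _ _ => zero_le_one) _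
      have a1 : (A ∩ J).indicator (fun _ => (1 : ℝ)) (x n) ≤ 1 :=
        Set.indicator_le_self' (fun _ _ => zero_le_one) _
      have b0 : 0 ≤ Q.indicator (fun _ => (1 : ℝ)) n :=
        Set.indicator_nonneg (fun _ _ => zero_le_one) n
      have b1 : Q.indicator (fun _ => (1 : ℝ)) n ≤ 1 :=
        Set.indicator_le_self' (fun _ _ => zero_le_one) n
      rw [abs_le]; constructor <;> linarith
  have htot : |∑ n ∈ Finset.range N, Q.indicator (fun _ => (1 : ℝ)) n -
      ∑ n ∈ Finset.range N, (A ∩ J).indicator (fun _ => (1 : ℝ)) (x n)| ≤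
      s * (C' * (N : ℝ) ^ (1 - 1 / (s : ℝ))) := by
    rw [← Finset.sum_sub_distrib]
    refine (Finset.abs_sum_le_sum_abs _ _).trans ?_
    refine (Finset.sum_le_sum fun n _ => hdiff n).trans ?_
    rw [Finset.sum_comm]
    refine (Finset.sum_le_sum fun i _ => hzero i).trans ?_
    simp
  rw [abs_le] at *
  constructor <;> nlinarith [hmain.1, hmain.2, htot.1, htot.2]

/-! ### The first accepted indices -/

/-- With `Nat.nth` counting from `0`, the first `n` indices satisfying `p` are exactly those below
`Nat.nth p n`. This replaces a sum over accepted indices by one over all indices. -/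
theorem sum_range_nth {p : ℕ → Prop} (hp : {n | p n}.Infinite) (f : ℕ → ℝ) (n : ℕ) :
    ∑ i ∈ Finset.range n, f (Nat.nth p i) =
      ∑ m ∈ Finset.range (Nat.nth p n), {m | p m}.indicator f m := by
  classical
  have hfilter : ∀ M, ∑ m ∈ Finset.range M, {m | p m}.indicator f m =
      ∑ m ∈ Finset.range M with p m, f m := by
    intro M
    rw [Finset.sum_filter]
    rfl
  rw [hfilter]
  induction n with
  | zero =>
    have h := Nat.count_nth_zero (p := p)
    rw [Nat.count_eq_card_filter_range, Finset.card_eq_zero] at h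
    rw [h]
    simp
  | succ n ih =>
    rw [Nat.filter_range_nth_eq_insert_of_infinite hp, Finset.sum_insert (by simp),
      Finset.sum_range_succ, ih, add_comm]

/-- If both `p` and `p ∧ q` have nearly linear counting functions, then the proportion of the first
`n` indices satisfying `p` that also satisfy `q` is near the quotient of the densities. -/
theorem exists_abs_sum_nth_sub_le {W C θ : ℝ} (hW : 0 < W) (hC : 0 ≤ C) (hθ0 : 0 ≤ θ)
    (hθ1 : θ < 1) :
    ∃ K : ℝ, 0 ≤ K ∧ ∀ (p : ℕ → Prop) (Q : Set ℕ) (V : ℝ), 0 ≤ V → V ≤ W →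
      (∀ N : ℕ, 1 ≤ N →
        |∑ n ∈ Finset.range N, {n | p n}.indicator (fun _ => (1 : ℝ)) n - N * W| ≤
          C * (N : ℝ) ^ θ) →
      (∀ N : ℕ, 1 ≤ N →
        |∑ n ∈ Finset.range N, ({n | p n} ∩ Q).indicator (fun _ => (1 : ℝ)) n - N * V| ≤
          C * (N : ℝ) ^ θ) →
      ∀ n : ℕ, 1 ≤ n →
        |∑ i ∈ Finset.range n, Q.indicator (fun _ => (1 : ℝ)) (Nat.nth p i) - n * (V / W)| ≤
          K * (n : ℝ) ^ θ := by
  classical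
  -- From `N₀` on, the error `C N ^ θ` is at most `N W / 2`, so at least half of the expected number
  -- of indices satisfy `p`.
  have hev : ∀ᶠ N : ℕ in Filter.atTop, 2 * C / W ≤ (N : ℝ) ^ (1 - θ) :=
    ((tendsto_rpow_atTop (by linarith : 0 < 1 - θ)).comp
      tendsto_natCast_atTop_atTop).eventually_ge_atTop _
  obtain ⟨N₀, hN₀⟩ := Filter.eventually_atTop.1 hev
  set κ : ℝ := N₀ + 2 / W with hκ
  have hκ0 : 0 ≤ κ := by positivity
  refine ⟨2 * C * κ ^ θ, by positivity, fun p Q V hV0 hVW hp hq n hn => ?_⟩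
  have hlarge : ∀ N : ℕ, 1 ≤ N → N₀ ≤ N →
      (N : ℝ) * W ≤ 2 * ∑ n ∈ Finset.range N, {n | p n}.indicator (fun _ => (1 : ℝ)) n := by
    intro N hN1 hN
    have hNpos : (0 : ℝ) < N := by exact_mod_cast hN1
    have h1 := hN₀ N hN
    have h2 : C * (N : ℝ) ^ θ ≤ N * W / 2 := by
      rw [Real.rpow_sub hNpos, Real.rpow_one, div_le_div_iff₀ hW (by positivity)] at h1
      linarith
    have h3 := (abs_le.1 (hp N hN1)).1
    linarith
  have hcount : ∀ N : ℕ, ∑ n ∈ Finset.range N, {n | p n}.indicator (fun _ => (1 : ℝ)) n =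
      Nat.count p N := by
    intro N
    rw [Nat.count_eq_card_filter_range, Finset.card_filter]
    push_cast
    rfl
  have hinf : {n | p n}.Infinite := by
    intro hfin
    have hle : ∀ N, (Nat.count p N : ℝ) ≤ hfin.toFinset.card := by
      intro N
      rw [Nat.count_eq_card_filter_range]
      exact_mod_cast Finset.card_le_card fun m hm =>
        hfin.mem_toFinset.2 (Finset.mem_filter.1 hm).2
    obtain ⟨M, hM⟩ := exists_nat_gt (2 * (hfin.toFinset.card : ℝ) / W)
    have h1 := hlarge (M + N₀ + 1) (by omega) (by omega)
    rw [hcount] at h1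
    have h2 := hle (M + N₀ + 1)
    rw [div_lt_iff₀ hW] at hM
    push_cast at h1
    nlinarith [(Nat.cast_nonneg N₀ : (0 : ℝ) ≤ N₀)]
  -- Exactly `n` indices below `M` satisfy `p`. Either `M ≤ N₀` or `M W ≤ 2 n`, hence `M ≤ κ n`.
  set M := Nat.nth p n with hM
  have hMn : n ≤ M := (Nat.nth_strictMono hinf).le_apply
  have hM1 : 1 ≤ M := hn.trans hMn
  have hn1 : (1 : ℝ) ≤ n := by exact_mod_cast hn
  have hcM : ∑ n ∈ Finset.range M, {n | p n}.indicator (fun _ => (1 : ℝ)) n = n := by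
    rw [hcount, hM, Nat.count_nth_of_infinite hinf]
  have hMκ : (M : ℝ) ≤ κ * n := by
    have h2W : 0 ≤ 2 / W := by positivity
    rcases le_total N₀ M with h | h
    · have h1 := hlarge M hM1 h
      rw [hcM] at h1
      have h3 : (M : ℝ) ≤ 2 / W * n := by
        rw [div_mul_eq_mul_div, le_div_iff₀ hW]
        exact h1
      nlinarith [(Nat.cast_nonneg N₀ : (0 : ℝ) ≤ N₀)]
    · have h1 : (M : ℝ) ≤ N₀ := by exact_mod_cast h
      nlinarith [(Nat.cast_nonneg N₀ : (0 : ℝ) ≤ N₀)]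
  have hMθ : (M : ℝ) ^ θ ≤ κ ^ θ * (n : ℝ) ^ θ := by
    rw [← Real.mul_rpow hκ0 (by positivity)]
    exact Real.rpow_le_rpow (by positivity) hMκ hθ0
  have hs : ∑ i ∈ Finset.range n, Q.indicator (fun _ => (1 : ℝ)) (Nat.nth p i) =
      ∑ m ∈ Finset.range M, ({n | p n} ∩ Q).indicator (fun _ => (1 : ℝ)) m := by
    rw [sum_range_nth hinf]
    refine Finset.sum_congr rfl fun m _ => ?_
    rw [Set.indicator_indicator]
  have h1 := hp M hM1
  rw [hcM] at h1
  have h2 := hq M hM1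
  rw [← hs] at h2
  -- The count of `p` up to `M` shows that `M W` is close to `n`; scaling by `V / W ≤ 1` keeps the
  -- error. This and the count of `p ∧ q` account for the factor `2` in the constant.
  have h3 : |(n : ℝ) * (V / W) - M * V| ≤ C * (M : ℝ) ^ θ := by
    have : (n : ℝ) * (V / W) - M * V = (V / W) * (n - M * W) := by field_simp
    rw [this, abs_mul, abs_of_nonneg (by positivity)]
    have hr : V / W ≤ 1 := (div_le_one hW).2 hVW
    calc V / W * |(n : ℝ) - M * W| ≤ 1 * (C * (M : ℝ) ^ θ) :=
          mul_le_mul hr h1 (abs_nonneg _) zero_le_one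
      _ = _ := one_mul _
  have h4 := mul_le_mul_of_nonneg_left hMθ hC
  rw [abs_le] at *
  constructor <;> nlinarith [h2.1, h2.2, h3.1, h3.2]

section

/-! ### The two sampling steps -/

variable {d : ℕ} {E : Set (Fin d → ℝ)} {ψ h : (Fin d → ℝ) → ℝ} {g : Fin d → ℝ → ℝ}

theorem IsProductDensityOn.exists_isFactorization (hprod : IsProductDensityOn E h)
    (hE : MeasurableSet E) (hpos : 0 < ∫ x in E, h x) :
    ∃ g : Fin d → ℝ → ℝ, IsFactorization E h g := by
  obtain ⟨g, hg, hae⟩ := hprod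
  exact ⟨g, hE, fun j => (hg j).1, fun j => (hg j).2, hae, hpos⟩

/-- The assumptions on one acceptance-rejection step. -/
structure IsAcceptanceStep (E : Set (Fin d → ℝ)) (ψ h : (Fin d → ℝ) → ℝ) : Prop where
  measurableSet : MeasurableSet E
  measurable_target : Measurable ψ
  measurable_proposal : Measurable h
  integrableOn_target : IntegrableOn ψ E
  integrableOn_proposal : IntegrableOn h E
  nonneg : ∀ z ∈ E, 0 ≤ ψ z
  lt : ∀ z ∈ E, ψ z < h z
  isProductDensityOn : IsProductDensityOn E h
  isPseudoConvex : IsPseudoConvex (acceptanceSet E ψ h)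
  integral_pos : 0 < ∫ z in E, ψ z

/-- The box in driver space that corresponds to `(-∞, y]` in state space. -/
def driverBox (E : Set (Fin d → ℝ)) (h : (Fin d → ℝ) → ℝ) (y : Fin d → ℝ) :
    Set (Fin (d + 1) → ℝ) :=
  {u | ∀ j : Fin d, u j.castSucc ≤ marginalCDF E h j (y j)}

theorem convex_driverBox (E : Set (Fin d → ℝ)) (h : (Fin d → ℝ) → ℝ) (y : Fin d → ℝ) :
    Convex ℝ (driverBox E h y) := by
  intro u hu w hw p q hp hq hpq j
  have h1 := mul_le_mul_of_nonneg_left (hu j) hp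
  have h2 := mul_le_mul_of_nonneg_left (hw j) hq
  have h3 : marginalCDF E h j (y j) = p * marginalCDF E h j (y j) + q * marginalCDF E h j (y j) := by
    rw [← add_mul, hpq, one_mul]
  simp only [Pi.add_apply, Pi.smul_apply, smul_eq_mul]
  linarith

theorem inverseTransform_eq_of_ne_zero (c c' : Fin d → ℝ) {u : Fin d → ℝ} (hu : ∀ j, u j ≠ 0) :
    inverseTransform E h c u = inverseTransform E h c' u := by
  funext j
  simp [inverseTransform, hu j]

/-- The arbitrary values `c` matter only at zero coordinates. -/
theorem accepts_iff_mem_acceptanceSet (c : Fin d → ℝ) {u : Fin (d + 1) → ℝ}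
    (hu : ∀ i, 0 < u i ∧ u i < 1) : Accepts E ψ h c u ↔ u ∈ acceptanceSet E ψ h := by
  have hT : inverseTransform E h c (Fin.init u) = inverseTransform E h 0 (Fin.init u) :=
    inverseTransform_eq_of_ne_zero c 0 fun j => (hu j.castSucc).1.ne'
  simp only [acceptanceSet, Accepts, Set.mem_ofPred_eq, hT]
  exact ⟨fun h => ⟨hu, h⟩, fun h => h.2⟩

theorem IsFactorization.inverseTransform_mem_Iic_iff (hg : IsFactorization E h g) (c : Fin d → ℝ)
    {u : Fin (d + 1) → ℝ} (hu : ∀ j : Fin d, 0 < u j.castSucc ∧ u j.castSucc < 1)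
    (y : Fin d → ℝ) :
    inverseTransform E h c (Fin.init u) ∈ Set.Iic y ↔ u ∈ driverBox E h y := by
  rw [Set.mem_Iic, Pi.le_def]
  exact forall_congr' fun j => hg.inverseTransform_le_iff c (u := Fin.init u) (hu j) (y j)

theorem IsFactorization.acceptanceSet_inter_driverBox (hg : IsFactorization E h g)
    (y : Fin d → ℝ) :
    acceptanceSet E ψ h ∩ driverBox E h y = acceptancePart E ψ h (Set.Iic y) := by
  ext u
  refine and_congr_right fun hu => ?_
  exact (hg.inverseTransform_mem_Iic_iff 0 (fun j => hu.1 j.castSucc) y).symm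

/-- The error of the first `n` accepted points. -/
theorem IsAcceptanceStep.exists_abs_sum_sub_le {b : ℕ} (t : ℕ) (hd : 1 ≤ d) (hb : 2 ≤ b)
    (hS : IsAcceptanceStep E ψ h) :
    ∃ C : ℝ, 0 ≤ C ∧ ∀ (x : ℕ → Fin (d + 1) → ℝ) (c : Fin d → ℝ), IsSequence b t x →
      ∀ (y : Fin d → ℝ) (n : ℕ), 1 ≤ n →
        |((acceptedPoints E ψ h c x n).map ((Set.Iic y).indicator fun _ => (1 : ℝ))).sum -
            n * ((∫ z in E ∩ Set.Iic y, ψ z) / ∫ z in E, ψ z)| ≤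
          C * (n : ℝ) ^ (1 - 1 / ((d : ℝ) + 1)) := by
  have hmass : 0 < ∫ z in E, h z := hS.integral_pos.trans_le
    (setIntegral_mono_on hS.integrableOn_target hS.integrableOn_proposal hS.measurableSet
      fun z hz => (hS.lt z hz).le)
  obtain ⟨g, hg⟩ := hS.isProductDensityOn.exists_isFactorization hS.measurableSet hmass
  have hAm : MeasurableSet (acceptanceSet E ψ h) := by
    have := hg.measurableSet_acceptancePart hS.measurable_target hS.measurable_proposal
      MeasurableSet.univ
    simpa [acceptancePart] using this
  obtain ⟨C, hC, hcount⟩ := hS.isPseudoConvex.exists_abs_sum_index_sub_le t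
    (by omega : 2 ≤ d + 1) hb hAm
  have hvol := hg.volume_acceptanceSet hS.measurable_target hS.measurable_proposal
    hS.integrableOn_target hS.nonneg hS.lt
  have hd1 : (1 : ℝ) ≤ d := by exact_mod_cast hd
  have hθ0 : 0 ≤ 1 - 1 / ((d : ℝ) + 1) := by
    rw [sub_nonneg, div_le_one (by linarith)]
    linarith
  have hθ1 : 1 - 1 / ((d : ℝ) + 1) < 1 := by
    have : 0 < 1 / ((d : ℝ) + 1) := by positivity
    linarith
  have hW : 0 < volume.real (acceptanceSet E ψ h) := by
    rw [hvol]
    exact div_pos hS.integral_pos hmass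
  obtain ⟨K, hK, hnth⟩ := exists_abs_sum_nth_sub_le hW hC hθ0 hθ1
  refine ⟨K, hK, fun x c hx y n hn => ?_⟩
  have hIoo : ∀ m, (∀ i, x m i ≠ 0) → ∀ i, 0 < x m i ∧ x m i < 1 := fun m hm i =>
    ⟨lt_of_le_of_ne (hx.mem_Ico hb m i).1 (hm i).symm, (hx.mem_Ico hb m i).2⟩
  set Q : Set ℕ := {m | inverseTransform E h c (Fin.init (x m)) ∈ Set.Iic y} with hQ
  have hsum : ((acceptedPoints E ψ h c x n).map ((Set.Iic y).indicator fun _ => (1 : ℝ))).sum =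
      ∑ i ∈ Finset.range n,
        Q.indicator (fun _ => (1 : ℝ)) (Nat.nth (fun r => Accepts E ψ h c (x r)) i) := by
    rw [acceptedPoints, Multiset.map_map]
    rfl
  have hpart := hg.volume_acceptancePart hS.measurable_target hS.measurable_proposal
    hS.integrableOn_target hS.nonneg hS.lt (measurableSet_Iic (a := y))
  -- The proposal mass cancels in the quotient, which leaves the normalized target mass.
  have hpart' : volume.real (acceptancePart E ψ h (Set.Iic y)) /
      volume.real (acceptanceSet E ψ h) = (∫ z in E ∩ Set.Iic y, ψ z) / ∫ z in E, ψ z := by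
    rw [hvol, hpart, div_div_div_cancel_right₀ hmass.ne']
  rw [hsum, ← hpart']
  refine hnth _ Q _ measureReal_nonneg ?_ ?_ ?_ n hn
  · refine measureReal_mono Set.inter_subset_left ?_
    exact ne_top_of_le_ne_top isCompact_Icc.measure_lt_top.ne
      (measure_mono hS.isPseudoConvex.1)
  · intro N hN
    have := hcount x hx Set.univ convex_univ {m | Accepts E ψ h c (x m)} (fun m hm => by
      rw [Set.inter_univ]
      exact accepts_iff_mem_acceptanceSet c (hIoo m hm)) N hN
    rw [Set.inter_univ] at this
    push_cast at this
    exact this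
  · intro N hN
    have := hcount x hx (driverBox E h y) (convex_driverBox E h y)
      ({m | Accepts E ψ h c (x m)} ∩ Q) (fun m hm => by
        refine and_congr (accepts_iff_mem_acceptanceSet c (hIoo m hm)) ?_
        exact hg.inverseTransform_mem_Iic_iff c (fun j => hIoo m hm j.castSucc) y) N hN
    rw [hg.acceptanceSet_inter_driverBox] at this
    push_cast at this
    exact this

/-- The error of the first `n` points obtained by inversion. -/
theorem exists_abs_sum_invertedPoints_sub_le {b : ℕ} (t : ℕ) (hd : 1 ≤ d) (hb : 2 ≤ b) :
    ∃ C : ℝ, 0 ≤ C ∧ ∀ (E : Set (Fin d → ℝ)) (h : (Fin d → ℝ) → ℝ), MeasurableSet E →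
      IsProductDensityOn E h → 0 < ∫ z in E, h z →
      ∀ (x : ℕ → Fin (d + 1) → ℝ) (c : Fin d → ℝ), IsSequence b t x →
      ∀ (y : Fin d → ℝ) (n : ℕ), 2 ≤ n →
        |((invertedPoints E h c x n).map ((Set.Iic y).indicator fun _ => (1 : ℝ))).sum -
            n * ((∫ z in E ∩ Set.Iic y, h z) / ∫ z in E, h z)| ≤ C * Real.log n ^ d := by
  obtain ⟨C, hC, hbox⟩ := exists_abs_sum_indicator_sub_le t hd hb
  refine ⟨C, hC, fun E h hE hprod hpos x c hx y n hn => ?_⟩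
  obtain ⟨g, hg⟩ := hprod.exists_isFactorization hE hpos
  rw [← hg.prod_marginalCDF]
  have hsum : ((invertedPoints E h c x n).map ((Set.Iic y).indicator fun _ => (1 : ℝ))).sum =
      ∑ i ∈ Finset.range n,
        {m | inverseTransform E h c (Fin.init (x m)) ∈ Set.Iic y}.indicator
          (fun _ => (1 : ℝ)) i := by
    rw [invertedPoints, Multiset.map_map]
    rfl
  rw [hsum]
  refine hbox x hx _ (fun j => hg.marginalCDF_mem_Icc j (y j)) _ (fun m hm => ?_) n hn
  exact hg.inverseTransform_mem_Iic_iff c (fun j =>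
    ⟨lt_of_le_of_ne (hx.mem_Ico hb m _).1 (hm j).symm, (hx.mem_Ico hb m _).2⟩) y

/-! ### The regions of the algorithm -/

section Regions

variable {k : ℕ} {D : Set (Fin d → ℝ)} {H : ℕ → (Fin d → ℝ) → ℝ}

theorem remainder_eq_add {l : ℕ} (hl : l ≤ k) (z : Fin d → ℝ) :
    remainder k H l z = H l z + remainder k H (l + 1) z := by
  have hI : Finset.Icc l k = insert l (Finset.Icc (l + 1) k) := by
    ext i
    simp only [Finset.mem_Icc, Finset.mem_insert]
    omega
  rw [remainder, hI, Finset.sum_insert (by simp), remainder]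

theorem measurable_remainder (hH : ∀ l ∈ Finset.Icc 1 k, Measurable (H l)) {l : ℕ} (hl : 1 ≤ l) :
    Measurable (remainder k H l) := by
  refine Finset.measurable_fun_sum _ fun i hi => hH i ?_
  rw [Finset.mem_Icc] at hi ⊢
  omega

theorem integrableOn_remainder (hH : ∀ l ∈ Finset.Icc 1 k, IntegrableOn (H l) D) {l : ℕ}
    (hl : 1 ≤ l) : IntegrableOn (remainder k H l) D := by
  refine integrable_finsetSum _ fun i hi => hH i ?_
  rw [Finset.mem_Icc] at hi ⊢
  omega

theorem regionL_subset (l : ℕ) : regionL D k H l ⊆ D := by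
  induction l with
  | zero => exact subset_rfl
  | succ l ih => exact fun z hz => ih hz.1

theorem regionS_subset (l : ℕ) : regionS D k H l ⊆ D := fun _ hz => regionL_subset _ hz.1

theorem measurableSet_regionL (hD : MeasurableSet D) (hH : ∀ l ∈ Finset.Icc 1 k, Measurable (H l))
    {l : ℕ} (hl : l ≤ k) : MeasurableSet (regionL D k H l) := by
  induction l with
  | zero => exact hD
  | succ l ih =>
    exact (ih (by omega)).inter (measurableSet_le
      (hH _ (Finset.mem_Icc.2 ⟨by omega, hl⟩)) (measurable_remainder hH (by omega)))

theorem measurableSet_regionS (hD : MeasurableSet D) (hH : ∀ l ∈ Finset.Icc 1 k, Measurable (H l))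
    {l : ℕ} (hl : l ∈ Finset.Icc 1 k) : MeasurableSet (regionS D k H l) := by
  have hl' := Finset.mem_Icc.1 hl
  exact (measurableSet_regionL hD hH (by omega)).inter (measurableSet_lt
    (measurable_remainder hH hl'.1) (hH _ hl))

/-- On `L l` the inequality `H l ≤ H l + remainder k H (l + 1)` holds by construction; for `l = 0`
this is the assumption on the target. The signs of the individual `H i` play no role. -/
theorem remainder_nonneg (h0 : ∀ z ∈ D, 0 ≤ remainder k H 1 z) {l : ℕ} (hl : l ≤ k) :
    ∀ z ∈ regionL D k H l, 0 ≤ remainder k H (l + 1) z := by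
  cases l with
  | zero => exact h0
  | succ l =>
    intro z hz
    have h1 := hz.2
    rw [remainder_eq_add hl] at h1
    linarith

/-- At step `k` the remainder is `H k` itself, so the strict inequality fails. -/
theorem regionS_last : regionS D k H k = ∅ := by
  ext z
  simp [regionS, remainder]

/-- The mass of the target in `D ∩ Z` is the sum of the masses that the steps contribute. -/
theorem setIntegral_remainder_eq (hD : MeasurableSet D)
    (hH : ∀ l ∈ Finset.Icc 1 k, Measurable (H l) ∧ IntegrableOn (H l) D)
    {Z : Set (Fin d → ℝ)} (hZ : MeasurableSet Z) :
    ∫ z in D ∩ Z, remainder k H 1 z = ∑ l ∈ Finset.Icc 1 k,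
      ((∫ z in regionS D k H l ∩ Z, remainder k H l z) + ∫ z in regionL D k H l ∩ Z, H l z) := by
  have hHm := fun l hl => (hH l hl).1
  have hHi := fun l hl => (hH l hl).2
  -- After `m` steps the unsampled mass is that of the next remainder on `L m`. For `m = k` this
  -- remainder is an empty sum.
  have key : ∀ m ≤ k, ∫ z in D ∩ Z, remainder k H 1 z = ∑ l ∈ Finset.Icc 1 m,
      ((∫ z in regionS D k H l ∩ Z, remainder k H l z) + ∫ z in regionL D k H l ∩ Z, H l z) +
        ∫ z in regionL D k H m ∩ Z, remainder k H (m + 1) z := by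
    intro m hm
    induction m with
    | zero => simp [regionL]
    | succ m ih =>
      have hmem : m + 1 ∈ Finset.Icc 1 k := Finset.mem_Icc.2 ⟨by omega, hm⟩
      have hU : regionL D k H m ∩ Z =
          (regionS D k H (m + 1) ∩ Z) ∪ (regionL D k H (m + 1) ∩ Z) := by
        ext z
        simp only [regionS, regionL, Set.mem_inter_iff, Set.mem_union, Set.mem_ofPred_eq,
          Nat.add_sub_cancel]
        have := lt_or_ge (remainder k H (m + 1) z) (H (m + 1) z)
        tauto
      have hdisj : Disjoint (regionS D k H (m + 1) ∩ Z) (regionL D k H (m + 1) ∩ Z) :=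
        Set.disjoint_left.2 fun z h1 h2 => absurd h1.1.2 (not_lt.2 h2.1.2)
      have hR : ∀ {A : Set (Fin d → ℝ)} {l : ℕ}, A ⊆ D → 1 ≤ l →
          IntegrableOn (remainder k H l) (A ∩ Z) := fun hA hl =>
        (integrableOn_remainder hHi hl).mono_set (Set.inter_subset_left.trans hA)
      have hLm : MeasurableSet (regionL D k H (m + 1) ∩ Z) :=
        (measurableSet_regionL hD hHm hm).inter hZ
      rw [ih (by omega), Finset.sum_Icc_succ_top (by omega), hU,
        setIntegral_union hdisj hLm (hR (regionS_subset _) (by omega))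
          (hR (regionL_subset _) (by omega)),
        setIntegral_congr_fun (s := regionL D k H (m + 1) ∩ Z) hLm
          (fun z _ => remainder_eq_add hm z),
        integral_add ((hHi _ hmem).mono_set (Set.inter_subset_left.trans (regionL_subset _)))
          (hR (regionL_subset _) (by omega))]
      ring
  rw [key k le_rfl]
  simp [remainder]

end Regions

end

/-! ### Combining the pieces -/

/-- A sample that is made up of pieces with rounded sizes `⌈N γ i⌉` inherits the errors of its
pieces. -/
theorem abs_combined_sub_le {ι : Type*} (I : Finset ι) {γ a μ err : ι → ℝ} {N : ℕ} (hN : 1 ≤ N)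
    (hγ : ∀ i ∈ I, 0 ≤ γ i) (hγ1 : ∑ i ∈ I, γ i = 1) (hμ : ∀ i ∈ I, 0 ≤ μ i ∧ μ i ≤ 1)
    (herr : ∀ i ∈ I, |a i - ⌈(N : ℝ) * γ i⌉₊ * μ i| + (if γ i = 0 then 0 else 1) ≤ err i) :
    |(1 / ((∑ i ∈ I, ⌈(N : ℝ) * γ i⌉₊ : ℕ) : ℝ)) * ∑ i ∈ I, a i - ∑ i ∈ I, γ i * μ i| ≤
      (∑ i ∈ I, err i) / N := by
  have hN0 : (0 : ℝ) < N := by exact_mod_cast hN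
  set n : ι → ℝ := fun i => (⌈(N : ℝ) * γ i⌉₊ : ℝ) with hn
  set δ : ι → ℝ := fun i => if γ i = 0 then 0 else 1 with hδ
  have hround : ∀ i ∈ I, 0 ≤ n i - N * γ i ∧ n i - N * γ i ≤ δ i := by
    intro i hi
    by_cases h : γ i = 0
    · simp [hn, hδ, h]
    · simp only [hn, hδ, h, if_false]
      have h1 := Nat.le_ceil ((N : ℝ) * γ i)
      have h2 := Nat.ceil_lt_add_one (mul_nonneg hN0.le (hγ i hi))
      constructor <;> linarith
  have hM : ((∑ i ∈ I, ⌈(N : ℝ) * γ i⌉₊ : ℕ) : ℝ) = ∑ i ∈ I, n i := by push_cast; rfl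
  rw [hM]
  set M := ∑ i ∈ I, n i with hMdef
  have hdiff : M - N = ∑ i ∈ I, (n i - N * γ i) := by
    rw [Finset.sum_sub_distrib, ← Finset.mul_sum, hγ1, mul_one]
  have hMN : (N : ℝ) ≤ M := by
    have := Finset.sum_nonneg fun i hi => (hround i hi).1
    linarith
  have hM0 : 0 < M := hN0.trans_le hMN
  have hΔ0 : 0 ≤ M - N := by linarith
  have hΔ1 : M - N ≤ ∑ i ∈ I, δ i := by
    rw [hdiff]
    exact Finset.sum_le_sum fun i hi => (hround i hi).2
  have hγμ0 : 0 ≤ ∑ i ∈ I, γ i * μ i :=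
    Finset.sum_nonneg fun i hi => mul_nonneg (hγ i hi) (hμ i hi).1
  have hγμ1 : ∑ i ∈ I, γ i * μ i ≤ 1 := by
    rw [← hγ1]
    exact Finset.sum_le_sum fun i hi => mul_le_of_le_one_right (hγ i hi) (hμ i hi).2
  have hr0 : 0 ≤ ∑ i ∈ I, (n i - N * γ i) * μ i :=
    Finset.sum_nonneg fun i hi => mul_nonneg (hround i hi).1 (hμ i hi).1
  have hr1 : ∑ i ∈ I, (n i - N * γ i) * μ i ≤ ∑ i ∈ I, δ i :=
    Finset.sum_le_sum fun i hi =>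
      (mul_le_of_le_one_right (hround i hi).1 (hμ i hi).2).trans (hround i hi).2
  have hs0 : 0 ≤ (M - N) * ∑ i ∈ I, γ i * μ i := mul_nonneg hΔ0 hγμ0
  have hs1 : (M - N) * ∑ i ∈ I, γ i * μ i ≤ ∑ i ∈ I, δ i :=
    (mul_le_of_le_one_right hΔ0 hγμ1).trans hΔ1
  have ha : |∑ i ∈ I, (a i - n i * μ i)| ≤ ∑ i ∈ I, |a i - n i * μ i| :=
    Finset.abs_sum_le_sum_abs _ _
  -- Two rounding terms occur, one from the piece sizes and one from the total `M`. Both lie in `[0,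
  -- ∑ δ i]`, so their difference costs `∑ δ i` only once.
  have hsplit : ∑ i ∈ I, a i - M * ∑ i ∈ I, γ i * μ i = ∑ i ∈ I, (a i - n i * μ i) +
      (∑ i ∈ I, (n i - N * γ i) * μ i - (M - N) * ∑ i ∈ I, γ i * μ i) := by
    have : ∑ i ∈ I, (n i - N * γ i) * μ i = ∑ i ∈ I, n i * μ i - N * ∑ i ∈ I, γ i * μ i := by
      rw [Finset.mul_sum, ← Finset.sum_sub_distrib]
      exact Finset.sum_congr rfl fun i _ => by ring
    rw [this, Finset.sum_sub_distrib]
    ring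
  have herr' : ∑ i ∈ I, |a i - n i * μ i| + ∑ i ∈ I, δ i ≤ ∑ i ∈ I, err i := by
    rw [← Finset.sum_add_distrib]
    exact Finset.sum_le_sum herr
  have hkey : |∑ i ∈ I, a i - M * ∑ i ∈ I, γ i * μ i| ≤ ∑ i ∈ I, err i := by
    rw [hsplit]
    rw [abs_le] at ha ⊢
    constructor <;> linarith [ha.1, ha.2]
  have hdiv : 1 / M * ∑ i ∈ I, a i - ∑ i ∈ I, γ i * μ i =
      (∑ i ∈ I, a i - M * ∑ i ∈ I, γ i * μ i) / M := by
    field_simp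
  rw [hdiv, abs_div, abs_of_pos hM0]
  exact (div_le_div_of_nonneg_right hkey hM0.le).trans
    (div_le_div_of_nonneg_left ((abs_nonneg _).trans hkey) hN0 hMN)

theorem ceil_le_two_mul {r : ℝ} (hr : 2 ≤ r) : 2 ≤ ⌈r⌉₊ ∧ (⌈r⌉₊ : ℝ) ≤ 2 * r := by
  constructor
  · exact Nat.cast_le.1 ((by exact_mod_cast hr : ((2 : ℕ) : ℝ) ≤ r).trans (Nat.le_ceil r))
  · have := Nat.ceil_lt_add_one (by linarith : 0 ≤ r)
    linarith

/-- For `r ≥ 2` the rounding error `1` is at most `r ^ θ`, and the factor `log r / log 2 ≥ 1` is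
inserted freely to match the claimed form. -/
theorem rpow_ceil_add_one_le {C r θ : ℝ} (hC : 0 ≤ C) (hθ0 : 0 ≤ θ) (hθ1 : θ ≤ 1) (hr : 2 ≤ r) :
    C * (⌈r⌉₊ : ℝ) ^ θ + 1 ≤ (2 * C + 1) / Real.log 2 * r ^ θ * Real.log r := by
  have hlog2 : 0 < Real.log 2 := Real.log_pos (by norm_num)
  have h1 : (⌈r⌉₊ : ℝ) ^ θ ≤ 2 * r ^ θ := by
    refine (Real.rpow_le_rpow (Nat.cast_nonneg _) (ceil_le_two_mul hr).2 hθ0).trans ?_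
    rw [Real.mul_rpow (by norm_num) (by linarith)]
    refine mul_le_mul_of_nonneg_right ?_ (Real.rpow_nonneg (by linarith) _)
    calc (2 : ℝ) ^ θ ≤ 2 ^ (1 : ℝ) := Real.rpow_le_rpow_of_exponent_le (by norm_num) hθ1
      _ = 2 := Real.rpow_one _
  have h2 : 1 ≤ r ^ θ := Real.one_le_rpow (by linarith) hθ0
  have h3 : 1 ≤ Real.log r / Real.log 2 := by
    rw [one_le_div hlog2]
    exact Real.log_le_log (by norm_num) hr
  calc C * (⌈r⌉₊ : ℝ) ^ θ + 1 ≤ C * (2 * r ^ θ) + r ^ θ :=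
        add_le_add (mul_le_mul_of_nonneg_left h1 hC) h2
    _ = (2 * C + 1) * r ^ θ := by ring
    _ ≤ (2 * C + 1) * r ^ θ * (Real.log r / Real.log 2) :=
        le_mul_of_one_le_right (by positivity) h3
    _ = _ := by ring

/-- Rounding up at most squares `r` inside the logarithm, and `1` is absorbed because `log r ≥ log
2`. -/
theorem log_ceil_pow_add_one_le {C r : ℝ} (hC : 0 ≤ C) (hr : 2 ≤ r) (d : ℕ) :
    C * Real.log ⌈r⌉₊ ^ d + 1 ≤ (C * 2 ^ d + (1 / Real.log 2) ^ d) * Real.log r ^ d := by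
  have hlog2 : 0 < Real.log 2 := Real.log_pos (by norm_num)
  have hlog : Real.log 2 ≤ Real.log r := Real.log_le_log (by norm_num) hr
  obtain ⟨h2, hle⟩ := ceil_le_two_mul hr
  have h2' : (2 : ℝ) ≤ ⌈r⌉₊ := by exact_mod_cast h2
  have h1 : Real.log ⌈r⌉₊ ≤ 2 * Real.log r := by
    refine (Real.log_le_log (by linarith) hle).trans ?_
    rw [Real.log_mul (by norm_num) (by linarith)]
    linarith
  have h0 : 0 ≤ Real.log ⌈r⌉₊ := Real.log_nonneg (by linarith)
  have h3 : Real.log ⌈r⌉₊ ^ d ≤ 2 ^ d * Real.log r ^ d := by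
    rw [← mul_pow]
    exact pow_le_pow_left₀ h0 h1 d
  have h4 : 1 ≤ (1 / Real.log 2) ^ d * Real.log r ^ d := by
    rw [← mul_pow, one_div_mul_eq_div]
    exact one_le_pow₀ ((one_le_div hlog2).2 hlog)
  have h5 := mul_le_mul_of_nonneg_left h3 hC
  linarith

/-- The bound of an acceptance-rejection step, written with the powers of `α` and `N` apart. -/
theorem rpow_scaling {C α r θ : ℝ} {N : ℕ} (hN : 1 ≤ N) (hα : 0 ≤ α) (s : ℝ)
    (hθ : θ = 1 - 1 / s) :
    C * (α * N) ^ θ * r / N = C * α ^ θ * r / (N : ℝ) ^ (1 / s) := by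
  have hN0 : (0 : ℝ) < N := by exact_mod_cast hN
  have hp : 0 < (N : ℝ) ^ (1 / s) := Real.rpow_pos_of_pos hN0 _
  have h1 : (N : ℝ) ^ θ = N / (N : ℝ) ^ (1 / s) := by
    rw [hθ, Real.rpow_sub hN0, Real.rpow_one]
  rw [Real.mul_rpow hα hN0.le, h1]
  field_simp

/-! ### Signs and masses of the pieces -/

section Steps

variable {d k : ℕ} {D : Set (Fin d → ℝ)} {H : ℕ → (Fin d → ℝ) → ℝ}

theorem isAcceptanceStep_regionS (hD : MeasurableSet D)
    (hH : ∀ l ∈ Finset.Icc 1 k, Measurable (H l) ∧ IntegrableOn (H l) D)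
    (h0 : ∀ z ∈ D, 0 ≤ remainder k H 1 z) {l : ℕ} (hl : l ∈ Finset.Icc 1 k)
    (hprod : IsProductDensityOn (regionS D k H l) (H l))
    (hpc : IsPseudoConvex (acceptanceSet (regionS D k H l) (remainder k H l) (H l)))
    (hpos : 0 < ∫ z in regionS D k H l, remainder k H l z) :
    IsAcceptanceStep (regionS D k H l) (remainder k H l) (H l) where
  measurableSet := measurableSet_regionS hD (fun l hl => (hH l hl).1) hl
  measurable_target := measurable_remainder (fun l hl => (hH l hl).1) (Finset.mem_Icc.1 hl).1
  measurable_proposal := (hH l hl).1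
  integrableOn_target := (integrableOn_remainder (fun l hl => (hH l hl).2)
    (Finset.mem_Icc.1 hl).1).mono_set (regionS_subset l)
  integrableOn_proposal := (hH l hl).2.mono_set (regionS_subset l)
  nonneg := fun z hz => by
    have hl' := Finset.mem_Icc.1 hl
    have := remainder_nonneg h0 (l := l - 1) (by omega) z hz.1
    rwa [Nat.sub_add_cancel hl'.1] at this
  lt := fun z hz => hz.2
  isProductDensityOn := hprod
  isPseudoConvex := hpc
  integral_pos := hpos

/-- The `H l` may change sign, but the factors of a product density are nonnegative. This is what
makes the `β` nonnegative. -/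
theorem IsProductDensityOn.ae_nonneg {E : Set (Fin d → ℝ)} {h : (Fin d → ℝ) → ℝ}
    (hprod : IsProductDensityOn E h) (hE : MeasurableSet E) : 0 ≤ᵐ[volume.restrict E] h := by
  obtain ⟨g, hg, hae⟩ := hprod
  refine (ae_restrict_iff' hE).2 (hae.mono fun z hz hzE => ?_)
  rw [Set.indicator_of_mem hzE] at hz
  simp only [Pi.zero_apply]
  rw [hz]
  exact Finset.prod_nonneg fun j _ => (hg j).2 _

theorem setIntegral_inter_mem_Icc {E Z : Set (Fin d → ℝ)} {f : (Fin d → ℝ) → ℝ}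
    (hf : IntegrableOn f E) (hf0 : 0 ≤ᵐ[volume.restrict E] f) :
    0 ≤ ∫ z in E ∩ Z, f z ∧ ∫ z in E ∩ Z, f z ≤ ∫ z in E, f z :=
  ⟨integral_nonneg_of_ae (ae_restrict_of_ae_restrict_of_subset Set.inter_subset_left hf0),
    setIntegral_mono_set hf hf0 Set.inter_subset_left.eventuallyLE⟩

/-- The mass of a piece in `Z` is its total mass times the proportion that lies in `Z`. -/
theorem setIntegral_inter_eq_mul {E Z : Set (Fin d → ℝ)} {f : (Fin d → ℝ) → ℝ}
    (hf : IntegrableOn f E) (hf0 : 0 ≤ᵐ[volume.restrict E] f) :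
    ∫ z in E ∩ Z, f z = (∫ z in E, f z) * ((∫ z in E ∩ Z, f z) / ∫ z in E, f z) := by
  -- When the total mass vanishes, so does the part in `Z`, and division by zero yields `0`.
  by_cases h : ∫ z in E, f z = 0
  · have := setIntegral_inter_mem_Icc (Z := Z) hf hf0
    rw [h] at this ⊢
    linarith
  · field_simp

end Steps

end DRAR

end

/-! ### The discrepancy bound -/

open DRAR in
theorem mainTheorem8 (d b t : ℕ) (hd : 1 ≤ d) (hb : 2 ≤ b) :
    ∃ (CS : Set (Fin d → ℝ) → ((Fin d → ℝ) → ℝ) → ((Fin d → ℝ) → ℝ) → ℝ)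
      (CL : Set (Fin d → ℝ) → ((Fin d → ℝ) → ℝ) → ℝ),
    ∀ (k : ℕ) (D : Set (Fin d → ℝ)) (H : ℕ → (Fin d → ℝ) → ℝ),
      MeasurableSet D →
      (∀ l ∈ Finset.Icc 1 k, Measurable (H l) ∧ IntegrableOn (H l) D) →
      (∀ x ∈ D, 0 ≤ DRAR.remainder k H 1 x) →
      0 < ∫ x in D, DRAR.remainder k H 1 x →
      (∀ l ∈ Finset.Icc 1 (k - 1),
        DRAR.IsProductDensityOn (DRAR.regionS D k H l) (H l) ∧
        DRAR.IsPseudoConvex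
          (DRAR.acceptanceSet (DRAR.regionS D k H l) (DRAR.remainder k H l) (H l))) →
      (∀ l ∈ Finset.Icc 1 k, DRAR.IsProductDensityOn (DRAR.regionL D k H l) (H l)) →
      ∀ (x : ℕ → ℕ → Fin (d + 1) → ℝ) (cS cL : ℕ → Fin d → ℝ),
        (∀ l ∈ Finset.Icc 1 k, DRAR.IsSequence b t (x l)) →
        ∀ N : ℕ,
          (∀ l ∈ Finset.Icc 1 (k - 1),
            DRAR.fractionS D k H l = 0 ∨ 2 ≤ DRAR.fractionS D k H l * N) →
          (∀ l ∈ Finset.Icc 1 k,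
            DRAR.fractionL D k H l = 0 ∨ 2 ≤ DRAR.fractionL D k H l * N) →
          DRAR.starDiscrepancy D (DRAR.remainder k H 1) (DRAR.sample D k H cS cL x N)
            ≤ ∑ l ∈ Finset.Icc 1 (k - 1),
                CS (DRAR.regionS D k H l) (DRAR.remainder k H l) (H l)
                  * DRAR.fractionS D k H l ^ (1 - 1 / ((d : ℝ) + 1))
                  * Real.log (DRAR.fractionS D k H l * N) / (N : ℝ) ^ (1 / ((d : ℝ) + 1))
              + ∑ l ∈ Finset.Icc 1 k,
                CL (DRAR.regionL D k H l) (H l)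
                  * Real.log (DRAR.fractionL D k H l * N) ^ d / N
              + 1 / N := by
  classical
  -- The constants must be functions of `(S, ψ, h)` chosen before `k`, `D` and `H` are given.
  -- Triples that do not form an acceptance step receive the default `0`.
  have hconst : ∀ (S : Set (Fin d → ℝ)) (ψ h : (Fin d → ℝ) → ℝ), ∃ C : ℝ, 0 ≤ C ∧
      (IsAcceptanceStep S ψ h → ∀ (x : ℕ → Fin (d + 1) → ℝ) (c : Fin d → ℝ), IsSequence b t x →
        ∀ (y : Fin d → ℝ) (n : ℕ), 1 ≤ n →
          |((acceptedPoints S ψ h c x n).map ((Set.Iic y).indicator fun _ => (1 : ℝ))).sum -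
              n * ((∫ z in S ∩ Set.Iic y, ψ z) / ∫ z in S, ψ z)| ≤
            C * (n : ℝ) ^ (1 - 1 / ((d : ℝ) + 1))) := by
    intro S ψ h
    by_cases hS : IsAcceptanceStep S ψ h
    · obtain ⟨C, hC, hbound⟩ := hS.exists_abs_sum_sub_le t hd hb
      exact ⟨C, hC, fun _ => hbound⟩
    · exact ⟨0, le_rfl, fun h => absurd h hS⟩
  choose CA hCA0 hCA using hconst
  obtain ⟨CB, hCB0, hCB⟩ := exists_abs_sum_invertedPoints_sub_le (d := d) t hd hb
  refine ⟨fun S ψ h => (2 * CA S ψ h + 1) / Real.log 2,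
    fun _ _ => CB * 2 ^ d + (1 / Real.log 2) ^ d, ?_⟩
  intro k D H hD hH h0 hpos hSprod hLprod x cS cL hx N hNS hNL
  have hHm := fun l hl => (hH l hl).1
  have hHi := fun l hl => (hH l hl).2
  set θ : ℝ := 1 - 1 / ((d : ℝ) + 1) with hθ
  have hd1 : (1 : ℝ) ≤ d := by exact_mod_cast hd
  have hθ0 : 0 < θ := by
    rw [hθ, sub_pos, div_lt_one (by linarith)]
    linarith
  have hθ1 : θ ≤ 1 := by
    have : 0 ≤ 1 / ((d : ℝ) + 1) := by positivity
    linarith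
  have hSi : ∀ l ∈ Finset.Icc 1 k, IntegrableOn (remainder k H l) (regionS D k H l) :=
    fun l hl => (integrableOn_remainder hHi (Finset.mem_Icc.1 hl).1).mono_set (regionS_subset l)
  have hS0 : ∀ l ∈ Finset.Icc 1 k,
      0 ≤ᵐ[volume.restrict (regionS D k H l)] remainder k H l := by
    intro l hl
    have hl' := Finset.mem_Icc.1 hl
    refine (ae_restrict_iff' (measurableSet_regionS hD hHm hl)).2 (ae_of_all _ fun z hz => ?_)
    have := remainder_nonneg h0 (l := l - 1) (by omega) z hz.1
    rwa [Nat.sub_add_cancel hl'.1] at this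
  have hLi : ∀ l ∈ Finset.Icc 1 k, IntegrableOn (H l) (regionL D k H l) :=
    fun l hl => (hHi l hl).mono_set (regionL_subset l)
  have hL0 : ∀ l ∈ Finset.Icc 1 k, 0 ≤ᵐ[volume.restrict (regionL D k H l)] H l :=
    fun l hl => (hLprod l hl).ae_nonneg (measurableSet_regionL hD hHm (Finset.mem_Icc.1 hl).2)
  have hα0 : ∀ l ∈ Finset.Icc 1 k, 0 ≤ fractionS D k H l := fun l hl =>
    div_nonneg (integral_nonneg_of_ae (hS0 l hl)) hpos.le
  have hβ0 : ∀ l ∈ Finset.Icc 1 k, 0 ≤ fractionL D k H l := fun l hl =>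
    div_nonneg (integral_nonneg_of_ae (hL0 l hl)) hpos.le
  have hαk : fractionS D k H k = 0 := by simp [fractionS, regionS_last]
  have hsum1 : ∑ l ∈ Finset.Icc 1 k, (fractionS D k H l + fractionL D k H l) = 1 := by
    have h := setIntegral_remainder_eq hD hH MeasurableSet.univ
    simp only [Set.inter_univ] at h
    simp only [fractionS, fractionL, ← add_div]
    rw [← Finset.sum_div, ← h, div_self hpos.ne']
  have hNS' : ∀ l ∈ Finset.Icc 1 k, fractionS D k H l = 0 ∨
      (l ∈ Finset.Icc 1 (k - 1) ∧ 2 ≤ fractionS D k H l * N) := by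
    intro l hl
    by_cases hlk : l = k
    · exact Or.inl (hlk ▸ hαk)
    · have hl' : l ∈ Finset.Icc 1 (k - 1) := by
        rw [Finset.mem_Icc] at hl ⊢
        omega
      exact (hNS l hl').imp_right fun h => ⟨hl', h⟩
  -- For `N = 0` the size conditions would force all fractions to vanish, although they sum to `1`.
  have hN : 1 ≤ N := by
    by_contra hN
    have hN0 : N = 0 := by omega
    subst hN0
    rw [Finset.sum_eq_zero] at hsum1
    · exact zero_ne_one hsum1
    · intro l hl
      rcases hNS' l hl with h1 | ⟨-, h1⟩
      · rcases hNL l hl with h2 | h2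
        · rw [h1, h2, add_zero]
        · norm_num at h2
      · norm_num at h1
  set errS : ℕ → ℝ := fun l => (2 * CA (regionS D k H l) (remainder k H l) (H l) + 1) /
    Real.log 2 * (fractionS D k H l * N) ^ θ * Real.log (fractionS D k H l * N) with herrS
  set errL : ℕ → ℝ := fun l => (CB * 2 ^ d + (1 / Real.log 2) ^ d) *
    Real.log (fractionL D k H l * N) ^ d with herrL
  have hbound : ∀ y : Fin d → ℝ,
      |(1 / (Multiset.card (sample D k H cS cL x N) : ℝ)) *
          ((sample D k H cS cL x N).map ((Set.Iic y).indicator fun _ => (1 : ℝ))).sum -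
        (1 / ∫ z in D, remainder k H 1 z) * ∫ z in D ∩ Set.Iic y, remainder k H 1 z| ≤
      (∑ l ∈ Finset.Icc 1 k, errS l + ∑ l ∈ Finset.Icc 1 k, errL l) / N := by
    intro y
    set f := (Set.Iic y).indicator fun _ => (1 : ℝ) with hf
    -- The two families of pieces are indexed by a disjoint union of two copies of `1, …, k`.
    have hcomb := abs_combined_sub_le ((Finset.Icc 1 k).disjSum (Finset.Icc 1 k))
      (γ := Sum.elim (fractionS D k H) (fractionL D k H))
      (a := Sum.elim
        (fun l => ((acceptedPoints (regionS D k H l) (remainder k H l) (H l) (cS l) (x l)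
          ⌈(N : ℝ) * fractionS D k H l⌉₊).map f).sum)
        (fun l => ((invertedPoints (regionL D k H l) (H l) (cL l) (x l)
          ⌈(N : ℝ) * fractionL D k H l⌉₊).map f).sum))
      (μ := Sum.elim
        (fun l => (∫ z in regionS D k H l ∩ Set.Iic y, remainder k H l z) /
          ∫ z in regionS D k H l, remainder k H l z)
        (fun l => (∫ z in regionL D k H l ∩ Set.Iic y, H l z) / ∫ z in regionL D k H l, H l z))
      (err := Sum.elim errS errL) hN ?_ ?_ ?_ ?_
    · simp only [Finset.sum_disjSum, Sum.elim_inl, Sum.elim_inr] at hcomb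
      have hcard : Multiset.card (sample D k H cS cL x N) =
          ∑ l ∈ Finset.Icc 1 k, ⌈(N : ℝ) * fractionS D k H l⌉₊ +
            ∑ l ∈ Finset.Icc 1 k, ⌈(N : ℝ) * fractionL D k H l⌉₊ := by
        rw [sample, Multiset.card_sum, ← Finset.sum_add_distrib]
        simp [acceptedPoints, invertedPoints]
      have hmap : ((sample D k H cS cL x N).map f).sum =
          ∑ l ∈ Finset.Icc 1 k, ((acceptedPoints (regionS D k H l) (remainder k H l) (H l) (cS l)
            (x l) ⌈(N : ℝ) * fractionS D k H l⌉₊).map f).sum +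
          ∑ l ∈ Finset.Icc 1 k, ((invertedPoints (regionL D k H l) (H l) (cL l) (x l)
            ⌈(N : ℝ) * fractionL D k H l⌉₊).map f).sum := by
        have h := map_sum (Multiset.sumAddMonoidHom.comp (Multiset.mapAddMonoidHom f))
          (fun l => acceptedPoints (regionS D k H l) (remainder k H l) (H l) (cS l) (x l)
            ⌈(N : ℝ) * fractionS D k H l⌉₊ + invertedPoints (regionL D k H l) (H l) (cL l) (x l)
            ⌈(N : ℝ) * fractionL D k H l⌉₊) (Finset.Icc 1 k)
        rw [sample, ← Finset.sum_add_distrib]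
        refine h.trans (Finset.sum_congr rfl fun l _ => ?_)
        simp only [AddMonoidHom.comp_apply, Multiset.coe_mapAddMonoidHom,
          Multiset.coe_sumAddMonoidHom, Multiset.map_add, Multiset.sum_add]
      have htarget : (1 / ∫ z in D, remainder k H 1 z) *
          ∫ z in D ∩ Set.Iic y, remainder k H 1 z =
          ∑ l ∈ Finset.Icc 1 k, fractionS D k H l *
            ((∫ z in regionS D k H l ∩ Set.Iic y, remainder k H l z) /
              ∫ z in regionS D k H l, remainder k H l z) +
          ∑ l ∈ Finset.Icc 1 k, fractionL D k H l *
            ((∫ z in regionL D k H l ∩ Set.Iic y, H l z) / ∫ z in regionL D k H l, H l z) := by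
        rw [setIntegral_remainder_eq hD hH measurableSet_Iic, ← Finset.sum_add_distrib,
          Finset.mul_sum]
        refine Finset.sum_congr rfl fun l hl => ?_
        simp only [fractionS, fractionL, div_mul_eq_mul_div, one_mul]
        rw [← setIntegral_inter_eq_mul (hSi l hl) (hS0 l hl),
          ← setIntegral_inter_eq_mul (hLi l hl) (hL0 l hl), add_div]
      rw [hcard, hmap, htarget]
      exact hcomb
    · rintro (l | l) hl
      · exact hα0 l (Finset.inl_mem_disjSum.1 hl)
      · exact hβ0 l (Finset.inr_mem_disjSum.1 hl)
    · simp only [Finset.sum_disjSum, Sum.elim_inl, Sum.elim_inr]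
      rw [← Finset.sum_add_distrib, hsum1]
    · rintro (l | l) hl
      · have hl' := Finset.inl_mem_disjSum.1 hl
        have h := setIntegral_inter_mem_Icc (Z := Set.Iic y) (hSi l hl') (hS0 l hl')
        exact ⟨div_nonneg h.1 (h.1.trans h.2), div_le_one_of_le₀ h.2 (h.1.trans h.2)⟩
      · have hl' := Finset.inr_mem_disjSum.1 hl
        have h := setIntegral_inter_mem_Icc (Z := Set.Iic y) (hLi l hl') (hL0 l hl')
        exact ⟨div_nonneg h.1 (h.1.trans h.2), div_le_one_of_le₀ h.2 (h.1.trans h.2)⟩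
    · rintro (l | l) hl
      · have hl' := Finset.inl_mem_disjSum.1 hl
        rcases hNS' l hl' with hz | ⟨hlk, h2⟩
        -- An empty piece contributes no points, and its bound is `0` because `Real.log 0 = 0`.
        · simp [hz, acceptedPoints, herrS]
        · have hne : fractionS D k H l ≠ 0 := by
            intro hz
            rw [hz, zero_mul] at h2
            norm_num at h2
          have hmass : 0 < ∫ z in regionS D k H l, remainder k H l z := by
            refine lt_of_le_of_ne (integral_nonneg_of_ae (hS0 l hl')) fun hz => hne ?_
            rw [fractionS, ← hz, zero_div]
          have hstep := isAcceptanceStep_regionS hD hH h0 hl' (hSprod l hlk).1 (hSprod l hlk).2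
            hmass
          have hne' : ¬ Sum.elim (fractionS D k H) (fractionL D k H) (Sum.inl l) = 0 := hne
          rw [if_neg hne']
          simp only [Sum.elim_inl, herrS]
          rw [mul_comm (N : ℝ)]
          refine le_trans ?_ (rpow_ceil_add_one_le (hCA0 _ _ _) hθ0.le hθ1 h2)
          have hceil := (ceil_le_two_mul h2).1
          exact add_le_add_left (hCA _ _ _ hstep (x l) (cS l) (hx l hl') y _ (by omega)) 1
      · have hl' := Finset.inr_mem_disjSum.1 hl
        rcases hNL l hl' with hz | h2
        -- The bound of an empty piece contains `Real.log 0 ^ d`, which is `0` only for `d ≠ 0`.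
        · have : d ≠ 0 := by omega
          simp [hz, invertedPoints, this, herrL]
        · have hne : fractionL D k H l ≠ 0 := by
            intro hz
            rw [hz, zero_mul] at h2
            norm_num at h2
          have hmass : 0 < ∫ z in regionL D k H l, H l z := by
            refine lt_of_le_of_ne (integral_nonneg_of_ae (hL0 l hl')) fun hz => hne ?_
            rw [fractionL, ← hz, zero_div]
          have hne' : ¬ Sum.elim (fractionS D k H) (fractionL D k H) (Sum.inr l) = 0 := hne
          rw [if_neg hne']
          simp only [Sum.elim_inr, herrL]
          rw [mul_comm (N : ℝ)]
          refine le_trans ?_ (log_ceil_pow_add_one_le hCB0 h2 d)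
          exact add_le_add_left (hCB _ _ (measurableSet_regionL hD hHm (Finset.mem_Icc.1 hl').2)
            (hLprod l hl') hmass (x l) (cL l) (hx l hl') y _ (ceil_le_two_mul h2).1) 1
  refine (ciSup_le hbound).trans ?_
  have hSsum : (∑ l ∈ Finset.Icc 1 k, errS l) / N = ∑ l ∈ Finset.Icc 1 (k - 1),
      (2 * CA (regionS D k H l) (remainder k H l) (H l) + 1) / Real.log 2
        * fractionS D k H l ^ θ * Real.log (fractionS D k H l * N) /
          (N : ℝ) ^ (1 / ((d : ℝ) + 1)) := by
    have hsub : Finset.Icc 1 (k - 1) ⊆ Finset.Icc 1 k :=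
      Finset.Icc_subset_Icc_right (Nat.sub_le k 1)
    -- The term `l = k` drops out since its region is empty.
    rw [← Finset.sum_subset hsub, Finset.sum_div]
    · exact Finset.sum_congr rfl fun l hl => rpow_scaling hN (hα0 l (hsub hl)) _ hθ
    · intro l hl hl'
      rcases hNS' l hl with hz | ⟨h, -⟩
      · simp [herrS, hz]
      · exact absurd h hl'
  rw [add_div, hSsum, Finset.sum_div]
  have : (0 : ℝ) ≤ 1 / N := by positivity
  linarith
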